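/- **Setting.** Let $d\ge 2$ and let $\Omega\subset\mathbb R^d$ be a bounded domain that is polyhedral (it is triangulated by the meshes below). Write $\|\cdot\|_{0,G}$, $\|\cdot\|_{1,G}$ for the norms of $L_2(G)$, $H^1(G)$ (complex-valued functions; $G=\Omega$ if omitted), and for $U\subset\Omega$ $$a_U(u,v)=\int_U\Big(\sum_{i,j}a_{ij}\partial_iu\,\partial_j\bar v+\sum_i b_i\,\partial_iu\,\bar v+c\,u\bar v\Big)dx,\qquad b_U(u,v)=\int_U m\,u\bar v\,dx ,$$ $a=a_\Omega$, $b=b_\Omega$. Assume $a_{ij},b_i\in W^{1,\infty}(\Omega)$ and $c\in L^\infty(\Omega)$ (real or complex), $m\in L^\infty(\Omega)$ real and bounded below by a positive constant, $\operatorname{Re}\sum a_{ij}(x)\xi_i\xi_j\ge a_0|\xi|^2$ for almost all $x\in\Omega$ and all $\xi\in\mathbb R^d$ with some $a_0>0$, and $\operatorname{Re}a(u,u)\ge\frac12a_0\|u\|_1^2$ for all $u\in H^1(\Omega)$. Let $\lambda\in\mathbb C$, $\lambda^*=\bar\lambda$, and $$M(\lambda)=\{u\in H^1_0(\Omega): a(u,v)=\lambda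 b(u,v)\ \forall v\in H_0^1(\Omega)\},\quad M^*(\lambda^*)=\{u^*\in H^1_0(\Omega): a(v,u^*)=\overline{\lambda^*}\, b(v,u^*)\ \forall v\in H_0^1(\Omega)\}.$$ For $D\subset U\subset\Omega$, $D\subset\subset U$ means $\operatorname{dist}(\partial D\setminus\partial\Omega,\partial U\setminus\partial\Omega)>0$ (the distance to $\emptyset$ being $+\infty$). Let $l\ge1$ and let $\Omega\supset\Omega_1\supset\dots\supset\Omega_l$ and $D,F,G_1,\dots,G_l$ be open sets with $D\subset\subset F\subset\subset G_i\subset\subset\Omega_i$ for $1\le i\le l$. **Local regularity.** Let $\gamma_1,\gamma_2\in(0,1]$. $R(G)$ means: there is a constant $C_G$ such that for every $f\in L_2(G)$ there is $\phi\in H_0^1(G)\cap H^{1+\gamma_1}(G)$ with $a_G(\phi,v)=b_G(f,v)$ for all $v\in H_0^1(G)$ and $\|\phi\|_{1+\gamma_1,G}\le C_G\|f\|_{-1+\gamma_1,G}$; and for every $g\in L_2(G)$ there is $\varphi\in H_0^1(G)\cap H^{1+\gamma_2}(G)$ with $a_G(v,\varphi)=b_G(v,g)$ for all $v\in H_0^1(G)$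 and $\|\varphi\|_{1+\gamma_2,G}\le C_G\|g\|_{-1+\gamma_2,G}$. (Sobolev–Slobodeckij norms; $H^{-s}(G)$ is the dual of $H^s_0(G)$, the closure of $C_c^\infty(G)$ in $H^s(G)$.) **Meshes and finite element spaces.** Fix $r\ge1$, $\kappa>0$, $\nu\ge1$, $C_0>0$, $\beta>0$. For $-1\le i\le l$ let $\pi_{h_i}(\Omega)$ be a conforming mesh of $\Omega$ by simplices $\tau$, of mesh diameter $h_i=\max_\tau\operatorname{diam}\tau$, whose closed elements cover $\overline\Omega$ and such that $\partial\Omega$ is a union of faces of dimension $d-1$ (write $H=h_{-1}$, $w=h_0$). The meshes are shape regular (each $\tau$ contains a ball of radius $\kappa\operatorname{diam}\tau$) and satisfy $h_i^\nu\le C_0\operatorname{diam}\tau$ for all elements $\tau$. Let $V_{h_i}(\Omega)$ be the space of functions in $C(\overline\Omega)$ that are polynomials of degree at most $r$ on each element and, for $U\subset\Omega$, $V^0_{h_i}(U)=V_{h_i}(\Omega)|_U\cap H^1_0(U)$. Assume $V^0_{H}(\Omega)\subset V^0_{w}(\Omega)\subset V^0_{h_1}(\Omega)\subset\dots\subset V^0_{h_l}(\Omega)$,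 and that $\Omega_i$ aligns with $\pi_{h_{i-1}}(\Omega)$ and $\pi_{h_i}(\Omega)$ ($\partial\Omega_i$ is a union of $(d-1)$-dimensional faces) for $1\le i\le l$. The Ritz projections $P_{h}u,P^*_{h}u\in V^0_{h}(\Omega)$ are given by $a(u-P_{h}u,v)=0=a(v,u-P_h^*u)$ for all $v\in V^0_{h}(\Omega)$. **Scheme.** (1) $(\lambda_H,u_H)\in\mathbb C\times V_H^0(\Omega)$ with $\|u_H\|_0=1$ and $a(u_H,v)=\lambda_Hb(u_H,v)$ for all $v\in V_H^0(\Omega)$; $\lambda_H^*=\overline{\lambda_H}$; $u_H^*\in V_H^0(\Omega)$, $\|u_H^*\|_0=1$, is a generalized eigenfunction of $T_H^*$ for the eigenvalue $1/\lambda_H^*$, where $T_H^*f\in V_H^0(\Omega)$ is given by $a(v,T_H^*f)=b(v,f)$ for all $v\in V_H^0(\Omega)$; and $|b(u_H,u_H^*)|\ge\beta$. Put $(\lambda^{w,h_{-1}},u^{w,h_{-1}})=(\lambda_H,u_H)$, $(\lambda^{w,h_{-1}*},u^{w,h_{-1}*})=(\lambda_H^*,u_H^*)$. (2) $u^{w,h_0},u^{w,h_0*}\in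 V_w^0(\Omega)$ satisfy $a(u^{w,h_0},v)=\lambda_Hb(u_H,v)$ and $a(v,u^{w,h_0*})=\lambda_Hb(v,u_H^*)$ for all $v\in V_w^0(\Omega)$. (3) For $i=1,\dots,l$: $e^{h_i},e^{h_i*}\in V_{h_i}^0(\Omega_i)$ satisfy, for all $v\in V_{h_i}^0(\Omega_i)$, $$a_{\Omega_i}(e^{h_i},v)=\lambda^{w,h_{i-1}}b_{\Omega_i}(u^{w,h_{i-1}},v)-a_{\Omega_i}(u^{w,h_{i-1}},v),\qquad a_{\Omega_i}(v,e^{h_i*})=\overline{\lambda^{w,h_{i-1}*}}\,b_{\Omega_i}(v,u^{w,h_{i-1}*})-a_{\Omega_i}(v,u^{w,h_{i-1}*}),$$ and $u^{w,h_i}=u^{w,h_{i-1}}+e^{h_i}$, $u^{w,h_i*}=u^{w,h_{i-1}*}+e^{h_i*}$ on $\overline\Omega_i$, while $u^{w,h_i}=u^{w,h_{i-1}}$, $u^{w,h_i*}=u^{w,h_{i-1}*}$ on $\Omega\setminus\overline\Omega_i$. Here, for $i\ge 0$, $\lambda^{w,h_i}=a(u^{w,h_i},u^{w,h_i*})/b(u^{w,h_i},u^{w,h_i*})$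 and $\lambda^{w,h_i*}=\overline{\lambda^{w,h_i}}$; the denominators are assumed non-zero for $0\le i<l$. **Theorem 4.2.** Assume that $R(\Omega_i)$ holds for $i=1,\dots,l$. Then there is a constant $C>0$, independent of the meshes, of the functions and numbers produced by the scheme, and of $u$ and $u^*$, such that for all such meshes, every run of the scheme, all $u\in M(\lambda)$ and all $u^*\in M^*(\lambda^*)$, $$\begin{aligned}\|u^{w,h_l}-P_{h_l}u\|_{1,\Omega}\le C\Big(&\|u-P_{h_l}u\|_{0,\Omega_l}+h_{l-1}^{\gamma_2}\|P_{h_l}u-u^{w,h_{l-1}}\|_{1,\Omega_l}+\|\lambda u-\lambda^{w,h_{l-2}}u^{w,h_{l-2}}\|_{0,\Omega_l}\\&+\|\lambda^{w,h_{l-1}}u^{w,h_{l-1}}-\lambda u\|_0+\|u^{w,h_{l-1}}-P_{h_l}u\|_{1,\Omega\setminus\overline{G_l}}+\|u^{w,h_{l-1}}-u\|_{1,\Omega_l\setminus\overline F}\Big),\\ \|u^{w,h_l*}-P^*_{h_l}u^*\|_{1,\Omega}\le C\Big(&\|u^*-P^*_{h_l}u^*\|_{0,\Omega_l}+h_{l-1}^{\gamma_1}\|P^*_{h_l}u^*-u^{w,h_{l-1}*}\|_{1,\Omega_l}+\|\lambda^*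 u^*-\lambda^{w,h_{l-2}*}u^{w,h_{l-2}*}\|_{0,\Omega_l}\\&+\|\lambda^{w,h_{l-1}*}u^{w,h_{l-1}*}-\lambda^* u^*\|_0+\|u^{w,h_{l-1}*}-P^*_{h_l}u^*\|_{1,\Omega\setminus\overline{G_l}}+\|u^{w,h_{l-1}*}-u^*\|_{1,\Omega_l\setminus\overline F}\Big).\end{aligned}$$ -/

import Mathlib

open MeasureTheory Set
open scoped ContDiff ENNReal NNReal ComplexConjugate

noncomputable section

namespace MultilevelFEM

/-- Euclidean `d`-space. -/
abbrev E (d : ℕ) : Type := EuclideanSpace ℝ (Fin d)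

variable {d : ℕ}

/-! ## Sobolev spaces on an open set

Functions on an open set `U` are represented by functions on the whole space whose values outside
`U` are irrelevant; all notions below depend only on the class modulo null sets of `U`. -/

/-- Lebesgue measure on `U`. -/
abbrev vol (U : Set (E d)) : Measure (E d) := volume.restrict U

/-- The classical partial derivative `∂ᵢφ`. -/
def pderiv (i : Fin d) (φ : E d → ℂ) (x : E d) : ℂ :=
  fderiv ℝ φ x (EuclideanSpace.single i 1)

/-- `φ ∈ C_c^∞(U)`. -/
def IsTest (U : Set (E d)) (φ : E d → ℂ) : Prop :=
  ContDiff ℝ ∞ φ ∧ HasCompactSupport φ ∧ tsupport φ ⊆ U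

/-- `g` is a weak (distributional) gradient of `u` on `U`. -/
def HasWeakGrad (U : Set (E d)) (u : E d → ℂ) (g : Fin d → E d → ℂ) : Prop :=
  ∀ φ, IsTest U φ → ∀ i, ∫ x in U, u x * pderiv i φ x = -∫ x in U, g i x * φ x

/-- `u ∈ W^{1,p}(U)`. -/
def MemW1 (p : ℝ≥0∞) (U : Set (E d)) (u : E d → ℂ) : Prop :=
  MemLp u p (vol U) ∧ ∃ g : Fin d → E d → ℂ, (∀ i, MemLp (g i) p (vol U)) ∧ HasWeakGrad U u g

/-- `u ∈ H¹(U)`. -/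
abbrev MemH1 (U : Set (E d)) (u : E d → ℂ) : Prop := MemW1 2 U u

open Classical in
/-- The `L²` weak gradient of `u` on `U` (it is unique up to null sets), for `u ∈ H¹(U)`. -/
def weakGrad (U : Set (E d)) (u : E d → ℂ) : Fin d → E d → ℂ :=
  if h : ∃ g : Fin d → E d → ℂ, (∀ i, MemLp (g i) 2 (vol U)) ∧ HasWeakGrad U u g
  then h.choose else 0

/-- `‖u‖_{0,U}`. -/
def norm0 (U : Set (E d)) (u : E d → ℂ) : ℝ :=
  √(∫ x in U, ‖u x‖ ^ 2)

/-- `‖u‖_{1,U}`, for `u ∈ H¹(U)`. -/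
def norm1 (U : Set (E d)) (u : E d → ℂ) : ℝ :=
  √((∫ x in U, ‖u x‖ ^ 2) + ∑ i, ∫ x in U, ‖weakGrad U u i x‖ ^ 2)

/-- `u ∈ H¹₀(U)`, the closure of `C_c^∞(U)` in `H¹(U)`. -/
def MemH10 (U : Set (E d)) (u : E d → ℂ) : Prop :=
  MemH1 U u ∧ ∀ ε : ℝ, 0 < ε → ∃ φ, IsTest U φ ∧ norm1 U (u - φ) < ε

open Classical in
/-- The square of the Sobolev–Slobodeckij seminorm of order `s ∈ [0, 1]`:
nothing for `s = 0`, the squared `L²` norm of the gradient for `s = 1`,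
and the Gagliardo double integral for `0 < s < 1`. -/
def semiSq (s : ℝ) (U : Set (E d)) (g : E d → ℂ) : ℝ≥0∞ :=
  if s = 0 then 0
  else if s = 1 then
    if MemH1 U g then ∑ i, ∫⁻ x in U, ‖weakGrad U g i x‖ₑ ^ 2 else ⊤
  else ∫⁻ x in U, ∫⁻ y in U, ‖g x - g y‖ₑ ^ 2 / ENNReal.ofReal (dist x y ^ ((d : ℝ) + 2 * s))

/-- The norm of `H^s(U)`, `0 ≤ s ≤ 1`, for `g ∈ L²(U)` (infinite if `g ∉ H^s(U)`). -/
def normFrac (s : ℝ) (U : Set (E d)) (g : E d → ℂ) : ℝ≥0∞ :=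
  ((∫⁻ x in U, ‖g x‖ₑ ^ 2) + semiSq s U g) ^ (1 / 2 : ℝ)

/-- The norm of `H^{1+γ}(U)`, `0 ≤ γ ≤ 1`, for `u ∈ H¹(U)` (infinite if `u ∉ H^{1+γ}(U)`). -/
def normOnePlus (γ : ℝ) (U : Set (E d)) (u : E d → ℂ) : ℝ≥0∞ :=
  ((∫⁻ x in U, ‖u x‖ₑ ^ 2) + ∑ i, ((∫⁻ x in U, ‖weakGrad U u i x‖ₑ ^ 2)
    + semiSq γ U (weakGrad U u i))) ^ (1 / 2 : ℝ)

/-- `u ∈ H^{1+γ}(U)`. -/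
def MemHOnePlus (γ : ℝ) (U : Set (E d)) (u : E d → ℂ) : Prop :=
  MemH1 U u ∧ normOnePlus γ U u < ⊤

/-- The norm of `H^{-s}(U)`, the dual of `H^s₀(U)`, `0 ≤ s ≤ 1`, of a function `f ∈ L²(U)`; the
supremum runs over the dense subspace `C_c^∞(U)` of `H^s₀(U)`. -/
def normNeg (s : ℝ) (U : Set (E d)) (f : E d → ℂ) : ℝ≥0∞ :=
  ⨆ φ : E d → ℂ, ⨆ _ : IsTest U φ ∧ normFrac s U φ ≤ 1, ‖∫ x in U, f x * conj (φ x)‖ₑ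

/-! ## The differential operator and its sesquilinear forms -/

/-- The coefficients `a_{ij}, b_i, c` of the operator `L` and the weight `m`. -/
structure Coeffs (d : ℕ) where
  a : Fin d → Fin d → E d → ℂ
  b : Fin d → E d → ℂ
  c : E d → ℂ
  m : E d → ℝ

/-- `a(u, v)`, with integration over `U`. -/
def aForm (𝒞 : Coeffs d) (U : Set (E d)) (u v : E d → ℂ) : ℂ :=
  ∫ x in U, ((∑ i, ∑ j, 𝒞.a i j x * weakGrad U u i x * conj (weakGrad U v j x))
    + (∑ i, 𝒞.b i x * weakGrad U u i x * conj (v x)) + 𝒞.c x * u x * conj (v x))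

/-- `b(u, v)`, with integration over `U`. -/
def bForm (𝒞 : Coeffs d) (U : Set (E d)) (u v : E d → ℂ) : ℂ :=
  ∫ x in U, (𝒞.m x : ℂ) * u x * conj (v x)

/-- The assumptions on the coefficients: `a_{ij}, b_i ∈ W^{1,∞}(Ω)`, `c ∈ L^∞(Ω)`, `m ∈ L^∞(Ω)`
real and bounded below by a positive constant, uniform strong ellipticity with constant `a₀`, and
the coercivity of `a` on `H¹(Ω)`. -/
structure Admissible (Ω : Set (E d)) (𝒞 : Coeffs d) (a₀ : ℝ) : Prop where
  a_mem : ∀ i j, MemW1 ∞ Ω (𝒞.a i j)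
  b_mem : ∀ i, MemW1 ∞ Ω (𝒞.b i)
  c_mem : MemLp 𝒞.c ∞ (vol Ω)
  m_mem : MemLp 𝒞.m ∞ (vol Ω)
  m_pos : ∃ m₀ : ℝ, 0 < m₀ ∧ ∀ᵐ x ∂(vol Ω), m₀ ≤ 𝒞.m x
  a₀_pos : 0 < a₀
  elliptic : ∀ᵐ x ∂(vol Ω), ∀ ξ : Fin d → ℝ,
    a₀ * ∑ i, ξ i ^ 2 ≤ (∑ i, ∑ j, 𝒞.a i j x * (ξ i : ℂ) * (ξ j : ℂ)).re
  coercive : ∀ u, MemH1 Ω u → a₀ / 2 * norm1 Ω u ^ 2 ≤ (aForm 𝒞 Ω u u).re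

/-- `u` belongs to the space of eigenfunctions of `a(u, v) = lam b(u, v)`, `v ∈ H¹₀(Ω)`. -/
def IsEigen (𝒞 : Coeffs d) (Ω : Set (E d)) (lam : ℂ) (u : E d → ℂ) : Prop :=
  MemH10 Ω u ∧ ∀ v, MemH10 Ω v → aForm 𝒞 Ω u v = lam * bForm 𝒞 Ω u v

/-- `u` belongs to the space of eigenfunctions of the adjoint problem
`a(v, u) = conj lamS * b(v, u)`, `v ∈ H¹₀(Ω)`, for the adjoint eigenvalue `lamS`. -/
def IsAdjEigen (𝒞 : Coeffs d) (Ω : Set (E d)) (lamS : ℂ) (u : E d → ℂ) : Prop :=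
  MemH10 Ω u ∧ ∀ v, MemH10 Ω v → aForm 𝒞 Ω v u = conj lamS * bForm 𝒞 Ω v u

/-- The local regularity assumption `R(G)`. -/
def LocalRegularity (𝒞 : Coeffs d) (γ₁ γ₂ : ℝ) (G : Set (E d)) : Prop :=
  ∃ C : ℝ≥0,
    (∀ f, MemLp f 2 (vol G) → ∃ φ, MemH10 G φ ∧ MemHOnePlus γ₁ G φ ∧
      (∀ v, MemH10 G v → aForm 𝒞 G φ v = bForm 𝒞 G f v) ∧
      normOnePlus γ₁ G φ ≤ C * normNeg (1 - γ₁) G f) ∧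
    (∀ g, MemLp g 2 (vol G) → ∃ φ, MemH10 G φ ∧ MemHOnePlus γ₂ G φ ∧
      (∀ v, MemH10 G v → aForm 𝒞 G v φ = bForm 𝒞 G v g) ∧
      normOnePlus γ₂ G φ ≤ C * normNeg (1 - γ₂) G g)

/-- `D ⊂⊂ U` relative to `Ω`: `D ⊆ U` and `dist (∂D \ ∂Ω, ∂U \ ∂Ω) > 0`
(the distance to the empty set being `+∞`). -/
def CInside (Ω D U : Set (E d)) : Prop :=
  D ⊆ U ∧ ∃ δ : ℝ, 0 < δ ∧
    ∀ x ∈ frontier D \ frontier Ω, ∀ y ∈ frontier U \ frontier Ω, δ ≤ dist x y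

/-! ## Simplicial meshes and finite element spaces -/

/-- The closed simplex with vertex set `s`. -/
abbrev cell (s : Finset (E d)) : Set (E d) := convexHull ℝ (s : Set (E d))

/-- `U` aligns with the complex `K`: its boundary is a union of `(d-1)`-dimensional faces. -/
def AlignedWith (K : Geometry.SimplicialComplex ℝ (E d)) (U : Set (E d)) : Prop :=
  ∃ Γ ⊆ K.faces, (∀ s ∈ Γ, s.card = d) ∧ frontier U = ⋃ s ∈ Γ, cell s

/-- A (conforming) simplicial mesh of `Ω`: a finite simplicial complex, all of whose maximal
simplices are `d`-dimensional, covering the closure of `Ω` and aligned with `Ω`. (Cracks in `Ω`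
are not excluded.) -/
structure Mesh (Ω : Set (E d)) where
  K : Geometry.SimplicialComplex ℝ (E d)
  finite : K.faces.Finite
  pure : ∀ s ∈ K.faces, ∃ t ∈ K.faces, s ⊆ t ∧ t.card = d + 1
  space_eq : K.space = closure Ω
  aligned : AlignedWith K Ω

/-- The elements (`d`-simplices) of a mesh. -/
def Mesh.elements {Ω : Set (E d)} (T : Mesh Ω) : Set (Finset (E d)) :=
  {s ∈ T.K.faces | s.card = d + 1}

/-- The mesh diameter: the maximal diameter of the elements. -/
def Mesh.size {Ω : Set (E d)} (T : Mesh Ω) : ℝ :=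
  sSup ((fun s => Metric.diam (cell s)) '' T.elements)

/-- Shape regularity: each element `τ` contains a ball of radius `κ · diam τ`. -/
def Mesh.ShapeRegular {Ω : Set (E d)} (T : Mesh Ω) (κ : ℝ) : Prop :=
  ∀ s ∈ T.elements, ∃ x, Metric.ball x (κ * Metric.diam (cell s)) ⊆ cell s

/-- The mesh size condition `h(Ω)^ν ≤ C₀ h_τ` for all elements `τ`. -/
def Mesh.SizeCondition {Ω : Set (E d)} (T : Mesh Ω) (ν C₀ : ℝ) : Prop :=
  ∀ s ∈ T.elements, T.size ^ ν ≤ C₀ * Metric.diam (cell s)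

/-- `v ∈ V_h(Ω)`: continuous on the closure of `Ω`, and a polynomial of degree at most `r` on each
element. -/
def Mesh.IsFE {Ω : Set (E d)} (T : Mesh Ω) (r : ℕ) (v : E d → ℂ) : Prop :=
  ContinuousOn v (closure Ω) ∧ ∀ s ∈ T.elements, ∃ p : MvPolynomial (Fin d) ℂ,
    p.totalDegree ≤ r ∧ ∀ x ∈ cell s, v x = MvPolynomial.eval (fun i => (x i : ℂ)) p

/-- `V_h⁰(U) = V_h(U) ∩ H¹₀(U)`, where `V_h(U)` consists of the restrictions of the functions in
`V_h(Ω)` to `U` (up to the boundary). -/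
def Mesh.V0 {Ω : Set (E d)} (T : Mesh Ω) (r : ℕ) (U : Set (E d)) : Set (E d → ℂ) :=
  {v | (∃ w, T.IsFE r w ∧ EqOn v w (closure U)) ∧ MemH10 U v}

/-- `p = P_h u`, the Ritz projection of `u`. -/
def Mesh.IsRitz {Ω : Set (E d)} (T : Mesh Ω) (r : ℕ) (𝒞 : Coeffs d) (u p : E d → ℂ) : Prop :=
  p ∈ T.V0 r Ω ∧ ∀ v ∈ T.V0 r Ω, aForm 𝒞 Ω (u - p) v = 0

/-- `p = P_h^* u`, the adjoint Ritz projection of `u`. -/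
def Mesh.IsAdjRitz {Ω : Set (E d)} (T : Mesh Ω) (r : ℕ) (𝒞 : Coeffs d) (u p : E d → ℂ) : Prop :=
  p ∈ T.V0 r Ω ∧ ∀ v ∈ T.V0 r Ω, aForm 𝒞 Ω v (u - p) = 0

/-- `(lamS⁻¹ - T_h^*)^k u = 0`, where `T_h^* f ∈ V` is given by `a(v, T_h^* f) = b(v, f)`, `v ∈ V`,
for the discrete space `V`. -/
def IsDiscreteAdjGenEigen (𝒞 : Coeffs d) (Ω : Set (E d)) (V : Set (E d → ℂ)) (lamS : ℂ) :
    ℕ → (E d → ℂ) → Prop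
  | 0, u => u =ᵐ[vol Ω] 0
  | k + 1, u => ∃ w ∈ V, (∀ v ∈ V, aForm 𝒞 Ω v w = bForm 𝒞 Ω v u) ∧
      IsDiscreteAdjGenEigen 𝒞 Ω V lamS k (lamS⁻¹ • u - w)

/-! ## The multilevel scheme -/

/-- The multilevel local defect-correction scheme with levels `-1, 0, 1, …, l`.
`T (-1)` is the coarse mesh `π_H(Ω)`, `T 0` is the mesoscopic mesh `π_w(Ω)`, and `T i` is
`π_{h_i}(Ω)` for `1 ≤ i ≤ l`; the local spaces are `V_{h_i}⁰(Ω_i)` with `Ω_i = W i`.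
`(lam (-1), u (-1))` and `(lamS (-1), uS (-1))` are `(λ_H, u_H)` and `(λ_H^*, u_H^*)`,
`(lam i, u i)` and `(lamS i, uS i)` are the `i`-th iterates, and `e i`, `eS i` the
corrections, for `1 ≤ i ≤ l`. `β` is the lower bound of `|b(u_H, u_H^*)|`. -/
structure IsSchemeRun (𝒞 : Coeffs d) (Ω : Set (E d)) (r : ℕ) (β : ℝ) (l : ℤ)
    (W : ℤ → Set (E d)) (T : ℤ → Mesh Ω) (lam lamS : ℤ → ℂ) (u uS e eS : ℤ → E d → ℂ) :
    Prop where
  /- the coarse eigenvalue problem -/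
  coarse_mem : u (-1) ∈ (T (-1)).V0 r Ω
  coarse_norm : norm0 Ω (u (-1)) = 1
  coarse_eq : ∀ v ∈ (T (-1)).V0 r Ω,
    aForm 𝒞 Ω (u (-1)) v = lam (-1) * bForm 𝒞 Ω (u (-1)) v
  coarse_adj_lam : lamS (-1) = conj (lam (-1))
  coarse_adj_mem : uS (-1) ∈ (T (-1)).V0 r Ω
  coarse_adj_norm : norm0 Ω (uS (-1)) = 1
  coarse_adj_eigen : ∃ k, IsDiscreteAdjGenEigen 𝒞 Ω ((T (-1)).V0 r Ω) (lamS (-1)) k (uS (-1))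
  coarse_pairing : β ≤ ‖bForm 𝒞 Ω (u (-1)) (uS (-1))‖
  /- the linear problems on the mesoscopic mesh -/
  meso_mem : u 0 ∈ (T 0).V0 r Ω
  meso_eq : ∀ v ∈ (T 0).V0 r Ω, aForm 𝒞 Ω (u 0) v = lam (-1) * bForm 𝒞 Ω (u (-1)) v
  meso_adj_mem : uS 0 ∈ (T 0).V0 r Ω
  meso_adj_eq : ∀ v ∈ (T 0).V0 r Ω,
    aForm 𝒞 Ω v (uS 0) = lam (-1) * bForm 𝒞 Ω v (uS (-1))
  /- the Rayleigh quotients -/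
  rayleigh : ∀ i, 0 ≤ i → i ≤ l → lam i = aForm 𝒞 Ω (u i) (uS i) / bForm 𝒞 Ω (u i) (uS i)
  rayleigh_den : ∀ i, 0 ≤ i → i < l → bForm 𝒞 Ω (u i) (uS i) ≠ 0
  rayleigh_adj : ∀ i, 0 ≤ i → i ≤ l → lamS i = conj (lam i)
  /- the local defect corrections -/
  corr_mem : ∀ i, 1 ≤ i → i ≤ l → e i ∈ (T i).V0 r (W i)
  corr_eq : ∀ i, 1 ≤ i → i ≤ l → ∀ v ∈ (T i).V0 r (W i),
    aForm 𝒞 (W i) (e i) v =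
      lam (i - 1) * bForm 𝒞 (W i) (u (i - 1)) v - aForm 𝒞 (W i) (u (i - 1)) v
  corr_adj_mem : ∀ i, 1 ≤ i → i ≤ l → eS i ∈ (T i).V0 r (W i)
  corr_adj_eq : ∀ i, 1 ≤ i → i ≤ l → ∀ v ∈ (T i).V0 r (W i),
    aForm 𝒞 (W i) v (eS i) =
      conj (lamS (i - 1)) * bForm 𝒞 (W i) v (uS (i - 1)) - aForm 𝒞 (W i) v (uS (i - 1))
  /- the updates -/
  update : ∀ i, 1 ≤ i → i ≤ l → u i = u (i - 1) + (closure (W i)).indicator (e i)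
  update_adj : ∀ i, 1 ≤ i → i ≤ l → uS i = uS (i - 1) + (closure (W i)).indicator (eS i)

end MultilevelFEM

end

noncomputable section

namespace MultilevelFEM

variable {d : ℕ}

/-! ### Test functions -/

/-! The proof is an energy argument on the finest level. Write U for the iterate of level l - 1, W
and G for Ω_l and G_l, p for the Ritz projection of u on level l, and ē for the last correction
extended by zero. The defect equation, the eigenvalue equation and the Ritz property combine to a(U
+ ē - p, v) = b(g, v) with g = λ^{w,h_{l-1}} U - λ u, for every v in the local space on W, extended
by zero.

The error itself is no admissible v, because U - p need not vanish on the boundary of W. It is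
therefore cut off: `Mesh.exists_cutoff_approx` gives v₀ in the local space with ‖v₀ - (U - p)‖₁ ≤ C
‖U - p‖₁ on Ω \ closure G. Put η = v₀ - (U - p) and v = ē + v₀, so that the error is v - η. Testing
with v gives a(v, v) = b(g, v) + a(η, v), and coercivity bounds ‖v‖₁ by ‖g‖₀ + ‖η‖₁ up to a constant
(`exists_local_correction_estimate`). Both quantities are controlled by terms of the asserted bound;
its four other terms are nonnegative. The adjoint estimate is the same with the two slots exchanged.

The work lies in v₀, whose constant may depend on d, r, the shape regularity, the gap between G and
W and the diameter of Ω, but not on the mesh. Multiplying by a piecewise linear cutoff χ would raise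
the degree. Instead the polynomial P of an element is replaced by the sum over the vertices v of
w_v(x) χ(v) (P(x) + r⁻¹ DP(x)(v - x)), with w_v the barycentric coordinates. The bracket is the
polar form of P with r - 1 arguments x and one argument v. Hence the degree stays at most r, the
result is P if χ = 1 at all vertices, and on a face only the data of that face enter, which allows
gluing. An element where some vertex value is below one contains a ball of comparable size outside
closure G; polynomial norm equivalence controls the whole element from this ball
(`exists_cell_estimate`, `exists_cutoff_estimate`). No smallness of the mesh size is needed.

Two facts relate H¹₀ to boundary values. Lipschitz functions vanishing off U lie in H¹₀(U)
(`memH10_of_lipschitzWith`), which makes the constructed functions admissible. Conversely, a finite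
element function in H¹₀(W) vanishes on the boundary of W (`Mesh.pev_eq_zero_of_face`), so local
corrections extend by zero. -/

theorem pderiv_eq_zero_of_notMem_tsupport {φ : E d → ℂ} {x : E d} (hx : x ∉ tsupport φ)
    (i : Fin d) : pderiv i φ x = 0 := by
  have h : fderiv ℝ φ x = 0 := by
    by_contra h
    exact hx (support_fderiv_subset ℝ (Function.mem_support.2 h))
  simp [pderiv, h]

theorem continuous_pderiv {φ : E d → ℂ} (h : ContDiff ℝ ∞ φ) (i : Fin d) :
    Continuous (pderiv i φ) :=
  (h.continuous_fderiv (by simp)).clm_apply continuous_const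

namespace IsTest

variable {U V : Set (E d)} {φ ψ : E d → ℂ}

theorem mono (h : IsTest U φ) (hUV : U ⊆ V) : IsTest V φ := ⟨h.1, h.2.1, h.2.2.trans hUV⟩

theorem hasCompactSupport_pderiv (h : IsTest U φ) (i : Fin d) : HasCompactSupport (pderiv i φ) :=
  h.2.1.fderiv_apply ℝ _

theorem eq_zero (h : IsTest U φ) {x : E d} (hx : x ∉ U) : φ x = 0 :=
  image_eq_zero_of_notMem_tsupport fun h' => hx (h.2.2 h')

theorem pderiv_eq_zero (h : IsTest U φ) {x : E d} (hx : x ∉ U) (i : Fin d) : pderiv i φ x = 0 :=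
  pderiv_eq_zero_of_notMem_tsupport (fun h' => hx (h.2.2 h')) i

theorem memLp (h : IsTest U φ) (p : ℝ≥0∞) : MemLp φ p (vol V) :=
  h.1.continuous.memLp_of_hasCompactSupport h.2.1

theorem memLp_pderiv (h : IsTest U φ) (p : ℝ≥0∞) (i : Fin d) : MemLp (pderiv i φ) p (vol V) :=
  (continuous_pderiv h.1 i).memLp_of_hasCompactSupport (h.hasCompactSupport_pderiv i)

theorem add (h : IsTest U φ) (h' : IsTest U ψ) : IsTest U (φ + ψ) :=
  ⟨h.1.add h'.1, h.2.1.add h'.2.1, (tsupport_add φ ψ).trans (union_subset h.2.2 h'.2.2)⟩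

theorem const_smul (h : IsTest U φ) (c : ℂ) : IsTest U (c • φ) :=
  ⟨contDiff_const.smul h.1, h.2.1.smul_left (f := fun _ => c),
    (tsupport_smul_subset_right (fun _ => c) φ).trans h.2.2⟩

end IsTest

/-! ### Weak gradients -/

/-- Integration by parts for a smooth function. -/
theorem hasWeakGrad_of_contDiff (U : Set (E d)) {f : E d → ℂ} (hf : ContDiff ℝ ∞ f) :
    HasWeakGrad U f (fun i => pderiv i f) := by
  intro φ hφ i
  have h1 : ∫ x in U, f x * pderiv i φ x = ∫ x, f x * pderiv i φ x :=
    setIntegral_eq_integral_of_forall_compl_eq_zero fun x hx => by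
      rw [hφ.pderiv_eq_zero hx, mul_zero]
  have h2 : ∫ x in U, pderiv i f x * φ x = ∫ x, pderiv i f x * φ x :=
    setIntegral_eq_integral_of_forall_compl_eq_zero fun x hx => by rw [hφ.eq_zero hx, mul_zero]
  rw [h1, h2]
  refine integral_mul_fderiv_eq_neg_fderiv_mul_of_integrable ?_ ?_ ?_ ?_ ?_
  · exact ((continuous_pderiv hf i).mul hφ.1.continuous).integrable_of_hasCompactSupport
      hφ.2.1.mul_left
  · exact (hf.continuous.mul (continuous_pderiv hφ.1 i)).integrable_of_hasCompactSupport
      (hφ.hasCompactSupport_pderiv i).mul_left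
  · exact (hf.continuous.mul hφ.1.continuous).integrable_of_hasCompactSupport hφ.2.1.mul_left
  · exact fun x _ => (hf.differentiable (by simp)).differentiableAt
  · exact fun x _ => (hφ.1.differentiable (by simp)).differentiableAt

/-- `g` is an `L²` weak gradient of `u` on `U`. -/
def HasGrad (U : Set (E d)) (u : E d → ℂ) (g : Fin d → E d → ℂ) : Prop :=
  (∀ i, MemLp (g i) 2 (vol U)) ∧ HasWeakGrad U u g

theorem MemW1.hasGrad {U : Set (E d)} {u : E d → ℂ} (h : MemH1 U u) :
    HasGrad U u (weakGrad U u) := by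
  have h' : ∃ g : Fin d → E d → ℂ, (∀ i, MemLp (g i) 2 (vol U)) ∧ HasWeakGrad U u g := h.2
  have := h'.choose_spec
  rw [weakGrad, dif_pos h']
  exact this

/-- This is the fundamental lemma of the calculus of variations; real bump functions suffice as test
functions, since they may multiply complex-valued ones. -/
theorem HasWeakGrad.ae_eq {U : Set (E d)} (hU : IsOpen U) {u : E d → ℂ}
    {g g' : Fin d → E d → ℂ} (h : HasGrad U u g) (h' : HasGrad U u g') (i : Fin d) :
    g i =ᵐ[vol U] g' i := by
  have hm : MemLp (g i - g' i) 2 (vol U) := (h.1 i).sub (h'.1 i)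
  have hloc : LocallyIntegrableOn (g i - g' i) U :=
    locallyIntegrableOn_of_locallyIntegrable_restrict (hm.locallyIntegrable (by norm_num))
  have key := hU.ae_eq_zero_of_integral_contDiff_smul_eq_zero hloc ?_
  · rw [Filter.EventuallyEq, ae_restrict_iff' hU.measurableSet]
    filter_upwards [key] with x hx hxU
    simpa [sub_eq_zero] using hx hxU
  · intro η hη hηc hηU
    have hφ : IsTest U (fun x => (η x : ℂ)) := by
      refine ⟨Complex.ofRealCLM.contDiff.comp hη, ?_, ?_⟩
      · exact hηc.comp_left (g := fun t : ℝ => (t : ℂ)) (by simp)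
      · refine (closure_mono ?_).trans hηU
        intro x hx
        simpa using hx
    have e1 := h.2 _ hφ i
    have e2 := h'.2 _ hφ i
    have i1 : Integrable (fun x => g i x * (η x : ℂ)) (vol U) :=
      (h.1 i).integrable_mul (hφ.memLp 2)
    have i2 : Integrable (fun x => g' i x * (η x : ℂ)) (vol U) :=
      (h'.1 i).integrable_mul (hφ.memLp 2)
    have e3 : ∫ x in U, g i x * (η x : ℂ) - g' i x * (η x : ℂ) = 0 := by
      rw [integral_sub i1 i2, sub_eq_zero]
      exact neg_injective (e1.symm.trans e2)
    rw [← e3]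
    rw [← setIntegral_eq_integral_of_forall_compl_eq_zero (s := U)]
    · refine integral_congr_ae (Filter.Eventually.of_forall fun x => ?_)
      simp only [Pi.sub_apply, Complex.real_smul]
      ring
    · intro x hx
      have : (η x : ℂ) = 0 := hφ.eq_zero hx
      simp [Complex.real_smul, this]

namespace HasGrad

variable {U V : Set (E d)} {u v : E d → ℂ} {g k : Fin d → E d → ℂ}

theorem memH1 (h : HasGrad U u g) (hu : MemLp u 2 (vol U)) : MemH1 U u := ⟨hu, g, h⟩

/-- `weakGrad` is an arbitrary choice, so every computation with it passes through an explicit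
gradient and this uniqueness statement. -/
theorem weakGrad_ae_eq (hU : IsOpen U) (h : HasGrad U u g) (i : Fin d) :
    weakGrad U u i =ᵐ[vol U] g i := by
  have h' : ∃ g : Fin d → E d → ℂ, (∀ i, MemLp (g i) 2 (vol U)) ∧ HasWeakGrad U u g := ⟨g, h⟩
  have h2 : HasGrad U u (weakGrad U u) := by
    have := h'.choose_spec
    rw [weakGrad, dif_pos h']
    exact this
  exact HasWeakGrad.ae_eq hU h2 h i

theorem congr (h : HasGrad U u g) (hu : u =ᵐ[vol U] v) (hg : ∀ i, g i =ᵐ[vol U] k i) :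
    HasGrad U v k := by
  refine ⟨fun i => (memLp_congr_ae (hg i)).1 (h.1 i), fun φ hφ i => ?_⟩
  have e := h.2 φ hφ i
  have e1 : ∫ x in U, u x * pderiv i φ x = ∫ x in U, v x * pderiv i φ x :=
    integral_congr_ae (hu.mono fun x hx => by simp only [hx])
  have e2 : ∫ x in U, g i x * φ x = ∫ x in U, k i x * φ x :=
    integral_congr_ae ((hg i).mono fun x hx => by simp only [hx])
  rw [← e1, ← e2, e]

theorem mono (hU : MeasurableSet U) (h : HasGrad U u g) (hVU : V ⊆ U) : HasGrad V u g := by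
  refine ⟨fun i => (h.1 i).mono_measure (Measure.restrict_mono hVU le_rfl), fun φ hφ i => ?_⟩
  have e := h.2 φ (hφ.mono hVU) i
  have e1 : ∫ x in U, u x * pderiv i φ x = ∫ x in V, u x * pderiv i φ x :=
    setIntegral_eq_of_subset_of_forall_sdiff_eq_zero hU hVU fun x hx => by
      rw [hφ.pderiv_eq_zero hx.2, mul_zero]
  have e2 : ∫ x in U, g i x * φ x = ∫ x in V, g i x * φ x :=
    setIntegral_eq_of_subset_of_forall_sdiff_eq_zero hU hVU fun x hx => by
      rw [hφ.eq_zero hx.2, mul_zero]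
  rw [← e1, ← e2, e]

theorem add (hu : MemLp u 2 (vol U)) (hv : MemLp v 2 (vol U)) (h : HasGrad U u g)
    (h' : HasGrad U v k) : HasGrad U (u + v) (fun i => g i + k i) := by
  refine ⟨fun i => (h.1 i).add (h'.1 i), fun φ hφ i => ?_⟩
  have e1 := h.2 φ hφ i
  have e2 := h'.2 φ hφ i
  simp only [Pi.add_apply, add_mul]
  have i1 : Integrable (fun x => u x * pderiv i φ x) (vol U) :=
    hu.integrable_mul (hφ.memLp_pderiv 2 i)
  have i2 : Integrable (fun x => v x * pderiv i φ x) (vol U) :=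
    hv.integrable_mul (hφ.memLp_pderiv 2 i)
  have i3 : Integrable (fun x => g i x * φ x) (vol U) := (h.1 i).integrable_mul (hφ.memLp 2)
  have i4 : Integrable (fun x => k i x * φ x) (vol U) := (h'.1 i).integrable_mul (hφ.memLp 2)
  rw [integral_add i1 i2, integral_add i3 i4, e1, e2]
  ring

theorem const_smul (h : HasGrad U u g) (c : ℂ) : HasGrad U (c • u) (fun i => c • g i) := by
  refine ⟨fun i => (h.1 i).const_smul c, fun φ hφ i => ?_⟩
  have e1 := h.2 φ hφ i
  simp only [Pi.smul_apply, smul_eq_mul, mul_assoc]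
  rw [integral_const_mul, integral_const_mul, e1]
  ring

theorem of_isTest (h : IsTest V u) : HasGrad U u (fun i => pderiv i u) :=
  ⟨fun i => h.memLp_pderiv 2 i, hasWeakGrad_of_contDiff U h.1⟩

end HasGrad

namespace MemW1

variable {U V : Set (E d)} {u v : E d → ℂ}

theorem add (hu : MemH1 U u) (hv : MemH1 U v) : MemH1 U (u + v) :=
  (HasGrad.add hu.1 hv.1 hu.hasGrad hv.hasGrad).memH1 (hu.1.add hv.1)

theorem const_smul (hu : MemH1 U u) (c : ℂ) : MemH1 U (c • u) :=
  (hu.hasGrad.const_smul c).memH1 (hu.1.const_smul c)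

theorem sub (hu : MemH1 U u) (hv : MemH1 U v) : MemH1 U (u - v) := by
  have := hu.add (hv.const_smul (-1))
  rwa [neg_one_smul, ← sub_eq_add_neg] at this

theorem mono (hU : MeasurableSet U) (hu : MemH1 U u) (hVU : V ⊆ U) : MemH1 V u :=
  (hu.hasGrad.mono hU hVU).memH1 (hu.1.mono_measure (Measure.restrict_mono hVU le_rfl))

theorem congr (hu : MemH1 U u) (h : u =ᵐ[vol U] v) : MemH1 U v :=
  (hu.hasGrad.congr h fun _ => Filter.EventuallyEq.rfl).memH1 ((memLp_congr_ae h).1 hu.1)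

end MemW1

theorem IsTest.memH1 {U V : Set (E d)} {φ : E d → ℂ} (h : IsTest V φ) : MemH1 U φ :=
  (HasGrad.of_isTest h).memH1 (h.memLp 2)

section weakGrad

variable {U V : Set (E d)} {u v : E d → ℂ}

theorem weakGrad_add (hU : IsOpen U) (hu : MemH1 U u) (hv : MemH1 U v) (i : Fin d) :
    weakGrad U (u + v) i =ᵐ[vol U] weakGrad U u i + weakGrad U v i :=
  (HasGrad.add hu.1 hv.1 hu.hasGrad hv.hasGrad).weakGrad_ae_eq hU i

theorem weakGrad_congr (hU : IsOpen U) (hu : MemH1 U u) (h : u =ᵐ[vol U] v) (i : Fin d) :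
    weakGrad U u i =ᵐ[vol U] weakGrad U v i :=
  ((hu.hasGrad.congr h fun _ => Filter.EventuallyEq.rfl).weakGrad_ae_eq hU i).symm

theorem weakGrad_mono (hU : IsOpen U) (hV : IsOpen V) (hu : MemH1 U u) (hVU : V ⊆ U)
    (i : Fin d) : weakGrad V u i =ᵐ[vol V] weakGrad U u i :=
  (hu.hasGrad.mono hU.measurableSet hVU).weakGrad_ae_eq hV i

/-- The weak gradient is local. -/
theorem weakGrad_ae_eq_of_ae_eq (hU : IsOpen U) (hV : IsOpen V) (hVU : V ⊆ U)
    (hu : MemH1 U u) (h : u =ᵐ[vol V] v) (i : Fin d) :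
    weakGrad U u i =ᵐ[vol V] weakGrad V v i :=
  (weakGrad_mono hU hV hu hVU i).symm.trans
    (weakGrad_congr hV (hu.mono hU.measurableSet hVU) h i)

end weakGrad

/-! ### The `H¹` norm -/

/-- The density of the square of the `H¹` norm. -/
def dens (u : E d → ℂ) (g : Fin d → E d → ℂ) (x : E d) : ℝ := ‖u x‖ ^ 2 + ∑ i, ‖g i x‖ ^ 2

theorem dens_nonneg (u : E d → ℂ) (g : Fin d → E d → ℂ) (x : E d) : 0 ≤ dens u g x := by
  unfold dens; positivity

theorem integrable_norm_sq {U : Set (E d)} {u : E d → ℂ} (h : MemLp u 2 (vol U)) :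
    IntegrableOn (fun x => ‖u x‖ ^ 2) U := h.integrable_norm_pow (by norm_num)

theorem HasGrad.integrableOn_dens {U : Set (E d)} {u : E d → ℂ} {g : Fin d → E d → ℂ}
    (hu : MemLp u 2 (vol U)) (h : HasGrad U u g) : IntegrableOn (dens u g) U :=
  (integrable_norm_sq hu).add (integrable_finsetSum _ fun i _ => integrable_norm_sq (h.1 i))

theorem MemW1.integrableOn_dens {U : Set (E d)} {u : E d → ℂ} (h : MemH1 U u) :
    IntegrableOn (dens u (weakGrad U u)) U := h.hasGrad.integrableOn_dens h.1

/-- A single integral of a density can be localized, compared pointwise and split over elements. -/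
theorem MemW1.norm1_sq {U : Set (E d)} {u : E d → ℂ} (h : MemH1 U u) :
    norm1 U u ^ 2 = ∫ x in U, dens u (weakGrad U u) x := by
  rw [norm1, Real.sq_sqrt]
  · unfold dens
    rw [integral_add (integrable_norm_sq h.1)
      (integrable_finsetSum _ fun i _ => integrable_norm_sq (h.hasGrad.1 i)),
      integral_finsetSum _ fun i _ => integrable_norm_sq (h.hasGrad.1 i)]
  · have h1 : 0 ≤ ∫ x in U, ‖u x‖ ^ 2 := integral_nonneg fun x => by positivity
    have h2 : ∀ i, 0 ≤ ∫ x in U, ‖weakGrad U u i x‖ ^ 2 :=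
      fun i => integral_nonneg fun x => by positivity
    have := Finset.sum_nonneg fun i (_ : i ∈ Finset.univ) => h2 i
    linarith

theorem dens_ae_eq {U : Set (E d)} {u v : E d → ℂ} {g k : Fin d → E d → ℂ}
    (hu : u =ᵐ[vol U] v) (hg : ∀ i, g i =ᵐ[vol U] k i) : dens u g =ᵐ[vol U] dens v k := by
  filter_upwards [hu, ae_all_iff.2 hg] with x h1 h2
  simp [dens, h1, h2]

theorem HasGrad.norm1_sq {U : Set (E d)} (hU : IsOpen U) {u : E d → ℂ} {g : Fin d → E d → ℂ}
    (hu : MemLp u 2 (vol U)) (h : HasGrad U u g) : norm1 U u ^ 2 = ∫ x in U, dens u g x := by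
  rw [(h.memH1 hu).norm1_sq]
  exact integral_congr_ae (dens_ae_eq Filter.EventuallyEq.rfl (h.weakGrad_ae_eq hU))

theorem norm0_nonneg (U : Set (E d)) (u : E d → ℂ) : 0 ≤ norm0 U u := Real.sqrt_nonneg _

theorem norm1_nonneg (U : Set (E d)) (u : E d → ℂ) : 0 ≤ norm1 U u := Real.sqrt_nonneg _

theorem norm0_le_norm1 (U : Set (E d)) (u : E d → ℂ) : norm0 U u ≤ norm1 U u := by
  refine Real.sqrt_le_sqrt (le_add_of_nonneg_right (Finset.sum_nonneg fun i _ => ?_))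
  exact integral_nonneg fun x => by positivity

theorem norm1_congr {U : Set (E d)} (hU : IsOpen U) {u v : E d → ℂ} (hu : MemH1 U u)
    (h : u =ᵐ[vol U] v) : norm1 U u = norm1 U v := by
  have h1 := hu.norm1_sq
  have h2 := (hu.congr h).norm1_sq
  rw [integral_congr_ae (dens_ae_eq h (weakGrad_congr hU hu h)), ← h2] at h1
  exact (sq_eq_sq₀ (norm1_nonneg _ _) (norm1_nonneg _ _)).1 h1

theorem norm1_add_sq_le {U : Set (E d)} (hU : IsOpen U) {u v : E d → ℂ} (hu : MemH1 U u)
    (hv : MemH1 U v) : norm1 U (u + v) ^ 2 ≤ 2 * norm1 U u ^ 2 + 2 * norm1 U v ^ 2 := by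
  have hg := HasGrad.add hu.1 hv.1 hu.hasGrad hv.hasGrad
  rw [hg.norm1_sq hU (hu.1.add hv.1), hu.norm1_sq, hv.norm1_sq, ← integral_const_mul,
    ← integral_const_mul, ← integral_add (hu.integrableOn_dens.const_mul 2)
    (hv.integrableOn_dens.const_mul 2)]
  refine integral_mono (hg.integrableOn_dens (hu.1.add hv.1))
    ((hu.integrableOn_dens.const_mul 2).add (hv.integrableOn_dens.const_mul 2)) fun x => ?_
  have key : ∀ a b : ℂ, ‖a + b‖ ^ 2 ≤ 2 * ‖a‖ ^ 2 + 2 * ‖b‖ ^ 2 := fun a b => by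
    have := norm_add_le a b
    nlinarith [norm_nonneg (a + b), sq_nonneg (‖a‖ - ‖b‖)]
  simp only [dens, Pi.add_apply, mul_add, Finset.mul_sum]
  have := Finset.sum_le_sum fun i (_ : i ∈ Finset.univ) =>
    key (weakGrad U u i x) (weakGrad U v i x)
  rw [Finset.sum_add_distrib] at this
  linarith [key (u x) (v x)]

/-- The parallelogram-type bound for squares yields the factor 2; a sharp triangle inequality is not
needed, since constants are immaterial. -/
theorem norm1_add_le {U : Set (E d)} (hU : IsOpen U) {u v : E d → ℂ} (hu : MemH1 U u)
    (hv : MemH1 U v) : norm1 U (u + v) ≤ 2 * (norm1 U u + norm1 U v) := by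
  have := norm1_add_sq_le hU hu hv
  have h1 := norm1_nonneg U u
  have h2 := norm1_nonneg U v
  refine abs_le_of_sq_le_sq' ?_ (by positivity) |>.2
  nlinarith [mul_nonneg h1 h2]

theorem norm1_const_smul {U : Set (E d)} (hU : IsOpen U) {u : E d → ℂ} (hu : MemH1 U u) (c : ℂ) :
    norm1 U (c • u) = ‖c‖ * norm1 U u := by
  have h1 := (hu.hasGrad.const_smul c).norm1_sq hU (hu.1.const_smul c)
  refine (sq_eq_sq₀ (norm1_nonneg _ _) (mul_nonneg (norm_nonneg _) (norm1_nonneg _ _))).1 ?_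
  rw [h1, mul_pow, hu.norm1_sq, ← integral_const_mul]
  congr 1
  ext x
  simp only [dens, Pi.smul_apply, norm_smul, mul_pow, mul_add, Finset.mul_sum]

/-! ### The space `H¹₀` -/

namespace MemH10

variable {U V : Set (E d)} {u v : E d → ℂ}

theorem add (hU : IsOpen U) (hu : MemH10 U u) (hv : MemH10 U v) : MemH10 U (u + v) := by
  refine ⟨hu.1.add hv.1, fun ε hε => ?_⟩
  -- The factor 2 of `norm1_add_le` turns two errors below ε/4 into one below ε.
  obtain ⟨φ, hφ, h1⟩ := hu.2 (ε / 4) (by positivity)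
  obtain ⟨ψ, hψ, h2⟩ := hv.2 (ε / 4) (by positivity)
  refine ⟨φ + ψ, hφ.add hψ, ?_⟩
  have e : u + v - (φ + ψ) = (u - φ) + (v - ψ) := by abel
  rw [e]
  have := norm1_add_le hU (hu.1.sub (hφ.memH1 (U := U))) (hv.1.sub (hψ.memH1 (U := U)))
  linarith

theorem const_smul (hU : IsOpen U) (hu : MemH10 U u) (c : ℂ) : MemH10 U (c • u) := by
  refine ⟨hu.1.const_smul c, fun ε hε => ?_⟩
  obtain ⟨φ, hφ, h1⟩ := hu.2 (ε / (‖c‖ + 1)) (by positivity)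
  refine ⟨c • φ, hφ.const_smul c, ?_⟩
  rw [← smul_sub, norm1_const_smul hU (hu.1.sub (hφ.memH1 (U := U)))]
  rw [lt_div_iff₀ (by positivity)] at h1
  nlinarith [norm1_nonneg U (u - φ)]

theorem sub (hU : IsOpen U) (hu : MemH10 U u) (hv : MemH10 U v) : MemH10 U (u - v) := by
  have := hu.add hU (hv.const_smul hU (-1))
  rwa [neg_one_smul, ← sub_eq_add_neg] at this

theorem congr (hU : IsOpen U) (hu : MemH10 U u) (h : u =ᵐ[vol U] v) : MemH10 U v := by
  refine ⟨hu.1.congr h, fun ε hε => ?_⟩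
  obtain ⟨φ, hφ, h1⟩ := hu.2 ε hε
  refine ⟨φ, hφ, ?_⟩
  rwa [← norm1_congr hU (hu.1.sub (hφ.memH1 (U := U)))]
  exact h.mono fun x hx => by simp [hx]

end MemH10

/-! ### Lipschitz functions vanishing outside a bounded open set belong to `H¹₀` -/

section Limits
open Filter Topology

/-- Bounded convergence passes to the limit on both sides of the integration by parts formula. -/
theorem hasGrad_of_tendsto {U : Set (E d)} (hfin : volume U < ⊤)
    {φ : ℕ → E d → ℂ} {F : E d → ℂ} {g : Fin d → E d → ℂ} {M : ℝ}
    (hφ : ∀ n, IsTest U (φ n)) (hM : ∀ n x, ‖φ n x‖ ≤ M) (hM' : ∀ n i x, ‖pderiv i (φ n) x‖ ≤ M)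
    (hF : ∀ᵐ x ∂(vol U), Tendsto (fun n => φ n x) atTop (𝓝 (F x)))
    (hg : ∀ i, ∀ᵐ x ∂(vol U), Tendsto (fun n => pderiv i (φ n) x) atTop (𝓝 (g i x))) :
    MemLp F 2 (vol U) ∧ HasGrad U F g := by
  have : IsFiniteMeasure (vol U) := isFiniteMeasure_restrict.2 hfin.ne
  have hFm : AEStronglyMeasurable F (vol U) := aestronglyMeasurable_of_tendsto_ae atTop
    (fun n => (hφ n).1.continuous.aestronglyMeasurable) hF
  have hgm : ∀ i, AEStronglyMeasurable (g i) (vol U) := fun i =>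
    aestronglyMeasurable_of_tendsto_ae atTop
    (fun n => (continuous_pderiv (hφ n).1 i).aestronglyMeasurable) (hg i)
  have hFb : ∀ᵐ x ∂(vol U), ‖F x‖ ≤ M := hF.mono fun x hx =>
    le_of_tendsto hx.norm (Eventually.of_forall fun n => hM n x)
  have hgb : ∀ i, ∀ᵐ x ∂(vol U), ‖g i x‖ ≤ M := fun i => (hg i).mono fun x hx =>
    le_of_tendsto hx.norm (Eventually.of_forall fun n => hM' n i x)
  refine ⟨MemLp.of_bound hFm M hFb, fun i => MemLp.of_bound (hgm i) M (hgb i), ?_⟩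
  intro η hη i
  have h1 : Tendsto (fun n => ∫ x in U, φ n x * pderiv i η x) atTop
      (𝓝 (∫ x in U, F x * pderiv i η x)) := by
    refine tendsto_integral_of_dominated_convergence (fun x => M * ‖pderiv i η x‖)
      (fun n => ((hφ n).1.continuous.mul (continuous_pderiv hη.1 i)).aestronglyMeasurable)
      ((((hη.memLp_pderiv 1 i).integrable le_rfl).norm).const_mul M) ?_ ?_
    · exact fun n => Eventually.of_forall fun x => by
        rw [norm_mul]; exact mul_le_mul_of_nonneg_right (hM n x) (norm_nonneg _)
    · exact hF.mono fun x hx => hx.mul_const _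
  have h2 : Tendsto (fun n => ∫ x in U, pderiv i (φ n) x * η x) atTop
      (𝓝 (∫ x in U, g i x * η x)) := by
    refine tendsto_integral_of_dominated_convergence (fun x => M * ‖η x‖)
      (fun n => ((continuous_pderiv (hφ n).1 i).mul hη.1.continuous).aestronglyMeasurable)
      ((((hη.memLp 1).integrable le_rfl).norm).const_mul M) ?_ ?_
    · exact fun n => Eventually.of_forall fun x => by
        rw [norm_mul]; exact mul_le_mul_of_nonneg_right (hM' n i x) (norm_nonneg _)
    · exact (hg i).mono fun x hx => hx.mul_const _
  refine tendsto_nhds_unique h1 ?_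
  have h3 : ∀ n, ∫ x in U, φ n x * pderiv i η x = -∫ x in U, pderiv i (φ n) x * η x :=
    fun n => hasWeakGrad_of_contDiff U (hφ n).1 η hη i
  simpa only [h3] using h2.neg

/-- On a set of finite measure, uniform bounds upgrade pointwise convergence of values and gradients
to convergence in H¹, so the given test functions are themselves the required approximations. -/
theorem memH10_of_tendsto {U : Set (E d)} (hU : IsOpen U) (hfin : volume U < ⊤)
    {φ : ℕ → E d → ℂ} {F : E d → ℂ} {g : Fin d → E d → ℂ} {M : ℝ}
    (hφ : ∀ n, IsTest U (φ n)) (hM : ∀ n x, ‖φ n x‖ ≤ M) (hM' : ∀ n i x, ‖pderiv i (φ n) x‖ ≤ M)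
    (hF : ∀ᵐ x ∂(vol U), Tendsto (fun n => φ n x) atTop (𝓝 (F x)))
    (hg : ∀ i, ∀ᵐ x ∂(vol U), Tendsto (fun n => pderiv i (φ n) x) atTop (𝓝 (g i x))) :
    MemH10 U F := by
  obtain ⟨hF2, hFg⟩ := hasGrad_of_tendsto hfin hφ hM hM' hF hg
  have : IsFiniteMeasure (vol U) := isFiniteMeasure_restrict.2 hfin.ne
  have hG : ∀ n, HasGrad U (F - φ n) (fun i => g i - pderiv i (φ n)) := fun n => by
    have := HasGrad.add hF2 (((hφ n).memLp 2).const_smul (-1 : ℂ)) hFg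
      ((HasGrad.of_isTest (hφ n)).const_smul (-1 : ℂ))
    simpa only [neg_one_smul, ← sub_eq_add_neg] using this
  have hL : ∀ n, MemLp (F - φ n) 2 (vol U) := fun n => hF2.sub ((hφ n).memLp 2)
  have hFb : ∀ᵐ x ∂(vol U), ‖F x‖ ≤ M := hF.mono fun x hx =>
    le_of_tendsto hx.norm (Eventually.of_forall fun n => hM n x)
  have hgb : ∀ᵐ x ∂(vol U), ∀ i, ‖g i x‖ ≤ M := ae_all_iff.2 fun i => (hg i).mono fun x hx =>
    le_of_tendsto hx.norm (Eventually.of_forall fun n => hM' n i x)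
  have key : Tendsto (fun n => ∫ x in U, dens (F - φ n) (fun i => g i - pderiv i (φ n)) x) atTop
      (𝓝 (∫ _ in U, (0 : ℝ))) := by
    refine tendsto_integral_of_dominated_convergence
      (fun _ => (M + M) ^ 2 + ∑ _i : Fin d, (M + M) ^ 2)
      (fun n => ((hG n).integrableOn_dens (hL n)).aestronglyMeasurable)
      (integrable_const _) ?_ ?_
    · intro n
      filter_upwards [hFb, hgb] with x h1 h2
      rw [Real.norm_of_nonneg (dens_nonneg _ _ _)]
      refine add_le_add ?_ (Finset.sum_le_sum fun i _ => ?_)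
      · exact pow_le_pow_left₀ (norm_nonneg _) ((norm_sub_le _ _).trans
          (add_le_add h1 (hM n x))) 2
      · exact pow_le_pow_left₀ (norm_nonneg _) ((norm_sub_le _ _).trans
          (add_le_add (h2 i) (hM' n i x))) 2
    · filter_upwards [hF, ae_all_iff.2 hg] with x h1 h2
      have e : (0 : ℝ) = ‖F x - F x‖ ^ 2 + ∑ i, ‖g i x - g i x‖ ^ 2 := by simp
      rw [e]
      exact ((tendsto_const_nhds.sub h1).norm.pow 2).add
        (tendsto_finsetSum _ fun i _ => (tendsto_const_nhds.sub (h2 i)).norm.pow 2)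
  rw [integral_zero] at key
  refine ⟨hFg.memH1 hF2, fun ε hε => ?_⟩
  obtain ⟨n, hn⟩ := (key.eventually (gt_mem_nhds (show (0 : ℝ) < ε ^ 2 by positivity))).exists
  refine ⟨φ n, hφ n, ?_⟩
  rw [← (hG n).norm1_sq hU (hL n)] at hn
  exact lt_of_pow_lt_pow_left₀ 2 hε.le hn

end Limits

/-! ### Mollification of Lipschitz functions. -/

section Mollify
open Filter Topology Convolution
open ContinuousLinearMap (lsmul)

variable {Z : Type*} [NormedAddCommGroup Z] [NormedSpace ℝ Z]

theorem norm_normed_convolution_le (ρ : ContDiffBump (0 : E d)) {H : E d → Z} {C : ℝ}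
    (hH : ∀ x, ‖H x‖ ≤ C) (x : E d) :
    ‖(ρ.normed volume ⋆[lsmul ℝ ℝ, volume] H) x‖ ≤ C := by
  rw [convolution_def]
  refine (norm_integral_le_of_norm_le (g := fun t => ρ.normed volume t * C)
    (ρ.integrable_normed.mul_const C) (Eventually.of_forall fun t => ?_)).trans_eq ?_
  · rw [ContinuousLinearMap.lsmul_apply, norm_smul, Real.norm_of_nonneg (ρ.nonneg_normed t)]
    exact mul_le_mul_of_nonneg_left (hH _) (ρ.nonneg_normed t)
  · rw [integral_mul_const, ρ.integral_normed, one_mul]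

/-- The kernel is supported in a ball of radius `rOut`, so a mollified value sees the function only
on that ball around the point. -/
theorem normed_convolution_congr (ρ : ContDiffBump (0 : E d)) {H H' : E d → Z} {x : E d}
    (h : ∀ t, ‖t‖ < ρ.rOut → H (x - t) = H' (x - t)) :
    (ρ.normed volume ⋆[lsmul ℝ ℝ, volume] H) x = (ρ.normed volume ⋆[lsmul ℝ ℝ, volume] H') x := by
  rw [convolution_def, convolution_def]
  congr 1
  ext t
  by_cases ht : ‖t‖ < ρ.rOut
  · rw [h t ht]
  · have : ρ.normed volume t = 0 := by
      rw [← Function.notMem_support, ρ.support_normed_eq]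
      simpa using ht
    simp [this]

/-- The derivative is put on `H`, which is differentiable almost everywhere by Rademacher's theorem,
and not on the kernel. In this form it is bounded by the Lipschitz constant and converges at
Lebesgue points. -/
theorem hasFDerivAt_normed_convolution (ρ : ContDiffBump (0 : E d)) {H : E d → ℂ} {K : ℝ≥0}
    (hH : LipschitzWith K H) (x : E d) :
    HasFDerivAt (ρ.normed volume ⋆[lsmul ℝ ℝ, volume] H)
      ((ρ.normed volume ⋆[lsmul ℝ ℝ, volume] fderiv ℝ H) x) x := by
  have hρc : Continuous (ρ.normed volume) := ρ.continuous_normed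
  refine (hasFDerivAt_integral_of_dominated_loc_of_lip (μ := volume) (𝕜 := ℝ)
    (F := fun y t => ρ.normed volume t • H (y - t))
    (F' := fun t => ρ.normed volume t • fderiv ℝ H (x - t))
    (bound := fun t => ρ.normed volume t * K) (s := univ) univ_mem ?_ ?_ ?_ ?_ ?_ ?_).2
  · exact Eventually.of_forall fun y => (hρc.smul (hH.continuous.comp
      (continuous_const.sub continuous_id))).aestronglyMeasurable
  · exact (hρc.smul (hH.continuous.comp
      (continuous_const.sub continuous_id))).integrable_of_hasCompactSupport
      ρ.hasCompactSupport_normed.smul_right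
  · exact hρc.aestronglyMeasurable.smul ((measurable_fderiv ℝ H).comp
      (measurable_const.sub measurable_id)).aestronglyMeasurable
  · refine Eventually.of_forall fun t => LipschitzOnWith.of_dist_le_mul fun y _ z _ => ?_
    have h0 := ρ.nonneg_normed (μ := volume) t
    rw [dist_eq_norm, ← smul_sub, norm_smul, Real.norm_of_nonneg h0, Real.coe_nnabs,
      abs_of_nonneg (mul_nonneg h0 K.coe_nonneg), mul_assoc]
    refine mul_le_mul_of_nonneg_left ?_ h0
    rw [← dist_eq_norm]
    simpa using hH.dist_le_mul (y - t) (z - t)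
  · exact ρ.integrable_normed.mul_const _
  · have hae : ∀ᵐ t : E d, DifferentiableAt ℝ H (x - t) :=
      (Measure.measurePreserving_sub_left (volume : Measure (E d)) x).quasiMeasurePreserving.ae
        hH.ae_differentiableAt
    filter_upwards [hae] with t ht
    exact ((hasFDerivAt_comp_sub t).2 ht.hasFDerivAt).const_smul (ρ.normed volume t)

end Mollify

/-- A cutoff function which vanishes within distance `ε` from the complement of `U` and equals `1`
at distance at least `2 ε`. -/
def innerCutoff (U : Set (E d)) (ε : ℝ) (x : E d) : ℝ :=
  min 1 (max 0 (Metric.infDist x Uᶜ / ε - 1))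

section innerCutoff

variable {U : Set (E d)} {ε : ℝ} {x : E d}

theorem innerCutoff_nonneg : 0 ≤ innerCutoff U ε x := le_min zero_le_one (le_max_left _ _)

theorem innerCutoff_le_one : innerCutoff U ε x ≤ 1 := min_le_left _ _

theorem innerCutoff_eq_one (hε : 0 < ε) (h : 2 * ε ≤ Metric.infDist x Uᶜ) :
    innerCutoff U ε x = 1 := by
  have : 2 ≤ Metric.infDist x Uᶜ / ε := by rwa [le_div_iff₀ hε]
  exact min_eq_left (le_max_of_le_right (by linarith))

theorem innerCutoff_eq_zero (hε : 0 < ε) (h : Metric.infDist x Uᶜ ≤ ε) :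
    innerCutoff U ε x = 0 := by
  have : Metric.infDist x Uᶜ / ε ≤ 1 := by rwa [div_le_one hε]
  rw [innerCutoff, max_eq_left (by linarith), min_eq_right zero_le_one]

theorem abs_innerCutoff_sub_le (hε : 0 < ε) (x y : E d) :
    |innerCutoff U ε x - innerCutoff U ε y| ≤ dist x y / ε := by
  have h1 : |innerCutoff U ε x - innerCutoff U ε y| ≤
      |(Metric.infDist x Uᶜ / ε - 1) - (Metric.infDist y Uᶜ / ε - 1)| := by
    unfold innerCutoff
    refine (abs_min_sub_min_le_max _ _ _ _).trans ?_
    rw [sub_self, abs_zero, max_eq_right (abs_nonneg _)]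
    refine (abs_max_sub_max_le_max _ _ _ _).trans ?_
    rw [sub_self, abs_zero, max_eq_right (abs_nonneg _)]
  refine h1.trans ?_
  rw [sub_sub_sub_cancel_right, ← sub_div, abs_div, abs_of_pos hε]
  refine div_le_div_of_nonneg_right ?_ hε.le
  have := (Metric.lipschitz_infDist_pt Uᶜ).dist_le_mul x y
  simpa [Real.dist_eq] using this

/-- Comparison with nearly closest points of the complement, where `F` vanishes. -/
theorem norm_le_mul_infDist_compl {F : E d → ℂ} {K : ℝ≥0} (hF : LipschitzWith K F)
    (hF0 : ∀ x ∉ U, F x = 0) (hUc : Uᶜ.Nonempty) (x : E d) :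
    ‖F x‖ ≤ K * Metric.infDist x Uᶜ := by
  refine le_of_forall_pos_le_add fun δ hδ => ?_
  obtain ⟨y, hy, hxy⟩ := (Metric.infDist_lt_iff (x := x) hUc).1
    (show Metric.infDist x Uᶜ < Metric.infDist x Uᶜ + δ / (K + 1) by
      have : 0 < δ / ((K : ℝ) + 1) := by positivity
      linarith)
  have h := hF.dist_le_mul x y
  rw [hF0 y hy, dist_zero_right] at h
  have h2 : (K : ℝ) * (δ / (K + 1)) ≤ δ := by
    rw [← mul_div_assoc, div_le_iff₀ (by positivity)]
    nlinarith [K.2]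
  nlinarith [K.2]

/-- The slope 1/ε of the cutoff matters only within distance 2ε of the complement, where `F` is at
most 2Kε. The product contributes 2K there and the slope of `F` another K, uniformly in ε. -/
theorem lipschitzWith_innerCutoff_smul {F : E d → ℂ} {K : ℝ≥0} (hF : LipschitzWith K F)
    (hF0 : ∀ x ∉ U, F x = 0) (hUc : Uᶜ.Nonempty) (hε : 0 < ε) :
    LipschitzWith (3 * K) (fun x => innerCutoff U ε x • F x) := by
  have aux : ∀ x y, Metric.infDist x Uᶜ ≤ 2 * ε →
      ‖innerCutoff U ε x • F x - innerCutoff U ε y • F y‖ ≤ 3 * K * dist x y := by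
    intro x y hx
    have e : innerCutoff U ε x • F x - innerCutoff U ε y • F y =
        (innerCutoff U ε x - innerCutoff U ε y) • F x + innerCutoff U ε y • (F x - F y) := by
      rw [sub_smul, smul_sub]; abel
    rw [e]
    refine (norm_add_le _ _).trans ?_
    rw [norm_smul, norm_smul, Real.norm_of_nonneg innerCutoff_nonneg, Real.norm_eq_abs]
    have h1 : ‖F x‖ ≤ K * (2 * ε) := (norm_le_mul_infDist_compl hF hF0 hUc x).trans
      (mul_le_mul_of_nonneg_left hx K.2)
    have h2 := abs_innerCutoff_sub_le (U := U) hε x y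
    have h3 : ‖F x - F y‖ ≤ K * dist x y := by
      rw [← dist_eq_norm]; exact hF.dist_le_mul x y
    have h4 : |innerCutoff U ε x - innerCutoff U ε y| * ‖F x‖ ≤ dist x y / ε * (K * (2 * ε)) :=
      mul_le_mul h2 h1 (norm_nonneg _) (by positivity)
    have h5 : dist x y / ε * (K * (2 * ε)) = 2 * K * dist x y := by field_simp
    have h6 : innerCutoff U ε y * ‖F x - F y‖ ≤ 1 * (K * dist x y) :=
      mul_le_mul innerCutoff_le_one h3 (norm_nonneg _) zero_le_one
    linarith
  refine LipschitzWith.of_dist_le_mul fun x y => ?_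
  rw [dist_eq_norm]
  push_cast
  by_cases hx : Metric.infDist x Uᶜ ≤ 2 * ε
  · exact aux x y hx
  by_cases hy : Metric.infDist y Uᶜ ≤ 2 * ε
  · rw [norm_sub_rev, dist_comm]
    exact aux y x hy
  · rw [innerCutoff_eq_one hε (not_le.1 hx).le, innerCutoff_eq_one hε (not_le.1 hy).le, one_smul,
      one_smul, ← dist_eq_norm]
    have := hF.dist_le_mul x y
    nlinarith [K.2, dist_nonneg (x := x) (y := y), mul_nonneg K.2 (dist_nonneg (x := x) (y := y))]

end innerCutoff

section
open Filter Topology Convolution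
open ContinuousLinearMap (lsmul)

/-- A kernel of radius at most ε/2 shrinks the zero layer of width ε to one of width at least ε/2,
which keeps the support inside `U`. -/
theorem isTest_mollified {U : Set (E d)} (hUb : Bornology.IsBounded U)
    {H : E d → ℂ} {ε : ℝ} (hε : 0 < ε) (hH : Continuous H)
    (hH0 : ∀ x, Metric.infDist x Uᶜ ≤ ε → H x = 0) (ρ : ContDiffBump (0 : E d))
    (hρ : ρ.rOut ≤ ε / 2) :
    IsTest U (ρ.normed volume ⋆[lsmul ℝ ℝ, volume] H) := by
  have hsub : tsupport (ρ.normed volume ⋆[lsmul ℝ ℝ, volume] H) ⊆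
      {x | ε / 2 ≤ Metric.infDist x Uᶜ} := by
    refine closure_minimal ?_ (isClosed_le continuous_const (Metric.continuous_infDist_pt _))
    intro x hx
    by_contra hcon
    simp only [mem_ofPred_eq, not_le] at hcon
    refine hx ?_
    rw [normed_convolution_congr ρ (H' := fun _ => 0)]
    · simp [convolution_def]
    · intro t ht
      refine hH0 _ ?_
      have := (Metric.lipschitz_infDist_pt Uᶜ).dist_le_mul (x - t) x
      rw [Real.dist_eq, NNReal.coe_one, one_mul, dist_eq_norm, sub_sub_cancel_left,
        norm_neg] at this
      linarith [le_abs_self (Metric.infDist (x - t) Uᶜ - Metric.infDist x Uᶜ)]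
  have hsubU : {x | ε / 2 ≤ Metric.infDist x Uᶜ} ⊆ U := by
    intro x hx
    by_contra hxU
    have : Metric.infDist x Uᶜ = 0 := Metric.infDist_zero_of_mem hxU
    rw [mem_ofPred_eq, this] at hx
    linarith
  refine ⟨?_, ?_, hsub.trans hsubU⟩
  · exact ρ.hasCompactSupport_normed.contDiff_convolution_left _ ρ.contDiff_normed
      hH.locallyIntegrable
  · exact Metric.isCompact_of_isClosed_isBounded (isClosed_tsupport _)
      (hUb.subset (hsub.trans hsubU))

/-- A Lipschitz function vanishing outside of a bounded open set `U` belongs to `H¹₀(U)`. -/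
theorem memH10_of_lipschitzWith {U : Set (E d)} (hU : IsOpen U) (hUb : Bornology.IsBounded U)
    (hUc : Uᶜ.Nonempty) {F : E d → ℂ} {K : ℝ≥0} (hF : LipschitzWith K F)
    (hF0 : ∀ x ∉ U, F x = 0) : MemH10 U F := by
  have hcpt : HasCompactSupport F := by
    refine HasCompactSupport.intro (K := closure U) hUb.isCompact_closure fun x hx => ?_
    exact hF0 x fun h => hx (subset_closure h)
  obtain ⟨B, hB⟩ := hcpt.exists_bound_of_continuous hF.continuous
  let ε : ℕ → ℝ := fun n => 1 / ((n : ℝ) + 1)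
  have hε : ∀ n, 0 < ε n := fun n => by positivity
  have hε0 : Tendsto ε atTop (𝓝 0) := tendsto_one_div_add_atTop_nhds_zero_nat
  let ρ : ℕ → ContDiffBump (0 : E d) := fun n =>
    ⟨ε n / 4, ε n / 2, by linarith [hε n], by linarith [hε n]⟩
  have hρ0 : Tendsto (fun n => (ρ n).rOut) atTop (𝓝 0) := by
    simpa using hε0.div_const 2
  -- Cutting off at distance ε before mollifying at scale ε/2 gives test functions in `U` with
  -- gradients bounded by 3K. Near a fixed point of `U` the cutoff eventually equals one, so the
  -- limits are those of `F` alone.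
  let H : ℕ → E d → ℂ := fun n x => innerCutoff U (ε n) x • F x
  have hH : ∀ n, LipschitzWith (3 * K) (H n) := fun n =>
    lipschitzWith_innerCutoff_smul hF hF0 hUc (hε n)
  have hHt : ∀ n, IsTest U ((ρ n).normed volume ⋆[lsmul ℝ ℝ, volume] H n) := fun n =>
    isTest_mollified hUb (hε n) (hH n).continuous
      (fun x hx => by simp [H, innerCutoff_eq_zero (hε n) hx]) (ρ n) le_rfl
  have hev : ∀ x ∈ U, ∀ᶠ n in atTop, ∀ t, ‖t‖ < (ρ n).rOut →
      2 * ε n < Metric.infDist (x - t) Uᶜ := by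
    intro x hx
    have hpos : 0 < Metric.infDist x Uᶜ :=
      (hU.isClosed_compl.notMem_iff_infDist_pos hUc).1 (by simpa using hx)
    filter_upwards [hε0.eventually (gt_mem_nhds (show 0 < Metric.infDist x Uᶜ / 3 by positivity))]
      with n hn t ht
    have h1 := (Metric.lipschitz_infDist_pt Uᶜ).dist_le_mul x (x - t)
    rw [Real.dist_eq, NNReal.coe_one, one_mul, dist_eq_norm, sub_sub_cancel] at h1
    have h2 := le_abs_self (Metric.infDist x Uᶜ - Metric.infDist (x - t) Uᶜ)
    have h3 : (ρ n).rOut = ε n / 2 := rfl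
    linarith
  have hloc : LocallyIntegrable (fderiv ℝ F) volume := by
    have hbd : ∀ x, ‖fderiv ℝ F x‖ ≤ K := fun x => norm_fderiv_le_of_lipschitz ℝ hF
    refine (locallyIntegrable_const (K : ℝ)).mono
      (measurable_fderiv ℝ F).aestronglyMeasurable (Eventually.of_forall fun x => ?_)
    simpa using hbd x
  -- Lebesgue differentiation for the bounded function `fderiv ℝ F`; the bumps have outer radius
  -- exactly twice the inner one, whence the ratio 2.
  have hlim := ContDiffBump.ae_convolution_tendsto_right_of_locallyIntegrable (φ := ρ) (K := 2)
    hρ0 (Eventually.of_forall fun n => by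
      change ε n / 2 ≤ 2 * (ε n / 4); linarith) hloc
  refine memH10_of_tendsto hU hUb.measure_lt_top
    (φ := fun n => (ρ n).normed volume ⋆[lsmul ℝ ℝ, volume] H n)
    (g := fun i x => fderiv ℝ F x (EuclideanSpace.single i 1)) (M := max B (3 * K)) hHt ?_ ?_ ?_ ?_
  · intro n x
    refine (norm_normed_convolution_le (ρ n) (fun y => ?_) x).trans (le_max_left _ _)
    rw [norm_smul, Real.norm_of_nonneg innerCutoff_nonneg]
    exact (mul_le_of_le_one_left (norm_nonneg _) innerCutoff_le_one).trans (hB y)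
  · intro n i x
    refine le_trans ?_ (le_max_right _ _)
    rw [pderiv, (hasFDerivAt_normed_convolution (ρ n) (hH n) x).fderiv]
    refine (ContinuousLinearMap.le_opNorm _ _).trans ?_
    rw [PiLp.norm_single, norm_one, mul_one]
    refine norm_normed_convolution_le (ρ n) (fun y => ?_) x
    exact_mod_cast norm_fderiv_le_of_lipschitz ℝ (hH n)
  · rw [ae_restrict_iff' hU.measurableSet]
    refine Eventually.of_forall fun x hx => ?_
    refine (ContDiffBump.convolution_tendsto_right_of_continuous (μ := volume) hρ0
      hF.continuous x).congr' ?_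
    filter_upwards [hev x hx] with n hn
    refine (normed_convolution_congr (ρ n) fun t ht => ?_).symm
    simp [H, innerCutoff_eq_one (hε n) (hn t ht).le]
  · intro i
    rw [ae_restrict_iff' hU.measurableSet]
    filter_upwards [hlim] with x hx hxU
    have h1 : Tendsto (fun n => ((ρ n).normed volume ⋆[lsmul ℝ ℝ, volume] fderiv ℝ F) x
        (EuclideanSpace.single i (1 : ℝ))) atTop
        (𝓝 (fderiv ℝ F x (EuclideanSpace.single i (1 : ℝ)))) :=
      ((ContinuousLinearMap.apply ℝ ℂ (EuclideanSpace.single i (1 : ℝ))).continuous.tendsto _).comp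
        hx
    refine h1.congr' ?_
    filter_upwards [hev x hxU] with n hn
    rw [pderiv, (hasFDerivAt_normed_convolution (ρ n) (hH n) x).fderiv]
    congr 1
    refine (normed_convolution_congr (ρ n) fun t ht => ?_).symm
    refine Filter.EventuallyEq.fderiv_eq ?_
    have hop : IsOpen {y : E d | 2 * ε n < Metric.infDist y Uᶜ} :=
      isOpen_lt continuous_const (Metric.continuous_infDist_pt _)
    filter_upwards [hop.mem_nhds (hn t ht)] with y hy
    simp [H, innerCutoff_eq_one (hε n) (le_of_lt hy)]

end

/-! ### Cauchy-Schwarz -/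

theorem integral_mul_le_sqrt_mul_sqrt {α : Type*} [MeasurableSpace α] {μ : Measure α}
    {f g : α → ℝ} (hf : MemLp f 2 μ) (hg : MemLp g 2 μ) (hf0 : ∀ x, 0 ≤ f x)
    (hg0 : ∀ x, 0 ≤ g x) :
    ∫ x, f x * g x ∂μ ≤ √(∫ x, f x ^ 2 ∂μ) * √(∫ x, g x ^ 2 ∂μ) := by
  have h := integral_mul_le_Lp_mul_Lq_of_nonneg (μ := μ) (p := 2) (q := 2)
    (Real.HolderConjugate.two_two) (Filter.Eventually.of_forall hf0)
    (Filter.Eventually.of_forall hg0) (by simpa using hf) (by simpa using hg)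
  simpa [Real.sqrt_eq_rpow] using h

theorem MemW1.memLp_sqrt_dens {U : Set (E d)} {u : E d → ℂ} (h : MemH1 U u) :
    MemLp (fun x => √(dens u (weakGrad U u) x)) 2 (vol U) := by
  rw [memLp_two_iff_integrable_sq]
  · refine h.integrableOn_dens.congr (Filter.Eventually.of_forall fun x => ?_)
    simp only [Real.sq_sqrt (dens_nonneg _ _ _)]
  · exact Real.continuous_sqrt.comp_aestronglyMeasurable h.integrableOn_dens.aestronglyMeasurable

theorem integral_sqrt_dens_mul_le {U : Set (E d)} {u v : E d → ℂ} (hu : MemH1 U u)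
    (hv : MemH1 U v) :
    ∫ x in U, √(dens u (weakGrad U u) x) * √(dens v (weakGrad U v) x) ≤
      norm1 U u * norm1 U v := by
  refine (integral_mul_le_sqrt_mul_sqrt hu.memLp_sqrt_dens hv.memLp_sqrt_dens
    (fun _ => Real.sqrt_nonneg _) fun _ => Real.sqrt_nonneg _).trans_eq ?_
  simp only [Real.sq_sqrt (dens_nonneg _ _ _)]
  rw [← hu.norm1_sq, ← hv.norm1_sq, Real.sqrt_sq (norm1_nonneg _ _),
    Real.sqrt_sq (norm1_nonneg _ _)]

theorem norm_le_sqrt_dens (u : E d → ℂ) (g : Fin d → E d → ℂ) (x : E d) :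
    ‖u x‖ ≤ √(dens u g x) :=
  Real.le_sqrt_of_sq_le (le_add_of_nonneg_right (by positivity))

theorem norm_grad_le_sqrt_dens (u : E d → ℂ) (g : Fin d → E d → ℂ) (i : Fin d) (x : E d) :
    ‖g i x‖ ≤ √(dens u g x) := by
  refine Real.le_sqrt_of_sq_le (le_add_of_nonneg_of_le (by positivity) ?_)
  exact Finset.single_le_sum (f := fun i => ‖g i x‖ ^ 2) (fun _ _ => by positivity)
    (Finset.mem_univ i)

/-! ### The sesquilinear forms -/

/-- The integrand of `a(u, v)`. -/
def aInt (𝒞 : Coeffs d) (u : E d → ℂ) (g : Fin d → E d → ℂ) (v : E d → ℂ)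
    (k : Fin d → E d → ℂ) (x : E d) : ℂ :=
  (∑ i, ∑ j, 𝒞.a i j x * g i x * conj (k j x)) + (∑ i, 𝒞.b i x * g i x * conj (v x))
    + 𝒞.c x * u x * conj (v x)

theorem aForm_eq (𝒞 : Coeffs d) (U : Set (E d)) (u v : E d → ℂ) :
    aForm 𝒞 U u v = ∫ x in U, aInt 𝒞 u (weakGrad U u) v (weakGrad U v) x := rfl

theorem exists_ae_bound {α Z : Type*} [MeasurableSpace α] {μ : Measure α} [NormedAddCommGroup Z]
    {f : α → Z} (hf : MemLp f ∞ μ) : ∃ A : ℝ, 0 ≤ A ∧ ∀ᵐ x ∂μ, ‖f x‖ ≤ A := by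
  refine ⟨(eLpNorm f ∞ μ).toReal, ENNReal.toReal_nonneg, ?_⟩
  have h := ae_le_eLpNormEssSup (f := f) (μ := μ)
  filter_upwards [h] with x hx
  rw [← eLpNorm_exponent_top] at hx
  have := ENNReal.toReal_mono hf.2.ne hx
  simpa using this

section Forms

variable {Ω : Set (E d)} {𝒞 : Coeffs d} {a₀ : ℝ} {u v w : E d → ℂ}

theorem integrable_mul_conj_mul {U : Set (E d)} {a f g : E d → ℂ} (ha : MemLp a ∞ (vol U))
    (hf : MemLp f 2 (vol U)) (hg : MemLp g 2 (vol U)) :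
    Integrable (fun x => a x * f x * conj (g x)) (vol U) := by
  have h1 : Integrable (fun x => f x * conj (g x)) (vol U) := hf.integrable_mul hg.star
  have h2 := h1.mul_of_top_right ha
  refine h2.congr (Filter.Eventually.of_forall fun x => ?_)
  simp [mul_assoc]

theorem Admissible.integrable_aInt (h : Admissible Ω 𝒞 a₀) (hu : MemH1 Ω u) (hv : MemH1 Ω v) :
    Integrable (aInt 𝒞 u (weakGrad Ω u) v (weakGrad Ω v)) (vol Ω) := by
  refine ((integrable_finsetSum _ fun i _ => integrable_finsetSum _ fun j _ => ?_).add
    (integrable_finsetSum _ fun i _ => ?_)).add ?_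
  · exact integrable_mul_conj_mul (h.a_mem i j).1 (hu.hasGrad.1 i) (hv.hasGrad.1 j)
  · exact integrable_mul_conj_mul (h.b_mem i).1 (hu.hasGrad.1 i) hv.1
  · exact integrable_mul_conj_mul h.c_mem hu.1 hv.1

theorem aInt_congr {u' v' : E d → ℂ} {g k g' k' : Fin d → E d → ℂ} {x : E d} (hu : u x = u' x)
    (hg : ∀ i, g i x = g' i x) (hv : v x = v' x) (hk : ∀ i, k i x = k' i x) :
    aInt 𝒞 u g v k x = aInt 𝒞 u' g' v' k' x := by
  simp only [aInt, hu, hg, hv, hk]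

theorem Admissible.aForm_add_left (h : Admissible Ω 𝒞 a₀) (hΩ : IsOpen Ω) (hu : MemH1 Ω u)
    (hw : MemH1 Ω w) (hv : MemH1 Ω v) :
    aForm 𝒞 Ω (u + w) v = aForm 𝒞 Ω u v + aForm 𝒞 Ω w v := by
  rw [aForm_eq, aForm_eq, aForm_eq, ← integral_add (h.integrable_aInt hu hv)
    (h.integrable_aInt hw hv)]
  refine integral_congr_ae ?_
  filter_upwards [ae_all_iff.2 (weakGrad_add hΩ hu hw)] with x hx
  simp only [aInt, hx, Pi.add_apply, mul_add, add_mul, Finset.sum_add_distrib]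
  ring

theorem Admissible.aForm_add_right (h : Admissible Ω 𝒞 a₀) (hΩ : IsOpen Ω) (hu : MemH1 Ω u)
    (hw : MemH1 Ω w) (hv : MemH1 Ω v) :
    aForm 𝒞 Ω v (u + w) = aForm 𝒞 Ω v u + aForm 𝒞 Ω v w := by
  rw [aForm_eq, aForm_eq, aForm_eq, ← integral_add (h.integrable_aInt hv hu)
    (h.integrable_aInt hv hw)]
  refine integral_congr_ae ?_
  filter_upwards [ae_all_iff.2 (weakGrad_add hΩ hu hw)] with x hx
  simp only [aInt, hx, Pi.add_apply, map_add, mul_add, Finset.sum_add_distrib]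
  ring

theorem Admissible.aForm_sub_left (h : Admissible Ω 𝒞 a₀) (hΩ : IsOpen Ω) (hu : MemH1 Ω u)
    (hw : MemH1 Ω w) (hv : MemH1 Ω v) :
    aForm 𝒞 Ω (u - w) v = aForm 𝒞 Ω u v - aForm 𝒞 Ω w v := by
  rw [eq_sub_iff_add_eq, ← h.aForm_add_left hΩ (hu.sub hw) hw hv, sub_add_cancel]

theorem Admissible.aForm_sub_right (h : Admissible Ω 𝒞 a₀) (hΩ : IsOpen Ω) (hu : MemH1 Ω u)
    (hw : MemH1 Ω w) (hv : MemH1 Ω v) :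
    aForm 𝒞 Ω v (u - w) = aForm 𝒞 Ω v u - aForm 𝒞 Ω v w := by
  rw [eq_sub_iff_add_eq, ← h.aForm_add_right hΩ (hu.sub hw) hw hv, sub_add_cancel]

/-- Continuity of the form `a` on `H¹(Ω)`. -/
theorem Admissible.exists_norm_aForm_le (h : Admissible Ω 𝒞 a₀) :
    ∃ M : ℝ, 0 ≤ M ∧ ∀ u v, MemH1 Ω u → MemH1 Ω v →
      ‖aForm 𝒞 Ω u v‖ ≤ M * (norm1 Ω u * norm1 Ω v) := by
  choose A hA0 hA using fun i j => exists_ae_bound (h.a_mem i j).1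
  choose B hB0 hB using fun i => exists_ae_bound (h.b_mem i).1
  obtain ⟨D, hD0, hD⟩ := exists_ae_bound h.c_mem
  have hM0 : 0 ≤ (∑ i, ∑ j, A i j) + (∑ i, B i) + D := add_nonneg (add_nonneg
    (Finset.sum_nonneg fun i _ => Finset.sum_nonneg fun j _ => hA0 i j)
    (Finset.sum_nonneg fun i _ => hB0 i)) hD0
  refine ⟨(∑ i, ∑ j, A i j) + (∑ i, B i) + D, hM0, fun u v hu hv => ?_⟩
  refine le_trans ?_ (mul_le_mul_of_nonneg_left (integral_sqrt_dens_mul_le hu hv) hM0)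
  rw [← integral_const_mul]
  refine norm_integral_le_of_norm_le ((hu.memLp_sqrt_dens.integrable_mul
    hv.memLp_sqrt_dens).const_mul _) ?_
  filter_upwards [ae_all_iff.2 fun i => ae_all_iff.2 (hA i), ae_all_iff.2 hB, hD] with x h1 h2 h3
  set s := √(dens u (weakGrad Ω u) x)
  set t := √(dens v (weakGrad Ω v) x)
  have key : ∀ (α : ℝ) (p q r : ℂ), 0 ≤ α → ‖p‖ ≤ α → ‖q‖ ≤ s → ‖r‖ ≤ t →
      ‖p * q * conj r‖ ≤ α * (s * t) := by
    intro α p q r hα hp hq hr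
    rw [norm_mul, norm_mul, RCLike.norm_conj, mul_assoc]
    exact mul_le_mul hp (mul_le_mul hq hr (norm_nonneg _) (Real.sqrt_nonneg _))
      (by positivity) hα
  rw [add_mul, add_mul, Finset.sum_mul, Finset.sum_mul]
  simp only [Finset.sum_mul]
  refine (norm_add_le _ _).trans (add_le_add ((norm_add_le _ _).trans (add_le_add ?_ ?_)) ?_)
  · refine (norm_sum_le _ _).trans (Finset.sum_le_sum fun i _ => (norm_sum_le _ _).trans
      (Finset.sum_le_sum fun j _ => ?_))
    exact key _ _ _ _ (hA0 i j) (h1 i j) (norm_grad_le_sqrt_dens _ _ i x)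
      (norm_grad_le_sqrt_dens _ _ j x)
  · refine (norm_sum_le _ _).trans (Finset.sum_le_sum fun i _ => ?_)
    exact key _ _ _ _ (hB0 i) (h2 i) (norm_grad_le_sqrt_dens _ _ i x) (norm_le_sqrt_dens _ _ x)
  · exact key _ _ _ _ hD0 h3 (norm_le_sqrt_dens _ _ x) (norm_le_sqrt_dens _ _ x)

theorem Admissible.memLp_m (h : Admissible Ω 𝒞 a₀) :
    MemLp (fun x => (𝒞.m x : ℂ)) ∞ (vol Ω) := h.m_mem.ofReal

theorem Admissible.bForm_sub_left (h : Admissible Ω 𝒞 a₀) (hu : MemLp u 2 (vol Ω))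
    (hw : MemLp w 2 (vol Ω)) (hv : MemLp v 2 (vol Ω)) (s t : ℂ) :
    bForm 𝒞 Ω (s • u - t • w) v = s * bForm 𝒞 Ω u v - t * bForm 𝒞 Ω w v := by
  have h1 := integrable_mul_conj_mul h.memLp_m hu hv
  have h2 := integrable_mul_conj_mul h.memLp_m hw hv
  simp only [bForm]
  rw [← integral_const_mul, ← integral_const_mul, ← integral_sub (h1.const_mul s) (h2.const_mul t)]
  refine integral_congr_ae (Filter.Eventually.of_forall fun x => ?_)
  simp only [Pi.sub_apply, Pi.smul_apply, smul_eq_mul]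
  ring

theorem Admissible.bForm_sub_right (h : Admissible Ω 𝒞 a₀) (hu : MemLp u 2 (vol Ω))
    (hw : MemLp w 2 (vol Ω)) (hv : MemLp v 2 (vol Ω)) (s t : ℂ) :
    bForm 𝒞 Ω v (s • u - t • w) = conj s * bForm 𝒞 Ω v u - conj t * bForm 𝒞 Ω v w := by
  have h1 := integrable_mul_conj_mul h.memLp_m hv hu
  have h2 := integrable_mul_conj_mul h.memLp_m hv hw
  simp only [bForm]
  rw [← integral_const_mul, ← integral_const_mul,
    ← integral_sub (h1.const_mul (conj s)) (h2.const_mul (conj t))]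
  refine integral_congr_ae (Filter.Eventually.of_forall fun x => ?_)
  simp only [Pi.sub_apply, Pi.smul_apply, smul_eq_mul, map_sub, map_mul]
  ring

/-- Continuity of the form `b` on `L²(Ω)`. -/
theorem Admissible.exists_norm_bForm_le (h : Admissible Ω 𝒞 a₀) :
    ∃ M : ℝ, 0 ≤ M ∧ ∀ u v, MemLp u 2 (vol Ω) → MemLp v 2 (vol Ω) →
      ‖bForm 𝒞 Ω u v‖ ≤ M * (norm0 Ω u * norm0 Ω v) := by
  obtain ⟨M, hM0, hM⟩ := exists_ae_bound h.memLp_m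
  refine ⟨M, hM0, fun u v hu hv => ?_⟩
  have hCS := integral_mul_le_sqrt_mul_sqrt hu.norm hv.norm (fun _ => norm_nonneg _)
    fun _ => norm_nonneg _
  refine le_trans ?_ (mul_le_mul_of_nonneg_left hCS hM0)
  rw [← integral_const_mul]
  refine norm_integral_le_of_norm_le ((hu.norm.integrable_mul hv.norm).const_mul _) ?_
  filter_upwards [hM] with x hx
  rw [norm_mul, norm_mul, RCLike.norm_conj, mul_assoc]
  exact mul_le_mul_of_nonneg_right hx (by positivity)

/-! ### Localization of the forms -/

variable {W : Set (E d)} {u' v' : E d → ℂ}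

/-- On the open set Ω \ closure W this is locality of the weak gradient; what remains of Ω \ W lies
in the frontier of W, a null set. -/
theorem ae_diff_weakGrad_eq_zero (hΩ : IsOpen Ω) (hW : IsOpen W)
    (hnull : volume (frontier W) = 0) (hv : MemH1 Ω v) (hv0 : ∀ x ∈ Ω \ closure W, v x = 0) :
    ∀ᵐ x ∂(vol (Ω \ W)), v x = 0 ∧ ∀ i, weakGrad Ω v i x = 0 := by
  have hO : IsOpen (Ω \ closure W) := hΩ.sdiff isClosed_closure
  have h1 : v =ᵐ[vol (Ω \ closure W)] 0 := by
    rw [Filter.EventuallyEq, ae_restrict_iff' hO.measurableSet]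
    exact Filter.Eventually.of_forall hv0
  have h0 : HasGrad (Ω \ closure W) (0 : E d → ℂ) 0 :=
    ⟨fun i => MemLp.zero, fun φ _ i => by simp⟩
  have h2 : ∀ i, weakGrad Ω v i =ᵐ[vol (Ω \ closure W)] 0 := fun i =>
    (weakGrad_ae_eq_of_ae_eq hΩ hO sdiff_subset hv h1 i).trans (h0.weakGrad_ae_eq hO i)
  have h3 : ∀ᵐ x, x ∉ frontier W := by
    rw [ae_iff]; simpa using hnull
  have h4 : ∀ᵐ x ∂(vol (Ω \ closure W)), v x = 0 ∧ ∀ i, weakGrad Ω v i x = 0 := by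
    filter_upwards [h1, ae_all_iff.2 h2] with x a b using ⟨a, b⟩
  rw [ae_restrict_iff' hO.measurableSet] at h4
  rw [ae_restrict_iff' (hΩ.measurableSet.diff hW.measurableSet)]
  filter_upwards [h3, h4] with x ha hb hx
  refine hb ⟨hx.1, fun hc => ha ?_⟩
  rw [hW.frontier_eq]
  exact ⟨hc, hx.2⟩

theorem setIntegral_eq_of_ae_diff_eq_zero {f : E d → ℂ} (hΩ : MeasurableSet Ω)
    (hW : MeasurableSet W) (hWΩ : W ⊆ Ω) (hf : ∀ᵐ x ∂(vol (Ω \ W)), f x = 0) :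
    ∫ x in Ω, f x = ∫ x in W, f x := by
  refine setIntegral_eq_of_subset_of_ae_sdiff_eq_zero hΩ.nullMeasurableSet hWΩ ?_
  rwa [ae_restrict_iff' (hΩ.diff hW)] at hf

/-- This turns the local correction problem, with gradients taken on W, into an identity for the
form on Ω tested with functions extended by zero. On W any representatives may be used. -/
theorem aForm_local_right (hΩ : IsOpen Ω) (hWΩ : W ⊆ Ω) (hW : IsOpen W)
    (hnull : volume (frontier W) = 0) (hu : MemH1 Ω u) (hv : MemH1 Ω v)
    (hv0 : ∀ x ∈ Ω \ closure W, v x = 0) (hu' : u =ᵐ[vol W] u') (hv' : v =ᵐ[vol W] v') :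
    aForm 𝒞 W u' v' = aForm 𝒞 Ω u v := by
  have h1 := weakGrad_ae_eq_of_ae_eq hΩ hW hWΩ hu hu'
  have h2 := weakGrad_ae_eq_of_ae_eq hΩ hW hWΩ hv hv'
  rw [aForm_eq, aForm_eq]
  rw [setIntegral_eq_of_ae_diff_eq_zero hΩ.measurableSet hW.measurableSet hWΩ]
  · refine integral_congr_ae ?_
    filter_upwards [hu', hv', ae_all_iff.2 h1, ae_all_iff.2 h2] with x a b c e
    exact (aInt_congr a c b e).symm
  · filter_upwards [ae_diff_weakGrad_eq_zero hΩ hW hnull hv hv0] with x hx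
    simp [aInt, hx.1, hx.2]

/-- The counterpart for the adjoint problem, where the test function occupies the first slot. -/
theorem aForm_local_left (hΩ : IsOpen Ω) (hWΩ : W ⊆ Ω) (hW : IsOpen W)
    (hnull : volume (frontier W) = 0) (hu : MemH1 Ω u) (hv : MemH1 Ω v)
    (hv0 : ∀ x ∈ Ω \ closure W, v x = 0) (hu' : u =ᵐ[vol W] u') (hv' : v =ᵐ[vol W] v') :
    aForm 𝒞 W v' u' = aForm 𝒞 Ω v u := by
  have h1 := weakGrad_ae_eq_of_ae_eq hΩ hW hWΩ hu hu'
  have h2 := weakGrad_ae_eq_of_ae_eq hΩ hW hWΩ hv hv'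
  rw [aForm_eq, aForm_eq]
  rw [setIntegral_eq_of_ae_diff_eq_zero hΩ.measurableSet hW.measurableSet hWΩ]
  · refine integral_congr_ae ?_
    filter_upwards [hu', hv', ae_all_iff.2 h1, ae_all_iff.2 h2] with x a b c e
    exact (aInt_congr b e a c).symm
  · filter_upwards [ae_diff_weakGrad_eq_zero hΩ hW hnull hv hv0] with x hx
    simp [aInt, hx.1, hx.2]

theorem bForm_local (hΩ : IsOpen Ω) (hWΩ : W ⊆ Ω) (hW : IsOpen W)
    (hv0 : ∀ x ∈ Ω \ W, u x = 0 ∨ v x = 0) (hu' : u =ᵐ[vol W] u') (hv' : v =ᵐ[vol W] v') :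
    bForm 𝒞 W u' v' = bForm 𝒞 Ω u v := by
  rw [bForm, bForm, setIntegral_eq_of_ae_diff_eq_zero hΩ.measurableSet hW.measurableSet hWΩ]
  · refine integral_congr_ae ?_
    filter_upwards [hu', hv'] with x a b
    rw [a, b]
  · rw [ae_restrict_iff' (hΩ.measurableSet.diff hW.measurableSet)]
    refine Filter.Eventually.of_forall fun x hx => ?_
    rcases hv0 x hx with h | h <;> simp [h]

end Forms

/-! ### Polynomial functions -/

/-- The function on `ℝᵈ` defined by a polynomial with complex coefficients. -/
def pev (p : MvPolynomial (Fin d) ℂ) (x : E d) : ℂ :=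
  MvPolynomial.eval (fun i => (x i : ℂ)) p

@[simp] theorem pev_C (c : ℂ) (x : E d) : pev (MvPolynomial.C c) x = c := by simp [pev]

@[simp] theorem pev_X (i : Fin d) (x : E d) : pev (MvPolynomial.X i) x = x i := by simp [pev]

@[simp] theorem pev_add (p q : MvPolynomial (Fin d) ℂ) (x : E d) :
    pev (p + q) x = pev p x + pev q x := by simp [pev]

@[simp] theorem pev_sub (p q : MvPolynomial (Fin d) ℂ) (x : E d) :
    pev (p - q) x = pev p x - pev q x := by simp [pev]

@[simp] theorem pev_mul (p q : MvPolynomial (Fin d) ℂ) (x : E d) :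
    pev (p * q) x = pev p x * pev q x := by simp [pev]

@[simp] theorem pev_zero (x : E d) : pev 0 x = 0 := by simp [pev]

@[simp] theorem pev_one (x : E d) : pev 1 x = 1 := by simp [pev]

@[simp] theorem pev_smul (c : ℂ) (p : MvPolynomial (Fin d) ℂ) (x : E d) :
    pev (c • p) x = c * pev p x := by simp [pev]

theorem pev_sum {ι : Type*} (s : Finset ι) (p : ι → MvPolynomial (Fin d) ℂ) (x : E d) :
    pev (∑ i ∈ s, p i) x = ∑ i ∈ s, pev (p i) x := by simp [pev]

theorem contDiff_pev (p : MvPolynomial (Fin d) ℂ) : ContDiff ℝ ∞ (pev p) := by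
  induction p using MvPolynomial.induction_on with
  | C a =>
    have : pev (MvPolynomial.C a) = fun _ : E d => a := by ext x; simp
    rw [this]; exact contDiff_const
  | add p q hp hq =>
    have : pev (p + q) = fun x : E d => pev p x + pev q x := by ext x; simp
    rw [this]; exact hp.add hq
  | mul_X p i hp =>
    have : pev (p * MvPolynomial.X i) = fun x : E d => pev p x * (x i : ℂ) := by ext x; simp
    rw [this]
    exact hp.mul (Complex.ofRealCLM.contDiff.comp (EuclideanSpace.proj (𝕜 := ℝ) i).contDiff)

theorem differentiable_pev (p : MvPolynomial (Fin d) ℂ) : Differentiable ℝ (pev p) :=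
  (contDiff_pev p).differentiable (by simp)

theorem continuous_pev (p : MvPolynomial (Fin d) ℂ) : Continuous (pev p) :=
  (contDiff_pev p).continuous

theorem pderiv_pev (p : MvPolynomial (Fin d) ℂ) (i : Fin d) (x : E d) :
    pderiv i (pev p) x = pev (MvPolynomial.pderiv i p) x := by
  induction p using MvPolynomial.induction_on with
  | C a =>
    have : pev (MvPolynomial.C a) = fun _ : E d => a := by ext x; simp
    rw [this, MvPolynomial.pderiv_C]
    simp [pderiv]
  | add p q hp hq =>
    have : pev (p + q) = fun x : E d => pev p x + pev q x := by ext x; simp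
    rw [this, map_add, pev_add, ← hp, ← hq]
    simp [pderiv, fderiv_fun_add (differentiable_pev p x) (differentiable_pev q x)]
  | mul_X p j hp =>
    have : pev (p * MvPolynomial.X j) = fun x : E d => pev p x * (x j : ℂ) := by ext x; simp
    have hX : HasFDerivAt (fun x : E d => (x j : ℂ))
        (Complex.ofRealCLM.comp (EuclideanSpace.proj (𝕜 := ℝ) j)) x :=
      (Complex.ofRealCLM.comp (EuclideanSpace.proj (𝕜 := ℝ) j)).hasFDerivAt
    rw [this, MvPolynomial.pderiv_mul, pev_add, pev_mul, pev_mul, ← hp, pderiv,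
      ((differentiable_pev p x).hasFDerivAt.fun_mul hX).fderiv]
    rcases eq_or_ne j i with rfl | hij
    · simp [pderiv, mul_comm, add_comm]
    · simp [pderiv, MvPolynomial.pderiv_X_of_ne hij, hij, mul_comm]

theorem totalDegree_pderiv_le {p : MvPolynomial (Fin d) ℂ} {r : ℕ} (hp : p.totalDegree ≤ r)
    (i : Fin d) : (MvPolynomial.pderiv i p).totalDegree ≤ r - 1 := by
  rw [p.as_sum, map_sum]
  refine MvPolynomial.totalDegree_finsetSum_le fun s hs => ?_
  rw [MvPolynomial.pderiv_monomial]
  by_cases h : s i = 0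
  · simp [h]
  refine (MvPolynomial.totalDegree_monomial_le _ _).trans ?_
  have h1 := (MvPolynomial.le_totalDegree hs).trans hp
  have h2 : s - Finsupp.single i 1 + Finsupp.single i 1 = s := Finsupp.sub_add_single_one_cancel h
  have h3 := congrArg Finsupp.degree h2
  rw [map_add, Finsupp.degree_single] at h3
  have h4 : s.degree = s.sum fun _ e => e := by
    simp [Finsupp.degree_apply, Finsupp.sum]
  have h5 : ((s - Finsupp.single i 1).sum fun _ => id) = (s - Finsupp.single i 1).degree := by
    simp [Finsupp.degree_apply, Finsupp.sum]
  rw [h5]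
  omega

/-- By Euler's identity, r - x·∇ multiplies a monomial of degree k by r - k, so the part of degree r
is annihilated. -/
theorem totalDegree_euler_le {p : MvPolynomial (Fin d) ℂ} {r : ℕ} (hr : 1 ≤ r)
    (hp : p.totalDegree ≤ r) :
    (MvPolynomial.C (r : ℂ) * p - ∑ k, MvPolynomial.X k * MvPolynomial.pderiv k p).totalDegree
      ≤ r - 1 := by
  have e : MvPolynomial.C (r : ℂ) * p - ∑ k, MvPolynomial.X k * MvPolynomial.pderiv k p =
      ∑ s ∈ p.support, MvPolynomial.monomial s (((r : ℂ) - s.degree) * p.coeff s) := by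
    conv_lhs => rw [p.as_sum]
    simp only [map_sum, Finset.mul_sum, MvPolynomial.X_mul_pderiv_monomial]
    rw [Finset.sum_comm, ← Finset.sum_sub_distrib]
    refine Finset.sum_congr rfl fun s _ => ?_
    rw [MvPolynomial.C_mul_monomial, ← Finset.sum_smul, MvPolynomial.smul_monomial,
      ← map_sub]
    congr 1
    rw [nsmul_eq_mul, sub_mul, Finsupp.degree_eq_sum]
  rw [e]
  refine MvPolynomial.totalDegree_finsetSum_le fun s hs => ?_
  have h1 := (MvPolynomial.le_totalDegree hs).trans hp
  have h4 : s.degree = s.sum fun _ e => e := by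
    simp [Finsupp.degree_apply, Finsupp.sum]
  by_cases h : s.degree = r
  · simp [h]
  refine (MvPolynomial.totalDegree_monomial_le _ _).trans ?_
  have h5 : (s.sum fun _ => id) = s.degree := by
    simp [Finsupp.degree_apply, Finsupp.sum]
  rw [h5]
  omega

/-- The polynomial of an affine function has degree at most one. -/
theorem exists_poly_of_affine (f : E d →ᵃ[ℝ] ℝ) :
    ∃ p : MvPolynomial (Fin d) ℂ, p.totalDegree ≤ 1 ∧ ∀ x, pev p x = (f x : ℂ) := by
  refine ⟨MvPolynomial.C (f 0 : ℂ) + ∑ k,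
    MvPolynomial.C (f.linear (EuclideanSpace.single k 1) : ℂ) * MvPolynomial.X k, ?_, fun x => ?_⟩
  · refine (MvPolynomial.totalDegree_add _ _).trans (max_le (by simp) ?_)
    refine MvPolynomial.totalDegree_finsetSum_le fun k _ => ?_
    exact (MvPolynomial.totalDegree_mul _ _).trans (by simp)
  · rw [pev_add, pev_sum]
    simp only [pev_C, pev_mul, pev_X]
    have h1 : f x = f.linear x + f 0 := congrFun f.decomp x
    have h2 : x = ∑ k, x k • EuclideanSpace.single k (1 : ℝ) := by
      have := (EuclideanSpace.basisFun (Fin d) ℝ).sum_repr x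
      simpa using this.symm
    rw [h1]
    conv_rhs => rw [h2, map_sum]
    push_cast
    rw [add_comm]
    congr 1
    refine Finset.sum_congr rfl fun k _ => ?_
    rw [map_smul, smul_eq_mul]
    push_cast
    ring

/-- The degree-preserving local cutoff operation for polynomials of degree at most `r`. -/
theorem exists_poly_cutoff {r : ℕ} (hr : 1 ≤ r) {p : MvPolynomial (Fin d) ℂ}
    (hp : p.totalDegree ≤ r) {χ : MvPolynomial (Fin d) ℂ} {M : Fin d → MvPolynomial (Fin d) ℂ}
    (hχ : χ.totalDegree ≤ 1) (hM : ∀ k, (M k).totalDegree ≤ 1) :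
    ∃ q : MvPolynomial (Fin d) ℂ, q.totalDegree ≤ r ∧ ∀ x, pev q x = pev χ x * pev p x +
      (r : ℂ)⁻¹ * ∑ k, pev (MvPolynomial.pderiv k p) x * (pev (M k) x - pev χ x * (x k : ℂ)) := by
  -- The expression rearranges to r⁻¹(χ (r p - x·∇p) + M·∇p). The factors multiplied by χ and by M
  -- have degree at most r - 1, which leaves room for one affine factor.
  refine ⟨MvPolynomial.C (r : ℂ)⁻¹ *
    (χ * (MvPolynomial.C (r : ℂ) * p - ∑ k, MvPolynomial.X k * MvPolynomial.pderiv k p) +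
      ∑ k, M k * MvPolynomial.pderiv k p), ?_, fun x => ?_⟩
  · refine (MvPolynomial.totalDegree_mul _ _).trans ?_
    rw [MvPolynomial.totalDegree_C, zero_add]
    refine (MvPolynomial.totalDegree_add _ _).trans (max_le ?_ ?_)
    · refine (MvPolynomial.totalDegree_mul _ _).trans ?_
      have := totalDegree_euler_le hr hp
      omega
    · refine MvPolynomial.totalDegree_finsetSum_le fun k _ => ?_
      refine (MvPolynomial.totalDegree_mul _ _).trans ?_
      have := totalDegree_pderiv_le hp k
      have := hM k
      omega
  · have hr0 : (r : ℂ) ≠ 0 := by exact_mod_cast (by omega : r ≠ 0)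
    simp only [pev_mul, pev_C, pev_add, pev_sub, pev_sum, pev_X, mul_sub, Finset.sum_sub_distrib]
    have e : ∑ k, pev (MvPolynomial.pderiv k p) x * (pev χ x * (x k : ℂ)) =
        pev χ x * ∑ k, (x k : ℂ) * pev (MvPolynomial.pderiv k p) x := by
      rw [Finset.mul_sum]
      exact Finset.sum_congr rfl fun k _ => by ring
    have e' : ∑ k, pev (M k) x * pev (MvPolynomial.pderiv k p) x =
        ∑ k, pev (MvPolynomial.pderiv k p) x * pev (M k) x :=
      Finset.sum_congr rfl fun k _ => by ring
    rw [e, e']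
    field_simp
    ring

/-- Rescaling of a polynomial. -/
theorem exists_poly_rescale {r : ℕ} {p : MvPolynomial (Fin d) ℂ} (hp : p.totalDegree ≤ r)
    (y : E d) (h : ℝ) :
    ∃ q : MvPolynomial (Fin d) ℂ, q.totalDegree ≤ r ∧ ∀ z, pev q z = pev p (y + h • z) := by
  let f : Fin d → MvPolynomial (Fin d) ℂ := fun i =>
    MvPolynomial.C (y i : ℂ) + MvPolynomial.C (h : ℂ) * MvPolynomial.X i
  have hf : ∀ i, (f i).totalDegree ≤ 1 := fun i =>
    (MvPolynomial.totalDegree_add _ _).trans (max_le (by simp)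
      ((MvPolynomial.totalDegree_mul _ _).trans (by simp)))
  refine ⟨MvPolynomial.bind₁ f p, ?_, fun z => ?_⟩
  · rw [p.as_sum, map_sum]
    refine MvPolynomial.totalDegree_finsetSum_le fun s hs => ?_
    rw [MvPolynomial.bind₁_monomial]
    refine (MvPolynomial.totalDegree_mul _ _).trans ?_
    rw [MvPolynomial.totalDegree_C, zero_add]
    refine (MvPolynomial.totalDegree_finsetProd _ _).trans ?_
    refine le_trans (Finset.sum_le_sum fun i _ => ?_) ((MvPolynomial.le_totalDegree hs).trans hp)
    refine (MvPolynomial.totalDegree_pow _ _).trans ?_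
    exact (Nat.mul_le_mul_left _ (hf i)).trans (by simp)
  · simp only [pev, MvPolynomial.eval, MvPolynomial.eval₂Hom_bind₁]
    congr 2
    ext i
    simp [f]

/-! ### Inverse estimates for polynomials -/

theorem memLp_pev (p : MvPolynomial (Fin d) ℂ) (y : E d) (ρ : ℝ) :
    MemLp (pev p) 2 (vol (Metric.ball y ρ)) := by
  obtain ⟨C, hC⟩ := (isCompact_closedBall y ρ).exists_bound_of_continuousOn
    (continuous_pev p).continuousOn
  have : IsFiniteMeasure (vol (Metric.ball y ρ)) :=
    isFiniteMeasure_restrict.2 measure_ball_lt_top.ne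
  refine MemLp.of_bound (continuous_pev p).aestronglyMeasurable C ?_
  rw [ae_restrict_iff' measurableSet_ball]
  exact Filter.Eventually.of_forall fun x hx => hC x (Metric.ball_subset_closedBall hx)

/-- A polynomial vanishing on a ball is zero. -/
theorem eq_zero_of_pev_eq_zero {p : MvPolynomial (Fin d) ℂ} {ρ : ℝ} (hρ : 0 < ρ)
    (h : ∀ x ∈ Metric.ball (0 : E d) ρ, pev p x = 0) : p = 0 := by
  have hopen : IsOpen {f : Fin d → ℝ | WithLp.toLp 2 f ∈ Metric.ball (0 : E d) ρ} :=
    Metric.isOpen_ball.preimage (PiLp.continuous_toLp 2 _)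
  -- The ball contains a cube, and a polynomial vanishing on a product of infinite sets is zero.
  obtain ⟨η, hη, hsub⟩ := Metric.isOpen_iff.1 hopen 0 (by simpa using hρ)
  refine MvPolynomial.funext_set (fun _ => (fun t : ℝ => (t : ℂ)) '' Ioo (-η) η)
    (fun _ => (Ioo_infinite (by linarith)).image (Complex.ofReal_injective.injOn)) fun x hx => ?_
  choose f hf hfx using fun i => hx i (mem_univ i)
  have hmem : f ∈ Metric.ball (0 : Fin d → ℝ) η := by
    rw [mem_ball_zero_iff, pi_norm_lt_iff hη]
    exact fun i => abs_lt.2 (hf i)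
  have h0 := h _ (hsub hmem)
  have hx' : x = fun i => ((f i : ℝ) : ℂ) := funext fun i => (hfx i).symm
  rw [map_zero, hx']
  exact h0

/-- The restriction of polynomials to a ball, as a linear map into `L²`. -/
def pevLp (r : ℕ) (ρ : ℝ) : MvPolynomial.restrictTotalDegree (Fin d) ℂ r →ₗ[ℂ]
    Lp ℂ 2 (vol (Metric.ball (0 : E d) ρ)) where
  toFun p := (memLp_pev (p : MvPolynomial (Fin d) ℂ) 0 ρ).toLp _
  map_add' p q := by
    rw [← MemLp.toLp_add]
    exact MemLp.toLp_congr _ _ (Filter.Eventually.of_forall fun x => by simp)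
  map_smul' c p := by
    rw [RingHom.id_apply, ← MemLp.toLp_const_smul]
    exact MemLp.toLp_congr _ _ (Filter.Eventually.of_forall fun x => by simp)

theorem pevLp_injective (r : ℕ) {ρ : ℝ} (hρ : 0 < ρ) :
    Function.Injective (pevLp (d := d) r ρ) := by
  rw [injective_iff_map_eq_zero]
  intro p hp
  have h1 : pev (p : MvPolynomial (Fin d) ℂ) =ᵐ[vol (Metric.ball (0 : E d) ρ)] fun _ => 0 := by
    have := (memLp_pev (p : MvPolynomial (Fin d) ℂ) 0 ρ).coeFn_toLp
    have h2 : (memLp_pev (p : MvPolynomial (Fin d) ℂ) 0 ρ).toLp _ = 0 := hp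
    rw [h2] at this
    exact this.symm.trans (Lp.coeFn_zero ℂ 2 _)
  have h3 := Measure.eqOn_open_of_ae_eq h1 Metric.isOpen_ball
    (continuous_pev _).continuousOn continuousOn_const
  exact Subtype.ext (eq_zero_of_pev_eq_zero hρ h3)

theorem norm_pevLp_sq (r : ℕ) (ρ : ℝ) (p : MvPolynomial.restrictTotalDegree (Fin d) ℂ r) :
    ‖pevLp r ρ p‖ ^ 2 =
      ∫ x in Metric.ball (0 : E d) ρ, ‖pev (p : MvPolynomial (Fin d) ℂ) x‖ ^ 2 := by
  have h : ‖pevLp r ρ p‖ = ‖(memLp_pev (p : MvPolynomial (Fin d) ℂ) 0 ρ).toLp _‖ := rfl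
  rw [h, Lp.norm_toLp, (memLp_pev (p : MvPolynomial (Fin d) ℂ) 0 ρ).eLpNorm_eq_integral_rpow_norm
    (by norm_num) (by norm_num), ENNReal.toReal_ofReal (by positivity)]
  simp only [ENNReal.toReal_ofNat, Real.rpow_ofNat]
  rw [show (2⁻¹ : ℝ) = 1 / 2 by norm_num, ← Real.sqrt_eq_rpow,
    Real.sq_sqrt (integral_nonneg fun x => by positivity)]

/-- Polynomials of bounded degree form a finite-dimensional space, embedded in L² of the ball; every
linear functional on the image is automatically continuous. -/
theorem exists_coeff_bound (r : ℕ) {ρ : ℝ} (hρ : 0 < ρ)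
    (Λ : MvPolynomial (Fin d) ℂ →ₗ[ℂ] ℂ) :
    ∃ K : ℝ, 0 ≤ K ∧ ∀ p : MvPolynomial.restrictTotalDegree (Fin d) ℂ r,
      ‖Λ p‖ ≤ K * ‖pevLp r ρ p‖ := by
  let e := LinearEquiv.ofInjective (pevLp (d := d) r ρ) (pevLp_injective r hρ)
  have : FiniteDimensional ℂ (LinearMap.range (pevLp (d := d) r ρ)) := inferInstance
  let L : LinearMap.range (pevLp (d := d) r ρ) →ₗ[ℂ] ℂ :=
    (Λ.comp (MvPolynomial.restrictTotalDegree (Fin d) ℂ r).subtype).comp e.symm.toLinearMap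
  refine ⟨‖LinearMap.toContinuousLinearMap L‖, ContinuousLinearMap.opNorm_nonneg _, fun p => ?_⟩
  have h := (LinearMap.toContinuousLinearMap L).le_opNorm (e p)
  have h2 : LinearMap.toContinuousLinearMap L (e p) = Λ p := by simp [L]
  rw [h2] at h
  exact h

theorem norm_pev_le_sum {p : MvPolynomial (Fin d) ℂ} {r : ℕ} (hp : p.totalDegree ≤ r) {x : E d}
    (hx : ‖x‖ ≤ 1) :
    ‖pev p x‖ ≤ ∑ s ∈ (Finsupp.finite_of_degree_le (σ := Fin d) r).toFinset, ‖p.coeff s‖ := by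
  rw [pev, MvPolynomial.eval_eq]
  refine (norm_sum_le _ _).trans ?_
  refine (Finset.sum_le_sum fun s _ => ?_).trans
    (Finset.sum_le_sum_of_subset_of_nonneg ?_ fun s _ _ => norm_nonneg _)
  · rw [norm_mul, norm_prod]
    refine mul_le_of_le_one_right (norm_nonneg _) (Finset.prod_le_one (fun _ _ => norm_nonneg _) ?_)
    intro i _
    rw [norm_pow]
    refine pow_le_one₀ (norm_nonneg _) ?_
    rw [Complex.norm_real]
    exact (PiLp.norm_apply_le x i).trans hx
  · intro s hs
    rw [Set.Finite.mem_toFinset]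
    have := (MvPolynomial.le_totalDegree hs).trans hp
    simpa [Finsupp.degree_apply, Finsupp.sum] using this

/-- On the unit ball a polynomial is bounded by the sum of the moduli of its coefficients, and each
coefficient of `D p` is an L²-bounded functional of `p`. It serves with `D` the identity and the
partial derivatives. -/
theorem exists_unit_bound (r : ℕ) {ρ : ℝ} (hρ : 0 < ρ)
    (D : MvPolynomial (Fin d) ℂ →ₗ[ℂ] MvPolynomial (Fin d) ℂ)
    (hD : ∀ p : MvPolynomial (Fin d) ℂ, p.totalDegree ≤ r → (D p).totalDegree ≤ r) :
    ∃ C : ℝ, 0 ≤ C ∧ ∀ p : MvPolynomial (Fin d) ℂ, p.totalDegree ≤ r → ∀ x : E d, ‖x‖ ≤ 1 →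
      ‖pev (D p) x‖ ^ 2 ≤ C * ∫ x in Metric.ball (0 : E d) ρ, ‖pev p x‖ ^ 2 := by
  choose K hK0 hK using fun s : Fin d →₀ ℕ =>
    exists_coeff_bound r hρ ((MvPolynomial.lcoeff ℂ s).comp D)
  let S := (Finsupp.finite_of_degree_le (σ := Fin d) r).toFinset
  refine ⟨(∑ s ∈ S, K s) ^ 2, sq_nonneg _, fun p hp x hx => ?_⟩
  have hp' : p ∈ MvPolynomial.restrictTotalDegree (Fin d) ℂ r :=
    (MvPolynomial.mem_restrictTotalDegree _ _ _).2 hp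
  rw [← norm_pevLp_sq r ρ ⟨p, hp'⟩, ← mul_pow]
  refine pow_le_pow_left₀ (norm_nonneg _) ?_ 2
  refine (norm_pev_le_sum (hD p hp) hx).trans ?_
  rw [Finset.sum_mul]
  exact Finset.sum_le_sum fun s _ => hK s ⟨p, hp'⟩

theorem integral_ball_rescale (f : E d → ℝ) (y : E d) {h ρ : ℝ} (hh : 0 < h) :
    ∫ z in Metric.ball (0 : E d) ρ, f (y + h • z) =
      (h ^ d)⁻¹ * ∫ x in Metric.ball y (h * ρ), f x := by
  have h1 := Measure.setIntegral_comp_smul_of_pos (volume : Measure (E d)) (fun z => f (y + z))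
    (Metric.ball (0 : E d) ρ) hh
  rw [h1, finrank_euclideanSpace, Fintype.card_fin, smul_eq_mul]
  congr 1
  rw [smul_ball hh.ne', smul_zero, Real.norm_of_nonneg hh.le]
  have h2 := (measurePreserving_add_left (volume : Measure (E d)) y).setIntegral_preimage_emb
    (measurableEmbedding_addLeft y) f (Metric.ball y (h * ρ))
  rw [← h2]
  congr 2
  ext z
  simp [dist_eq_norm]

/-- Norm equivalence and inverse estimate on balls: the values and the derivatives of a polynomial
of degree at most `r` on a ball of radius `h` are controlled by its `L²` norm on a concentric ball
of radius `h ρ`. -/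
theorem exists_inverse_estimate (d r : ℕ) {ρ : ℝ} (hρ : 0 < ρ) :
    ∃ C : ℝ, 0 ≤ C ∧ ∀ p : MvPolynomial (Fin d) ℂ, p.totalDegree ≤ r → ∀ (y : E d) (h : ℝ), 0 < h →
      ∀ x ∈ Metric.closedBall y h,
      ‖pev p x‖ ^ 2 ≤ C * (h ^ d)⁻¹ * ∫ x in Metric.ball y (h * ρ), ‖pev p x‖ ^ 2 ∧
      ∀ i, ‖pev (MvPolynomial.pderiv i p) x‖ ^ 2 ≤
        C * (h ^ 2)⁻¹ * (h ^ d)⁻¹ * ∫ x in Metric.ball y (h * ρ), ‖pev p x‖ ^ 2 := by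
  obtain ⟨C, hC0, hC⟩ := exists_unit_bound (d := d) r hρ LinearMap.id fun p hp => hp
  choose B hB0 hB using fun i => exists_unit_bound (d := d) r hρ
    (MvPolynomial.pderiv i : Derivation ℂ _ _).toLinearMap
    fun p hp => (totalDegree_pderiv_le hp i).trans (Nat.sub_le _ _)
  have hS0 : 0 ≤ ∑ i, B i := Finset.sum_nonneg fun i _ => hB0 i
  refine ⟨C + ∑ i, B i, by positivity, fun p hp y h hh x hx => ?_⟩
  -- Transport to the unit ball by x = y + hz: the integral contributes the factor h^{-d}, and each
  -- derivative of `p` a factor h⁻¹.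
  obtain ⟨q, hq, hqp⟩ := exists_poly_rescale hp y h
  set z : E d := h⁻¹ • (x - y) with hz
  have hxz : x = y + h • z := by rw [hz, smul_inv_smul₀ hh.ne']; abel
  have hz1 : ‖z‖ ≤ 1 := by
    rw [hz, norm_smul, norm_inv, Real.norm_of_nonneg hh.le, inv_mul_le_one₀ hh, ← dist_eq_norm]
    exact hx
  have hI : ∫ x in Metric.ball (0 : E d) ρ, ‖pev q x‖ ^ 2 =
      (h ^ d)⁻¹ * ∫ x in Metric.ball y (h * ρ), ‖pev p x‖ ^ 2 := by
    simp only [hqp]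
    exact integral_ball_rescale (fun x => ‖pev p x‖ ^ 2) y hh
  have hI0 : 0 ≤ ∫ x in Metric.ball (0 : E d) ρ, ‖pev q x‖ ^ 2 :=
    integral_nonneg fun x => by positivity
  constructor
  · have h1 := hC q hq z hz1
    rw [LinearMap.id_apply, hqp, ← hxz] at h1
    rw [mul_assoc, ← hI]
    exact h1.trans (mul_le_mul_of_nonneg_right (by linarith) hI0)
  · intro i
    have h1 := hB i q hq z hz1
    have h2 : pev (MvPolynomial.pderiv i q) z = h * pev (MvPolynomial.pderiv i p) x := by
      rw [← pderiv_pev, ← pderiv_pev]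
      have e : pev q = fun z => pev p (y + h • z) := funext hqp
      have hd : HasFDerivAt (fun z : E d => y + h • z) (h • ContinuousLinearMap.id ℝ (E d)) z :=
        ((hasFDerivAt_id z).const_smul h).const_add y
      have hc := (differentiable_pev p (y + h • z)).hasFDerivAt.comp z hd
      have e2 : fderiv ℝ (pev q) z = (fderiv ℝ (pev p) (y + h • z)).comp
          (h • ContinuousLinearMap.id ℝ (E d)) := by rw [e]; exact hc.fderiv
      rw [pderiv, e2, pderiv, hxz]
      simp
    have h3 : ‖pev (MvPolynomial.pderiv i q) z‖ ^ 2 ≤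
        (C + ∑ i, B i) * ∫ x in Metric.ball (0 : E d) ρ, ‖pev q x‖ ^ 2 := by
      refine h1.trans (mul_le_mul_of_nonneg_right ?_ hI0)
      have := Finset.single_le_sum (f := B) (fun i _ => hB0 i) (Finset.mem_univ i)
      linarith
    rw [h2, norm_mul, mul_pow, Complex.norm_real, Real.norm_of_nonneg hh.le, hI] at h3
    have hh2 : 0 < h ^ 2 := by positivity
    calc _ = (h ^ 2)⁻¹ * (h ^ 2 * ‖pev (MvPolynomial.pderiv i p) x‖ ^ 2) := by field_simp
      _ ≤ (h ^ 2)⁻¹ * ((C + ∑ i, B i) *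
          ((h ^ d)⁻¹ * ∫ x in Metric.ball y (h * ρ), ‖pev p x‖ ^ 2)) :=
        mul_le_mul_of_nonneg_left h3 (by positivity)
      _ = _ := by ring

/-! ### The local estimate for the cutoff operation -/

/-- The density of the square of the `H¹` norm of a polynomial. -/
def pdens (p : MvPolynomial (Fin d) ℂ) : E d → ℝ :=
  dens (pev p) fun i => pev (MvPolynomial.pderiv i p)

theorem continuous_pdens (p : MvPolynomial (Fin d) ℂ) : Continuous (pdens p) := by
  unfold pdens dens
  exact ((continuous_pev p).norm.pow 2).add
    (continuous_finsetSum _ fun i _ => (continuous_pev _).norm.pow 2)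

theorem integrableOn_of_continuous_of_subset {f : E d → ℝ} (hf : Continuous f) {K : Set (E d)}
    {y : E d} {h : ℝ} (hK : K ⊆ Metric.closedBall y h) : IntegrableOn f K :=
  (hf.continuousOn.integrableOn_compact (isCompact_closedBall y h)).mono_set hK

theorem sq_add_sum_le (P h L : ℝ) (D : Fin d → ℝ) :
    (L * P + h * ∑ k, D k) ^ 2 ≤ 2 * L ^ 2 * P ^ 2 + 2 * h ^ 2 * d * ∑ k, D k ^ 2 := by
  have h1 : (∑ k, D k) ^ 2 ≤ d * ∑ k, D k ^ 2 := by
    have := sq_sum_le_card_mul_sum_sq (s := Finset.univ) (f := D)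
    simpa using this
  have h2 : (h * ∑ k, D k) ^ 2 ≤ h ^ 2 * (d * ∑ k, D k ^ 2) := by
    rw [mul_pow]; exact mul_le_mul_of_nonneg_left h1 (sq_nonneg h)
  nlinarith [sq_nonneg (L * P - h * ∑ k, D k)]

/-- Values of q - p are bounded directly, as |χ - 1| ≤ 2. For gradients an inverse estimate costs
h⁻¹, so q is first compared with c p for the constant c: the difference is O(h) because χ - c and Z
are, and this absorbs the loss. The remainder (c - 1) p has a harmless gradient. All bounds hold
pointwise on `K` in terms of the small ball, and the volume of `K` is of order h^d at most. -/
theorem exists_cell_estimate (d r : ℕ) {ρ L B : ℝ} (hρ : 0 < ρ) :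
    ∃ C : ℝ, 0 ≤ C ∧ ∀ p q : MvPolynomial (Fin d) ℂ, p.totalDegree ≤ r → q.totalDegree ≤ r →
      ∀ (y : E d) (h : ℝ), 0 < h → h ≤ B → ∀ K ⊆ Metric.closedBall y h, MeasurableSet K →
      Metric.ball y (h * ρ) ⊆ K → ∀ (χ : E d → ℂ) (Z : Fin d → E d → ℂ) (c : ℂ), ‖c‖ ≤ 1 →
      (∀ x ∈ K, pev q x = χ x * pev p x + ∑ k, pev (MvPolynomial.pderiv k p) x * Z k x) →
      (∀ x ∈ K, ‖χ x‖ ≤ 1 ∧ ‖χ x - c‖ ≤ L * h ∧ ∀ k, ‖Z k x‖ ≤ h) →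
      ∫ x in K, pdens (q - p) x ≤ C * ∫ x in Metric.ball y (h * ρ), pdens p x := by
  obtain ⟨C₁, hC₁, hinv⟩ := exists_inverse_estimate d r hρ
  -- The first two summands bound |q - p|² and the last one bounds its d squared derivatives, both
  -- relative to the mean J.
  set A : ℝ := 8 * C₁ + 2 * B ^ 2 * d * (d * C₁) +
    d * (2 * (C₁ * (2 * L ^ 2 + 2 * d)) + 8 * C₁) with hA
  have hA0 : 0 ≤ A := by positivity
  set V : ℝ := (volume (Metric.ball (0 : E d) 1)).toReal with hV
  refine ⟨A * V, by positivity, ?_⟩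
  intro p q hp hq y h hh hhB K hKy hKm hBK χ Z c hc hqK hbd
  set S := Metric.ball y (h * ρ) with hS
  have hSy : S ⊆ Metric.closedBall y h := hBK.trans hKy
  set I := ∫ x in S, pdens p x with hI
  set J := (h ^ d)⁻¹ * I with hJ
  have hhd : 0 < h ^ d := by positivity
  have hint : IntegrableOn (pdens p) S := integrableOn_of_continuous_of_subset
    (continuous_pdens p) hSy
  have hI0 : 0 ≤ I := integral_nonneg fun x => dens_nonneg _ _ _
  have hJ0 : 0 ≤ J := by positivity
  have i1 : ∫ x in S, ‖pev p x‖ ^ 2 ≤ I := by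
    refine integral_mono (integrableOn_of_continuous_of_subset
      ((continuous_pev p).norm.pow 2) hSy) hint fun x => ?_
    exact le_add_of_nonneg_right (Finset.sum_nonneg fun i _ => by positivity)
  have i2 : ∀ k, ∫ x in S, ‖pev (MvPolynomial.pderiv k p) x‖ ^ 2 ≤ I := by
    intro k
    refine integral_mono (integrableOn_of_continuous_of_subset
      ((continuous_pev _).norm.pow 2) hSy) hint fun x => ?_
    refine le_add_of_nonneg_of_le (by positivity) ?_
    exact Finset.single_le_sum (f := fun k => ‖pev (MvPolynomial.pderiv k p) x‖ ^ 2)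
      (fun _ _ => by positivity) (Finset.mem_univ k)
  have b1 : ∀ x ∈ K, ‖pev p x‖ ^ 2 ≤ C₁ * J := fun x hx => by
    refine ((hinv p hp y h hh x (hKy hx)).1).trans ?_
    rw [mul_assoc]
    exact mul_le_mul_of_nonneg_left (mul_le_mul_of_nonneg_left i1 (by positivity)) hC₁
  -- The derivative is treated as a polynomial in its own right; since its L² norm is part of I, no
  -- power of h is lost.
  have b2 : ∀ k, ∀ x ∈ K, ‖pev (MvPolynomial.pderiv k p) x‖ ^ 2 ≤ C₁ * J := fun k x hx => by
    refine ((hinv _ ((totalDegree_pderiv_le hp k).trans (Nat.sub_le _ _)) y h hh x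
      (hKy hx)).1).trans ?_
    rw [mul_assoc]
    exact mul_le_mul_of_nonneg_left (mul_le_mul_of_nonneg_left (i2 k) (by positivity)) hC₁
  have hsum : ∀ x ∈ K, ‖∑ k, pev (MvPolynomial.pderiv k p) x * Z k x‖ ≤
      h * ∑ k, ‖pev (MvPolynomial.pderiv k p) x‖ := by
    intro x hx
    refine (norm_sum_le _ _).trans ?_
    rw [Finset.mul_sum]
    refine Finset.sum_le_sum fun k _ => ?_
    rw [norm_mul, mul_comm]
    exact mul_le_mul_of_nonneg_right ((hbd x hx).2.2 k) (norm_nonneg _)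
  have b3 : ∀ x ∈ K, ‖pev (q - p) x‖ ^ 2 ≤ (8 * C₁ + 2 * B ^ 2 * d * (d * C₁)) * J := by
    intro x hx
    have e : pev (q - p) x = (χ x - 1) * pev p x +
        ∑ k, pev (MvPolynomial.pderiv k p) x * Z k x := by
      rw [pev_sub, hqK x hx]; ring
    have h1 : ‖pev (q - p) x‖ ≤ 2 * ‖pev p x‖ +
        h * ∑ k, ‖pev (MvPolynomial.pderiv k p) x‖ := by
      rw [e]
      refine (norm_add_le _ _).trans (add_le_add ?_ (hsum x hx))
      rw [norm_mul]
      refine mul_le_mul_of_nonneg_right ?_ (norm_nonneg _)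
      refine (norm_sub_le _ _).trans ?_
      rw [norm_one]
      linarith [(hbd x hx).1]
    refine (pow_le_pow_left₀ (norm_nonneg _) h1 2).trans ((sq_add_sum_le _ _ _ _).trans ?_)
    have h2 : ∑ k, ‖pev (MvPolynomial.pderiv k p) x‖ ^ 2 ≤ d * (C₁ * J) := by
      refine (Finset.sum_le_sum fun k _ => b2 k x hx).trans ?_
      simp
    have h3 : 2 * h ^ 2 * d ≤ 2 * B ^ 2 * d := by gcongr
    have h4 : 2 * h ^ 2 * d * ∑ k, ‖pev (MvPolynomial.pderiv k p) x‖ ^ 2 ≤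
        2 * B ^ 2 * d * (d * (C₁ * J)) :=
      mul_le_mul h3 h2 (Finset.sum_nonneg fun k _ => by positivity) (by positivity)
    have h5 := b1 x hx
    linarith
  -- This difference is small of order h on the ball, so that the inverse estimate for its
  -- derivatives is free of h.
  obtain ⟨s, hs, hsq⟩ : ∃ s : MvPolynomial (Fin d) ℂ, s.totalDegree ≤ r ∧ s = q - c • p :=
    ⟨_, (MvPolynomial.totalDegree_sub _ _).trans
      (max_le hq ((MvPolynomial.totalDegree_smul_le _ _).trans hp)), rfl⟩
  have b4 : ∀ x ∈ K, ‖pev s x‖ ^ 2 ≤ h ^ 2 * (2 * L ^ 2 + 2 * d) * pdens p x := by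
    intro x hx
    have e : pev s x = (χ x - c) * pev p x +
        ∑ k, pev (MvPolynomial.pderiv k p) x * Z k x := by
      rw [hsq, pev_sub, pev_smul, hqK x hx]; ring
    have h1 : ‖pev s x‖ ≤ (L * h) * ‖pev p x‖ +
        h * ∑ k, ‖pev (MvPolynomial.pderiv k p) x‖ := by
      rw [e]
      refine (norm_add_le _ _).trans (add_le_add ?_ (hsum x hx))
      rw [norm_mul]
      exact mul_le_mul_of_nonneg_right (hbd x hx).2.1 (norm_nonneg _)
    refine (pow_le_pow_left₀ (norm_nonneg _) h1 2).trans ((sq_add_sum_le _ _ _ _).trans ?_)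
    have h2 : 0 ≤ ∑ k, ‖pev (MvPolynomial.pderiv k p) x‖ ^ 2 :=
      Finset.sum_nonneg fun k _ => by positivity
    have e2 : pdens p x = ‖pev p x‖ ^ 2 + ∑ k, ‖pev (MvPolynomial.pderiv k p) x‖ ^ 2 := rfl
    rw [e2]
    have t1 : 0 ≤ h ^ 2 * (2 * L ^ 2) * ∑ k, ‖pev (MvPolynomial.pderiv k p) x‖ ^ 2 := by
      positivity
    have t2 : 0 ≤ h ^ 2 * (2 * d) * ‖pev p x‖ ^ 2 := by positivity
    nlinarith
  have b5 : ∫ x in S, ‖pev s x‖ ^ 2 ≤ h ^ 2 * (2 * L ^ 2 + 2 * d) * I := by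
    rw [hI, ← integral_const_mul]
    refine setIntegral_mono_on (integrableOn_of_continuous_of_subset
      ((continuous_pev s).norm.pow 2) hSy) (hint.const_mul _) measurableSet_ball fun x hx => ?_
    exact b4 x (hBK hx)
  have b6 : ∀ i, ∀ x ∈ K, ‖pev (MvPolynomial.pderiv i s) x‖ ^ 2 ≤
      C₁ * (2 * L ^ 2 + 2 * d) * J := by
    intro i x hx
    refine ((hinv s hs y h hh x (hKy hx)).2 i).trans ?_
    refine (mul_le_mul_of_nonneg_left b5 (by positivity)).trans_eq ?_
    rw [hJ]; field_simp
  have b7 : ∀ i, ∀ x ∈ K, ‖pev (MvPolynomial.pderiv i (q - p)) x‖ ^ 2 ≤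
      (2 * (C₁ * (2 * L ^ 2 + 2 * d)) + 8 * C₁) * J := by
    intro i x hx
    have e : pev (MvPolynomial.pderiv i (q - p)) x = pev (MvPolynomial.pderiv i s) x +
        (c - 1) * pev (MvPolynomial.pderiv i p) x := by
      rw [hsq, map_sub, map_sub, pev_sub, pev_sub, Derivation.map_smul, pev_smul]; ring
    have h1 : ‖pev (MvPolynomial.pderiv i (q - p)) x‖ ≤ ‖pev (MvPolynomial.pderiv i s) x‖ +
        2 * ‖pev (MvPolynomial.pderiv i p) x‖ := by
      rw [e]
      refine (norm_add_le _ _).trans (add_le_add le_rfl ?_)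
      rw [norm_mul]
      refine mul_le_mul_of_nonneg_right ((norm_sub_le _ _).trans ?_) (norm_nonneg _)
      rw [norm_one]; linarith
    have h2 := pow_le_pow_left₀ (norm_nonneg _) h1 2
    have h3 := b6 i x hx
    have h4 := b2 i x hx
    nlinarith [sq_nonneg (‖pev (MvPolynomial.pderiv i s) x‖ -
      2 * ‖pev (MvPolynomial.pderiv i p) x‖)]
  have b8 : ∀ x ∈ K, pdens (q - p) x ≤ A * J := by
    intro x hx
    have h1 : ∑ i, ‖pev (MvPolynomial.pderiv i (q - p)) x‖ ^ 2 ≤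
        d * ((2 * (C₁ * (2 * L ^ 2 + 2 * d)) + 8 * C₁) * J) := by
      refine (Finset.sum_le_sum fun i _ => b7 i x hx).trans ?_
      simp
    have e2 : pdens (q - p) x = ‖pev (q - p) x‖ ^ 2 +
      ∑ k, ‖pev (MvPolynomial.pderiv k (q - p)) x‖ ^ 2 := rfl
    rw [e2, hA]
    linarith [b3 x hx]
  have hKfin : volume K < ⊤ := (measure_mono hKy).trans_lt measure_closedBall_lt_top
  have hvol : volume.real K ≤ h ^ d * V := by
    have h1 : volume.real K ≤ volume.real (Metric.closedBall y h) :=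
      measureReal_mono hKy measure_closedBall_lt_top.ne
    refine h1.trans_eq ?_
    rw [measureReal_def, Measure.addHaar_closedBall _ _ hh.le, finrank_euclideanSpace,
      Fintype.card_fin, ENNReal.toReal_mul, ENNReal.toReal_ofReal hhd.le]
  calc ∫ x in K, pdens (q - p) x ≤ ∫ _ in K, A * J :=
        setIntegral_mono_on (integrableOn_of_continuous_of_subset (continuous_pdens _) hKy)
          (integrableOn_const hKfin.ne) hKm b8
    _ = volume.real K * (A * J) := by rw [setIntegral_const, smul_eq_mul]
    _ ≤ (h ^ d * V) * (A * J) := mul_le_mul_of_nonneg_right hvol (by positivity)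
    _ = A * V * I := by rw [hJ]; field_simp

/-! ### Simplices and barycentric coordinates -/

/-- The affine basis formed by the vertices of a nondegenerate `d`-simplex. -/
def bary {s : Finset (E d)} (hs : AffineIndependent ℝ ((↑) : s → E d)) (hc : s.card = d + 1) :
    AffineBasis s ℝ (E d) :=
  ⟨(↑), hs, (hs.affineSpan_eq_top_iff_card_eq_finrank_add_one).2 (by simp [hc])⟩

section Simplex

variable {s : Finset (E d)} (hs : AffineIndependent ℝ ((↑) : s → E d)) (hc : s.card = d + 1)

@[simp] theorem bary_apply (i : s) : bary hs hc i = (i : E d) := rfl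

theorem bary_coord_vertex (i j : s) : (bary hs hc).coord i (j : E d) = if i = j then 1 else 0 := by
  rw [← bary_apply hs hc j, AffineBasis.coord_apply]

theorem bary_range : range (bary hs hc) = (s : Set (E d)) := by
  ext x
  constructor
  · rintro ⟨i, rfl⟩; exact i.2
  · exact fun hx => ⟨⟨x, hx⟩, rfl⟩

theorem cell_eq : cell s = {x | ∀ i, 0 ≤ (bary hs hc).coord i x} := by
  rw [← AffineBasis.convexHull_eq_nonneg_coord, bary_range]

theorem interior_cell_eq : interior (cell s) = {x | ∀ i, 0 < (bary hs hc).coord i x} := by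
  rw [← AffineBasis.interior_convexHull, bary_range]

theorem sum_bary_smul (x : E d) : ∑ i, (bary hs hc).coord i x • (i : E d) = x :=
  (bary hs hc).linear_combination_coord_eq_self x

theorem sum_bary (x : E d) : ∑ i, (bary hs hc).coord i x = 1 :=
  (bary hs hc).sum_coord_apply_eq_one x

theorem bary_combo (i : s) {x y : E d} {a b : ℝ} (hab : a + b = 1) :
    (bary hs hc).coord i (a • x + b • y) =
      a * (bary hs hc).coord i x + b * (bary hs hc).coord i y := by
  rw [Convex.combo_affine_apply hab]; rfl

theorem isClosed_cell (s : Finset (E d)) : IsClosed (cell s) :=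
  s.finite_toSet.isClosed_convexHull ℝ

theorem isCompact_cell (s : Finset (E d)) : IsCompact (cell s) :=
  s.finite_toSet.isCompact_convexHull ℝ

theorem interior_cell_nonempty {s : Finset (E d)} (hs : AffineIndependent ℝ ((↑) : s → E d))
    (hc : s.card = d + 1) : (interior (cell s)).Nonempty := by
  rw [cell, ← bary_range hs hc]
  exact ⟨_, (bary hs hc).centroid_mem_interior_convexHull⟩

theorem closure_interior_cell {s : Finset (E d)} (hs : AffineIndependent ℝ ((↑) : s → E d))
    (hc : s.card = d + 1) : closure (interior (cell s)) = cell s := by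
  rw [(convex_convexHull ℝ _).closure_interior_eq_closure_of_nonempty_interior
    (interior_cell_nonempty hs hc), (isClosed_cell s).closure_eq]

/-- Vanishing coordinates drop the other vertices from the convex combination. Conformity of meshes
is used below through this description of faces. -/
theorem mem_cell_iff_of_subset {t : Finset (E d)} (hts : t ⊆ s) (x : E d) :
    x ∈ cell t ↔ x ∈ cell s ∧ ∀ i : s, (i : E d) ∉ t → (bary hs hc).coord i x = 0 := by
  constructor
  · intro hx
    refine ⟨convexHull_mono (by exact_mod_cast hts) hx, fun i hi => ?_⟩
    have hsub : cell t ⊆ (bary hs hc).coord i ⁻¹' {0} := by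
      refine convexHull_min (fun v hv => ?_) ((convex_singleton 0).affine_preimage _)
      have hv' : v ∈ t := by exact_mod_cast hv
      have := bary_coord_vertex hs hc i ⟨v, hts hv'⟩
      rw [if_neg (fun h => hi (by rw [h]; exact hv'))] at this
      exact this
    exact hsub hx
  · rintro ⟨hx, h0⟩
    rw [cell_eq hs hc] at hx
    have e1 : ∑ i ∈ Finset.univ.filter (fun i : s => (i : E d) ∈ t),
        (bary hs hc).coord i x • (i : E d) = x := by
      conv_rhs => rw [← sum_bary_smul hs hc x]
      refine Finset.sum_filter_of_ne fun i _ hi => ?_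
      by_contra hit
      exact hi (by rw [h0 i hit, zero_smul])
    have e2 : ∑ i ∈ Finset.univ.filter (fun i : s => (i : E d) ∈ t),
        (bary hs hc).coord i x = 1 := by
      rw [← sum_bary hs hc x]
      refine Finset.sum_filter_of_ne fun i _ hi => ?_
      by_contra hit
      exact hi (h0 i hit)
    rw [← e1]
    refine (convex_convexHull ℝ _).sum_mem (fun i _ => hx i) e2 fun i hi => ?_
    exact subset_convexHull ℝ _ (by simpa using (Finset.mem_filter.1 hi).2)

end Simplex

/-! ### Consequences of conformity of a simplicial complex. -/

section Complex

variable {K : Geometry.SimplicialComplex ℝ (E d)} {s t : Finset (E d)}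

/-- Two simplices of a complex meet in the hull of their common vertices. -/
theorem coord_eq_zero_of_mem (hs : s ∈ K.faces) (hc : s.card = d + 1) (ht : t ∈ K.faces)
    {x : E d} (hx : x ∈ cell s) (hxt : x ∈ cell t) (i : s) (hi : (i : E d) ∉ t) :
    (bary (K.indep hs) hc).coord i x = 0 := by
  classical
  have h := K.inter_subset_convexHull hs ht ⟨hx, hxt⟩
  rw [← Finset.coe_inter] at h
  refine ((mem_cell_iff_of_subset (K.indep hs) hc Finset.inter_subset_left x).1 h).2 i ?_
  simp [hi]

theorem mem_cell_of_coord (hs : s ∈ K.faces) (hc : s.card = d + 1) {x : E d} (hx : x ∈ cell s)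
    (h : ∀ i : s, (i : E d) ∉ t → (bary (K.indep hs) hc).coord i x = 0) : x ∈ cell t := by
  classical
  have : x ∈ cell (s ∩ t) := by
    refine (mem_cell_iff_of_subset (K.indep hs) hc Finset.inter_subset_left x).2 ⟨hx, ?_⟩
    intro i hi
    exact h i fun hit => hi (Finset.mem_inter.2 ⟨i.2, hit⟩)
  exact convexHull_mono (by simp) this

/-- Faces are extreme subsets of the simplices. -/
theorem mem_cell_of_mem_openSegment (hs : s ∈ K.faces) (hc : s.card = d + 1) (ht : t ∈ K.faces)
    {x y z : E d} (hx : x ∈ cell s) (hy : y ∈ cell s) (hz : z ∈ openSegment ℝ x y)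
    (hzt : z ∈ cell t) : y ∈ cell t := by
  refine mem_cell_of_coord hs hc hy fun i hi => ?_
  have hzs : z ∈ cell s := (convex_convexHull ℝ _).openSegment_subset hx hy hz
  have h0 := coord_eq_zero_of_mem hs hc ht hzs hzt i hi
  obtain ⟨a, b, ha, hb, hab, rfl⟩ := hz
  rw [bary_combo _ _ _ hab] at h0
  rw [cell_eq (K.indep hs) hc] at hx hy
  have h1 := mul_nonneg ha.le (hx i)
  have h2 := mul_nonneg hb.le (hy i)
  have h3 : b * (bary (K.indep hs) hc).coord i y = 0 := by linarith
  exact (mul_eq_zero.1 h3).resolve_left hb.ne'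

/-- At an interior point all barycentric coordinates are positive, so no vertex can be missing.
Hence faces of dimension d - 1 avoid the interiors of elements, and distinct elements have disjoint
interiors. -/
theorem subset_of_mem_interior (hs : s ∈ K.faces) (hc : s.card = d + 1) (ht : t ∈ K.faces)
    {x : E d} (hx : x ∈ interior (cell s)) (hxt : x ∈ cell t) : s ⊆ t := by
  intro v hv
  by_contra hvt
  have h0 := coord_eq_zero_of_mem hs hc ht (interior_subset hx) hxt ⟨v, hv⟩ hvt
  rw [interior_cell_eq (K.indep hs) hc] at hx
  exact (hx ⟨v, hv⟩).ne' h0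

/-- A proper face lies in the frontier of a convex set, which is a null set. -/
theorem volume_cell_eq_zero (hs : s ∈ K.faces) (hc : s.card = d + 1) (ht : t ∈ K.faces)
    (hts : t ⊆ s) (hct : t.card = d) : volume (cell t) = 0 := by
  refine measure_mono_null ?_ ((convex_convexHull ℝ (s : Set (E d))).addHaar_frontier volume)
  intro x hx
  rw [(isClosed_cell s).frontier_eq]
  refine ⟨convexHull_mono (by exact_mod_cast hts) hx, fun hxi => ?_⟩
  have := Finset.card_le_card (subset_of_mem_interior hs hc ht hxi hx)
  omega

end Complex

/-! ### Meshes -/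

namespace Mesh

variable {Ω W : Set (E d)} (T : Mesh Ω)

theorem finite_elements : T.elements.Finite := T.finite.subset fun _ h => h.1

theorem closure_eq : closure Ω = ⋃ s ∈ T.elements, cell s := by
  rw [← T.space_eq, Geometry.SimplicialComplex.space]
  refine subset_antisymm (iUnion₂_subset fun s hs => ?_) (iUnion₂_subset fun s hs => ?_)
  · obtain ⟨t, ht, hst, hc⟩ := T.pure s hs
    exact (convexHull_mono (by exact_mod_cast hst)).trans
      (subset_biUnion_of_mem (u := fun s : Finset (E d) => cell s)
        (show t ∈ T.elements from ⟨ht, hc⟩))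
  · exact subset_biUnion_of_mem (u := fun s : Finset (E d) => cell s) hs.1

theorem cell_subset {s : Finset (E d)} (hs : s ∈ T.elements) : cell s ⊆ closure Ω := by
  rw [T.closure_eq]
  exact subset_biUnion_of_mem (u := fun s : Finset (E d) => cell s) hs

variable {T}

theorem volume_frontier_eq_zero (hal : AlignedWith T.K W) : volume (frontier W) = 0 := by
  obtain ⟨Γ, hΓ, hcard, hfr⟩ := hal
  rw [hfr, measure_biUnion_null_iff (T.finite.subset hΓ).countable]
  intro t ht
  obtain ⟨s, hs, hts, hc⟩ := T.pure t (hΓ ht)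
  exact volume_cell_eq_zero hs hc (hΓ ht) hts (hcard t ht)

theorem disjoint_interior_frontier (hal : AlignedWith T.K W) {s : Finset (E d)}
    (hs : s ∈ T.elements) : Disjoint (interior (cell s)) (frontier W) := by
  obtain ⟨Γ, hΓ, hcard, hfr⟩ := hal
  rw [hfr, Set.disjoint_left]
  intro x hx hxΓ
  obtain ⟨t, ht, hxt⟩ := mem_iUnion₂.1 hxΓ
  have h1 := Finset.card_le_card (subset_of_mem_interior hs.1 hs.2 (hΓ ht) hx hxt)
  have h2 := hcard t ht
  have h3 := hs.2
  omega

/-- The interior of an element is connected and does not meet the frontier of W. -/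
theorem interior_subset_or_disjoint (hal : AlignedWith T.K W) (hW : IsOpen W)
    {s : Finset (E d)} (hs : s ∈ T.elements) :
    interior (cell s) ⊆ W ∨ Disjoint (interior (cell s)) W := by
  by_cases h : (interior (cell s) ∩ W).Nonempty
  · left
    refine (convex_convexHull ℝ (s : Set (E d))).interior.isPreconnected.subset_left_of_subset_union
      hW (isClosed_closure (s := W)).isOpen_compl ?_ ?_ h
    · exact Set.disjoint_left.2 fun x hx hx' => hx' (subset_closure hx)
    · intro x hx
      by_cases hxW : x ∈ W
      · exact Or.inl hxW
      · refine Or.inr fun hc => ?_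
        refine Set.disjoint_left.1 (disjoint_interior_frontier hal hs) hx ?_
        rw [hW.frontier_eq]
        exact ⟨hc, hxW⟩
  · right
    rwa [Set.disjoint_iff_inter_eq_empty, ← Set.not_nonempty_iff_eq_empty]

/-- The elements whose interior is contained in `W`. -/
def inner (T : Mesh Ω) (W : Set (E d)) : Set (Finset (E d)) :=
  {s ∈ T.elements | interior (cell s) ⊆ W}

theorem inner_subset_elements : T.inner W ⊆ T.elements := fun _ h => h.1

theorem cell_subset_closure {s : Finset (E d)} (hs : s ∈ T.inner W) : cell s ⊆ closure W := by
  rw [← closure_interior_cell (T.K.indep hs.1.1) hs.1.2]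
  exact closure_mono hs.2

theorem mem_inner_of_mem (hal : AlignedWith T.K W) (hW : IsOpen W) {s : Finset (E d)}
    (hs : s ∈ T.elements) {x : E d} (hx : x ∈ cell s) (hxW : x ∈ W) : s ∈ T.inner W := by
  refine ⟨hs, (interior_subset_or_disjoint hal hW hs).resolve_right fun hdisj => ?_⟩
  rw [← closure_interior_cell (T.K.indep hs.1) hs.2] at hx
  obtain ⟨y, hyW, hys⟩ := mem_closure_iff.1 hx W hW hxW
  exact Set.disjoint_left.1 hdisj hys hyW

theorem closure_eq_inner (hal : AlignedWith T.K W) (hW : IsOpen W) (hWΩ : W ⊆ closure Ω) :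
    closure W = ⋃ s ∈ T.inner W, cell s := by
  refine subset_antisymm (closure_minimal ?_ ?_) (iUnion₂_subset fun s hs => cell_subset_closure hs)
  · intro x hx
    have hx' := hWΩ hx
    rw [T.closure_eq] at hx'
    obtain ⟨s, hs, hxs⟩ := mem_iUnion₂.1 hx'
    exact mem_iUnion₂.2 ⟨s, mem_inner_of_mem hal hW hs hxs hx, hxs⟩
  · exact (T.finite_elements.subset inner_subset_elements).isClosed_biUnion
      fun s _ => isClosed_cell s

theorem notMem_frontier_of_mem_openSegment (hal : AlignedWith T.K W) {s : Finset (E d)}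
    (hs : s ∈ T.elements) {x y z : E d} (hx : x ∈ cell s) (hy : y ∈ cell s)
    (hyW : y ∉ frontier W) (hz : z ∈ openSegment ℝ x y) : z ∉ frontier W := by
  obtain ⟨Γ, hΓ, hcard, hfr⟩ := hal
  rw [hfr] at hyW ⊢
  intro hzΓ
  obtain ⟨t, ht, hzt⟩ := mem_iUnion₂.1 hzΓ
  exact hyW (mem_iUnion₂.2
    ⟨t, ht, mem_cell_of_mem_openSegment hs.1 hs.2 (hΓ ht) hx hy hz hzt⟩)

/-- Faces are extreme, so removing those in the frontier keeps the simplex convex. For W = Ω this is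
the set on which a cutoff function is Lipschitz even if Ω has cracks. -/
theorem convex_cell_diff_frontier (hal : AlignedWith T.K W) {s : Finset (E d)}
    (hs : s ∈ T.elements) : Convex ℝ (cell s \ frontier W) := by
  rw [convex_iff_openSegment_subset]
  intro x hx y hy z hz
  exact ⟨(convex_convexHull ℝ _).openSegment_subset hx.1 hy.1 hz,
    notMem_frontier_of_mem_openSegment hal hs hx.1 hy.1 hy.2 hz⟩

/-- A subface which is not contained in the boundary is the closure of its points off the
boundary. -/
theorem subset_closure_diff_frontier (hal : AlignedWith T.K W) {s t : Finset (E d)}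
    (hs : s ∈ T.elements) (hts : t ⊆ s) (hn : ¬ cell t ⊆ frontier W) :
    cell t ⊆ closure (cell t \ frontier W) := by
  obtain ⟨y, hyt, hyW⟩ := Set.not_subset.1 hn
  have hsub : cell t ⊆ cell s := convexHull_mono (by exact_mod_cast hts)
  intro x hx
  have h1 : x ∈ closure (openSegment ℝ x y) := by
    rw [closure_openSegment]; exact left_mem_segment ℝ x y
  refine closure_mono (fun z hz => ?_) h1
  exact ⟨(convex_convexHull ℝ _).openSegment_subset hx hyt hz,
    notMem_frontier_of_mem_openSegment hal hs (hsub hx) (hsub hyt) hyW hz⟩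

/-- The barycentre of the face lies in closure W, hence in some inner element. Its coordinates at
the vertices of the face are positive, so that element contains all of them. -/
theorem exists_inner_of_face (hal : AlignedWith T.K W) (hW : IsOpen W) (hWΩ : W ⊆ closure Ω)
    {t : Finset (E d)} (ht : t ∈ T.K.faces) (htW : cell t ⊆ frontier W) :
    ∃ s ∈ T.inner W, t ⊆ s := by
  have hne : t.Nonempty := T.K.nonempty_of_mem_faces ht
  have hpos : (0 : ℝ) < t.card := by exact_mod_cast hne.card_pos
  set y : E d := ∑ v ∈ t, (t.card : ℝ)⁻¹ • v with hy
  have hyt : y ∈ cell t := by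
    refine (convex_convexHull ℝ _).sum_mem (fun _ _ => by positivity) ?_ fun v hv =>
      subset_convexHull ℝ _ (by exact_mod_cast hv)
    rw [Finset.sum_const, nsmul_eq_mul, mul_inv_cancel₀ hpos.ne']
  have hyW : y ∈ closure W := frontier_subset_closure (htW hyt)
  rw [closure_eq_inner hal hW hWΩ] at hyW
  obtain ⟨s, hs, hys⟩ := mem_iUnion₂.1 hyW
  refine ⟨s, hs, fun v hv => ?_⟩
  by_contra hvs
  obtain ⟨s', hs', hts', hc'⟩ := T.pure t ht
  have hsub : cell t ⊆ cell s' := convexHull_mono (by exact_mod_cast hts')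
  have h0 := coord_eq_zero_of_mem hs' hc' hs.1.1 (hsub hyt) hys ⟨v, hts' hv⟩ hvs
  have h1 : (bary (T.K.indep hs') hc').coord ⟨v, hts' hv⟩ y = (t.card : ℝ)⁻¹ := by
    have hw : ∑ v ∈ t, (t.card : ℝ)⁻¹ = 1 := by
      rw [Finset.sum_const, nsmul_eq_mul, mul_inv_cancel₀ hpos.ne']
    have e : y = t.affineCombination ℝ id (fun _ => (t.card : ℝ)⁻¹) := by
      rw [Finset.affineCombination_eq_linear_combination _ _ _ hw]; rfl
    rw [e, Finset.map_affineCombination _ _ _ hw,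
      Finset.affineCombination_eq_linear_combination _ _ _ hw]
    rw [Finset.sum_eq_single_of_mem v hv]
    · have := bary_coord_vertex (T.K.indep hs') hc' ⟨v, hts' hv⟩ ⟨v, hts' hv⟩
      rw [if_pos rfl] at this
      simp [this]
    · intro w hw' hwv
      have := bary_coord_vertex (T.K.indep hs') hc' ⟨v, hts' hv⟩ ⟨w, hts' hw'⟩
      rw [if_neg (fun h => hwv (Subtype.ext_iff.1 h).symm)] at this
      simp [this]
  rw [h1] at h0
  exact (inv_pos.2 hpos).ne' h0

end Mesh

/-! ### Gluing of Lipschitz functions -/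

section Glue
open Filter Topology

/-- Along a segment, just after any time one of the finitely many closed sets is visited arbitrarily
soon; it also contains the present point. This bounds the lower right slope, which suffices for a
mean value inequality. -/
theorem dist_le_of_finite_closed_cover {𝓕 : Set (Set (E d))} (hfin : 𝓕.Finite)
    (hcl : ∀ F ∈ 𝓕, IsClosed F) (hcov : ∀ x, ∃ F ∈ 𝓕, x ∈ F) {f : E d → ℂ} (hf : Continuous f)
    {K : ℝ≥0} (hK : ∀ F ∈ 𝓕, LipschitzOnWith K f F) (x y : E d) :
    ‖f y - f x‖ ≤ K * ‖y - x‖ := by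
  refine le_of_forall_pos_le_add fun ε hε => ?_
  let γ : ℝ → E d := fun t => x + t • (y - x)
  have hγ : Continuous γ := by fun_prop
  -- The comparison principle needs a strictly larger slope, provided by the additional ε.
  have key := image_norm_le_of_liminf_right_slope_norm_lt_deriv_boundary
    (f := fun t => f (γ t) - f x) (f' := fun _ => K * ‖y - x‖) (a := 0) (b := 1)
    (B := fun t => (K * ‖y - x‖ + ε) * t) (B' := fun _ => K * ‖y - x‖ + ε)
    ((hf.comp hγ).sub continuous_const).continuousOn ?_ ?_ (by fun_prop) ?_ ?_
  · have := key (x := 1) (by simp)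
    simpa [γ] using this
  · intro t ht s hs
    obtain ⟨F, hF, hfreq⟩ : ∃ F ∈ 𝓕, ∃ᶠ z in 𝓝[>] t, γ z ∈ F := by
      by_contra hcon
      simp only [not_exists, not_and, not_frequently] at hcon
      have h1 : ∀ᶠ z in 𝓝[>] t, ∀ F ∈ 𝓕, γ z ∉ F := (eventually_all_finite hfin).2 hcon
      obtain ⟨z, hz⟩ := h1.exists
      obtain ⟨F, hF, hzF⟩ := hcov (γ z)
      exact hz F hF hzF
    have htF : γ t ∈ F := (hcl F hF).mem_of_frequently_of_tendsto hfreq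
      ((hγ.tendsto t).mono_left nhdsWithin_le_nhds)
    refine (hfreq.and_eventually self_mem_nhdsWithin).mono fun z hz => ?_
    have hzt : 0 < z - t := sub_pos.2 hz.2
    have h2 : ‖f (γ z) - f (γ t)‖ ≤ K * ‖y - x‖ * (z - t) := by
      have h3 := (hK F hF).dist_le_mul _ hz.1 _ htF
      have h4 : γ z - γ t = (z - t) • (y - x) := by simp only [γ, sub_smul]; abel
      rw [dist_eq_norm, dist_eq_norm, h4, norm_smul, Real.norm_of_nonneg hzt.le] at h3
      linarith
    refine lt_of_le_of_lt ?_ hs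
    rw [slope_def_field, div_le_iff₀ hzt]
    refine le_trans ?_ h2
    have h5 := norm_sub_norm_le (f (γ z) - f x) (f (γ t) - f x)
    rwa [sub_sub_sub_cancel_right] at h5
  · simp [γ]
  · intro t _
    simpa using ((hasDerivAt_id t).const_mul (K * ‖y - x‖ + ε)).hasDerivWithinAt
  · intro t _ _
    linarith

end Glue

theorem exists_lipschitzOnWith_pev (p : MvPolynomial (Fin d) ℂ) (s : Finset (E d)) :
    ∃ K : ℝ≥0, LipschitzOnWith K (pev p) (cell s) :=
  ((contDiff_pev p).contDiffOn (s := cell s)).exists_lipschitzOnWith (by simp)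
    (convex_convexHull ℝ _) (isCompact_cell s)

/-! ### Finite element functions with zero boundary values -/

namespace Mesh

variable {Ω W : Set (E d)} {T : Mesh Ω} {r : ℕ} {w w' : E d → ℂ}

theorem IsFE.exists_poly (hw : T.IsFE r w) {s : Finset (E d)} (hs : s ∈ T.elements) :
    ∃ p : MvPolynomial (Fin d) ℂ, p.totalDegree ≤ r ∧ ∀ x ∈ cell s, w x = pev p x :=
  hw.2 s hs

theorem IsFE.congr (hw : T.IsFE r w) (h : EqOn w' w (closure Ω)) : T.IsFE r w' := by
  refine ⟨hw.1.congr h, fun s hs => ?_⟩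
  obtain ⟨p, hp, hwp⟩ := hw.2 s hs
  exact ⟨p, hp, fun x hx => (h (T.cell_subset hs hx)).trans (hwp x hx)⟩

theorem IsFE.add (hw : T.IsFE r w) (hw' : T.IsFE r w') : T.IsFE r (w + w') := by
  refine ⟨hw.1.add hw'.1, fun s hs => ?_⟩
  obtain ⟨p, hp, hwp⟩ := hw.2 s hs
  obtain ⟨q, hq, hwq⟩ := hw'.2 s hs
  refine ⟨p + q, (MvPolynomial.totalDegree_add _ _).trans (max_le hp hq), fun x hx => ?_⟩
  rw [Pi.add_apply, hwp x hx, hwq x hx, map_add]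

theorem IsFE.neg (hw : T.IsFE r w) : T.IsFE r (-w) := by
  refine ⟨hw.1.neg, fun s hs => ?_⟩
  obtain ⟨p, hp, hwp⟩ := hw.2 s hs
  refine ⟨-p, (MvPolynomial.totalDegree_neg p).trans_le hp, fun x hx => ?_⟩
  rw [Pi.neg_apply, hwp x hx, map_neg]

theorem IsFE.sub (hw : T.IsFE r w) (hw' : T.IsFE r w') : T.IsFE r (w - w') := by
  rw [sub_eq_add_neg]; exact hw.add hw'.neg

theorem isFE_of_mem_V0 (hw : w ∈ T.V0 r Ω) : T.IsFE r w := by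
  obtain ⟨⟨v, hv, hwv⟩, _⟩ := hw
  exact hv.congr hwv

/-- The elements together with the complement of Ω form a finite closed cover of the space, cracks
included. The constant depends on the mesh, which is harmless: it only serves membership in H¹₀. -/
theorem IsFE.exists_lipschitzWith (hw : T.IsFE r w) (hΩ : IsOpen Ω) (h0 : ∀ x ∉ Ω, w x = 0) :
    ∃ K : ℝ≥0, LipschitzWith K w := by
  have hcont : Continuous w := by
    rw [← continuousOn_univ, ← union_compl_self (closure Ω)]
    have h1 : ContinuousOn w Ωᶜ :=
      (continuousOn_const : ContinuousOn (fun _ => (0 : ℂ)) Ωᶜ).congr h0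
    have h2 := hw.1.union_of_isClosed h1 isClosed_closure hΩ.isClosed_compl
    refine h2.mono (union_subset_union_right _ ?_)
    exact compl_subset_compl.2 subset_closure
  choose! p hp hwp using fun s hs => hw.exists_poly (s := s) hs
  choose K hK using fun s => exists_lipschitzOnWith_pev (p s) s
  let S := T.finite_elements.toFinset
  refine ⟨∑ s ∈ S, K s, LipschitzWith.of_dist_le_mul fun x y => ?_⟩
  rw [dist_comm, dist_comm x, dist_eq_norm, dist_eq_norm]
  refine dist_le_of_finite_closed_cover (𝓕 := insert Ωᶜ (cell '' T.elements))
    ((T.finite_elements.image _).insert _) ?_ ?_ hcont ?_ x y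
  · rintro F (rfl | ⟨s, _, rfl⟩)
    · exact hΩ.isClosed_compl
    · exact isClosed_cell s
  · intro z
    by_cases hz : z ∈ Ω
    · have hz' := subset_closure hz
      rw [T.closure_eq] at hz'
      obtain ⟨s, hs, hzs⟩ := mem_iUnion₂.1 hz'
      exact ⟨cell s, Or.inr ⟨s, hs, rfl⟩, hzs⟩
    · exact ⟨Ωᶜ, Or.inl rfl, hz⟩
  · rintro F (rfl | ⟨s, hs, rfl⟩)
    · refine LipschitzOnWith.of_dist_le_mul fun z hz z' hz' => ?_
      rw [h0 z hz, h0 z' hz', dist_self]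
      positivity
    · have h1 : LipschitzOnWith (K s) w (cell s) := by
        refine LipschitzOnWith.of_dist_le_mul fun z hz z' hz' => ?_
        rw [hwp s hs z hz, hwp s hs z' hz']
        exact (hK s).dist_le_mul z hz z' hz'
      refine h1.weaken ?_
      exact Finset.single_le_sum (f := K) (fun _ _ => zero_le)
        (T.finite_elements.mem_toFinset.2 hs)

/-- A finite element function vanishing off an open subset `U` belongs to `V_h⁰(U)`. -/
theorem IsFE.mem_V0 (hw : T.IsFE r w) (hΩ : IsOpen Ω) (hΩb : Bornology.IsBounded Ω)
    (hΩc : Ωᶜ.Nonempty) {U : Set (E d)} (hU : IsOpen U) (hUΩ : U ⊆ Ω) (h0 : ∀ x ∉ U, w x = 0) :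
    w ∈ T.V0 r U := by
  obtain ⟨K, hK⟩ := hw.exists_lipschitzWith hΩ fun x hx => h0 x fun h => hx (hUΩ h)
  exact ⟨⟨w, hw, fun _ _ => rfl⟩, memH10_of_lipschitzWith hU (hΩb.subset hUΩ)
    (hΩc.mono (compl_subset_compl.2 hUΩ)) hK h0⟩

end Mesh

/-! ### Functions in `H¹₀` have zero boundary values -/

/-- The fundamental theorem of calculus along the path from z to a zero of φ, followed by Tonelli's
theorem and translation invariance. The factor δ bounds the parameter length of the paths. -/
theorem lintegral_enorm_le_of_paths {φ : E d → ℂ} (hφ : ContDiff ℝ ∞ φ) {n : E d}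
    {B V : Set (E d)} (hB : MeasurableSet B) (hV : MeasurableSet V) {δ : ℝ} {c : E d → ℝ}
    (hc : ∀ z ∈ B, 0 ≤ c z ∧ c z ≤ δ) (hend : ∀ z ∈ B, φ (z - c z • n) = 0)
    (hpath : ∀ z ∈ B, ∀ σ ∈ Ioo 0 (c z), z - σ • n ∈ V) :
    ∫⁻ z in B, ‖φ z‖ₑ ≤ ENNReal.ofReal δ * ∫⁻ z in V, ‖fderiv ℝ φ z n‖ₑ := by
  have hcd : Continuous fun z => fderiv ℝ φ z n :=
    (hφ.continuous_fderiv (by simp)).clm_apply continuous_const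
  set D : E d → ℝ≥0∞ := V.indicator fun z => ‖fderiv ℝ φ z n‖ₑ with hD
  have hDm : Measurable D := (hcd.enorm.measurable).indicator hV
  have hpt : ∀ z ∈ B, ‖φ z‖ₑ ≤ ∫⁻ σ in Ioo 0 δ, D (z - σ • n) := by
    intro z hz
    have hder : ∀ σ, HasDerivAt (fun σ : ℝ => φ (z - σ • n)) (-(fderiv ℝ φ (z - σ • n) n)) σ := by
      intro σ
      have h1 : HasDerivAt (fun σ : ℝ => z - σ • n) (-n) σ := by
        simpa using ((hasDerivAt_id σ).smul_const n).const_sub z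
      have h2 := ((hφ.differentiable (by simp)) (z - σ • n)).hasFDerivAt.comp_hasDerivAt σ h1
      rw [map_neg] at h2
      exact h2
    have hcont : Continuous fun σ : ℝ => -(fderiv ℝ φ (z - σ • n) n) :=
      (hcd.comp (by fun_prop : Continuous fun σ : ℝ => z - σ • n)).neg
    have hftc := intervalIntegral.integral_eq_sub_of_hasDerivAt (a := 0) (b := c z)
      (fun σ _ => hder σ) (hcont.intervalIntegrable _ _)
    rw [hend z hz, zero_smul, sub_zero, zero_sub] at hftc
    rw [← enorm_neg, ← hftc, intervalIntegral.integral_of_le (hc z hz).1]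
    refine (enorm_integral_le_lintegral_enorm _).trans ?_
    rw [← restrict_Ioo_eq_restrict_Ioc]
    calc ∫⁻ σ in Ioo 0 (c z), ‖-(fderiv ℝ φ (z - σ • n) n)‖ₑ
        = ∫⁻ σ in Ioo 0 (c z), D (z - σ • n) := by
          refine setLIntegral_congr_fun measurableSet_Ioo fun σ hσ => ?_
          simp only [hD]
          rw [indicator_of_mem (hpath z hz σ hσ), enorm_neg]
      _ ≤ _ := lintegral_mono_set (Ioo_subset_Ioo_right (hc z hz).2)
  have hjoint : Measurable (Function.uncurry fun (z : E d) (σ : ℝ) => D (z - σ • n)) :=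
    hDm.comp (by fun_prop : Continuous fun q : E d × ℝ => q.1 - q.2 • n).measurable
  calc ∫⁻ z in B, ‖φ z‖ₑ ≤ ∫⁻ z in B, ∫⁻ σ in Ioo 0 δ, D (z - σ • n) :=
        setLIntegral_mono' hB hpt
    _ ≤ ∫⁻ z, ∫⁻ σ in Ioo 0 δ, D (z - σ • n) := setLIntegral_le_lintegral _ _
    _ = ∫⁻ σ in Ioo 0 δ, ∫⁻ z, D (z - σ • n) := lintegral_lintegral_swap hjoint.aemeasurable
    _ = ∫⁻ _ in Ioo 0 δ, ∫⁻ z in V, ‖fderiv ℝ φ z n‖ₑ := by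
        congr 1
        ext σ
        rw [lintegral_sub_right_eq_self D, hD, lintegral_indicator hV]
    _ = _ := by
        rw [setLIntegral_const, Real.volume_Ioo, sub_zero, mul_comm]

theorem norm_fderiv_apply_le (φ : E d → ℂ) (x n : E d) :
    ‖fderiv ℝ φ x n‖ ≤ ‖n‖ * ∑ i, ‖pderiv i φ x‖ := by
  have h2 : n = ∑ k, n k • EuclideanSpace.single k (1 : ℝ) := by
    have := (EuclideanSpace.basisFun (Fin d) ℝ).sum_repr n
    simpa using this.symm
  conv_lhs => rw [h2, map_sum]
  rw [Finset.mul_sum]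
  refine (norm_sum_le _ _).trans (Finset.sum_le_sum fun i _ => ?_)
  rw [map_smul, norm_smul]
  exact mul_le_mul_of_nonneg_right (PiLp.norm_apply_le n i) (norm_nonneg _)

theorem integral_norm_le_sqrt_mul {U : Set (E d)} (hfin : volume U < ⊤) {f : E d → ℂ}
    (hf : MemLp f 2 (vol U)) :
    ∫ x in U, ‖f x‖ ≤ √(∫ x in U, ‖f x‖ ^ 2) * √(volume.real U) := by
  have : IsFiniteMeasure (vol U) := isFiniteMeasure_restrict.2 hfin.ne
  have h := integral_mul_le_sqrt_mul_sqrt hf.norm (memLp_const (1 : ℝ)) (fun _ => norm_nonneg _)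
    fun _ => zero_le_one
  simpa using h

/-- On a set of finite measure, approximation in H¹ implies approximation in L¹, which is what the
path estimate requires. -/
theorem MemH10.exists_isTest_integral_le {U : Set (E d)} (hU : IsOpen U) (hfin : volume U < ⊤)
    {u : E d → ℂ} (hu : MemH10 U u) {ε : ℝ} (hε : 0 < ε) :
    ∃ φ, IsTest U φ ∧ ∫ x in U, ‖u x - φ x‖ ≤ ε ∧
      ∀ i, ∫ x in U, ‖pderiv i φ x - weakGrad U u i x‖ ≤ ε := by
  obtain ⟨φ, hφ, h⟩ := hu.2 (ε / (√(volume.real U) + 1)) (by positivity)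
  have hφ1 : MemH1 U φ := hφ.memH1
  have hm : MemH1 U (u - φ) := hu.1.sub hφ1
  have hN : norm1 U (u - φ) * √(volume.real U) ≤ ε := by
    rw [lt_div_iff₀ (by positivity)] at h
    nlinarith [norm1_nonneg U (u - φ)]
  have hle : ∀ f : E d → ℂ, MemLp f 2 (vol U) →
      (∫ x in U, ‖f x‖ ^ 2 ≤ norm1 U (u - φ) ^ 2) → ∫ x in U, ‖f x‖ ≤ ε := by
    intro f hf hle
    refine (integral_norm_le_sqrt_mul hfin hf).trans (le_trans ?_ hN)
    refine mul_le_mul_of_nonneg_right ?_ (Real.sqrt_nonneg _)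
    exact (Real.sqrt_le_sqrt hle).trans_eq (Real.sqrt_sq (norm1_nonneg _ _))
  refine ⟨φ, hφ, hle _ hm.1 ?_, fun i => ?_⟩
  · rw [hm.norm1_sq]
    exact integral_mono (integrable_norm_sq hm.1) hm.integrableOn_dens fun x =>
      le_add_of_nonneg_right (Finset.sum_nonneg fun i _ => by positivity)
  · have h1 : weakGrad U (u - φ) i =ᵐ[vol U] fun x => -(pderiv i φ x - weakGrad U u i x) := by
      have h2 := weakGrad_add hU hm hφ1 i
      rw [sub_add_cancel] at h2
      filter_upwards [h2, (HasGrad.of_isTest (U := U) hφ).weakGrad_ae_eq hU i] with x a b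
      rw [a, Pi.add_apply, b]; ring
    have h3 : ∫ x in U, ‖pderiv i φ x - weakGrad U u i x‖ = ∫ x in U, ‖weakGrad U (u - φ) i x‖ :=
      integral_congr_ae (h1.mono fun x hx => by simp only [hx, norm_neg])
    rw [h3]
    refine hle _ (hm.hasGrad.1 i) ?_
    rw [hm.norm1_sq]
    refine integral_mono (integrable_norm_sq (hm.hasGrad.1 i)) hm.integrableOn_dens fun x => ?_
    refine le_add_of_nonneg_of_le (by positivity) ?_
    exact Finset.single_le_sum (f := fun i => ‖weakGrad U (u - φ) i x‖ ^ 2)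
      (fun _ _ => by positivity) (Finset.mem_univ i)

theorem weakGrad_ae_eq_pev {Ω V : Set (E d)} (hΩ : IsOpen Ω) (hV : IsOpen V) (hVΩ : V ⊆ Ω)
    {u : E d → ℂ} (hu : MemH1 Ω u) {p : MvPolynomial (Fin d) ℂ} (h : ∀ x ∈ V, u x = pev p x)
    (hb : Bornology.IsBounded V) (i : Fin d) :
    weakGrad Ω u i =ᵐ[vol V] pev (MvPolynomial.pderiv i p) := by
  obtain ⟨R, hR⟩ := hb.subset_closedBall (0 : E d)
  have hp : HasGrad V (pev p) (fun i => pev (MvPolynomial.pderiv i p)) := by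
    refine ⟨fun i => ?_, ?_⟩
    · exact (memLp_pev _ 0 (R + 1)).mono_measure
        (Measure.restrict_mono (hR.trans (Metric.closedBall_subset_ball (by linarith))) le_rfl)
    · have := hasWeakGrad_of_contDiff V (contDiff_pev p)
      have e : (fun i => pderiv i (pev p)) = fun i => pev (MvPolynomial.pderiv i p) := by
        ext i x; exact pderiv_pev p i x
      rwa [← e]
  have hup : u =ᵐ[vol V] pev p := by
    rw [Filter.EventuallyEq, ae_restrict_iff' hV.measurableSet]
    exact Filter.Eventually.of_forall h
  exact (weakGrad_ae_eq_of_ae_eq hΩ hV hVΩ hu hup i).trans (hp.weakGrad_ae_eq hV i)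

/-- The estimate behind the trace theorem: near a boundary face, a polynomial which agrees with a
function in `H¹₀` is small. -/
theorem mul_volume_le_of_boundary_face {W : Set (E d)} (hW : IsOpen W) (hfin : volume W < ⊤)
    {w : E d → ℂ} (hw : MemH10 W w) {p : MvPolynomial (Fin d) ℂ} {O B V : Set (E d)}
    (hOo : IsOpen O) (hOb : Bornology.IsBounded O) (hOW : O ⊆ W) (hwp : ∀ x ∈ O, w x = pev p x)
    (hB : MeasurableSet B) (hV : MeasurableSet V) (hBO : B ⊆ O) (hVO : V ⊆ O)
    {n : E d} {δ : ℝ} {c : E d → ℝ} (hδ : 0 ≤ δ) (hc : ∀ z ∈ B, 0 ≤ c z ∧ c z ≤ δ)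
    (hend : ∀ z ∈ B, z - c z • n ∉ W) (hpath : ∀ z ∈ B, ∀ σ ∈ Ioo 0 (c z), z - σ • n ∈ V)
    {a M : ℝ} (ha : ∀ z ∈ B, a ≤ ‖pev p z‖)
    (hM : ∀ i, ∀ z ∈ V, ‖pev (MvPolynomial.pderiv i p) z‖ ≤ M) :
    a * volume.real B ≤ δ * (‖n‖ * (d * (M * volume.real V))) := by
  have hBfin : volume B < ⊤ := (measure_mono (hBO.trans hOW)).trans_lt hfin
  have hVfin : volume V < ⊤ := (measure_mono (hVO.trans hOW)).trans_lt hfin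
  have : IsFiniteMeasure (vol W) := isFiniteMeasure_restrict.2 hfin.ne
  refine le_of_forall_pos_le_add fun ε' hε' => ?_
  -- The values contribute an error ε and the gradients δ‖n‖dε, which add up to ε'.
  set ε := ε' / (1 + δ * (‖n‖ * d)) with hεdef
  have hε : 0 < ε := by positivity
  obtain ⟨φ, hφ, h1, h2⟩ := hw.exists_isTest_integral_le hW hfin hε
  have hcd : Continuous fun z => fderiv ℝ φ z n :=
    (hφ.1.continuous_fderiv (by simp)).clm_apply continuous_const
  have hcs : HasCompactSupport fun z => fderiv ℝ φ z n := hφ.2.1.fderiv_apply ℝ n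
  have hφint : ∀ S : Set (E d), IntegrableOn φ S := fun S =>
    (hφ.1.continuous.integrable_of_hasCompactSupport hφ.2.1).integrableOn
  have hdint : ∀ S : Set (E d), IntegrableOn (fun z => fderiv ℝ φ z n) S := fun S =>
    (hcd.integrable_of_hasCompactSupport hcs).integrableOn
  have hgint : ∀ i, ∀ S : Set (E d), IntegrableOn (pderiv i φ) S := fun i S =>
    ((continuous_pderiv hφ.1 i).integrable_of_hasCompactSupport
      (hφ.hasCompactSupport_pderiv i)).integrableOn
  have hwi : IntegrableOn w W := hw.1.1.integrable (by norm_num)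
  have hwgi : ∀ i, IntegrableOn (weakGrad W w i) W := fun i =>
    (hw.1.hasGrad.1 i).integrable (by norm_num)
  -- the path estimate for the test function
  have hpathφ : ∫ z in B, ‖φ z‖ ≤ δ * ∫ z in V, ‖fderiv ℝ φ z n‖ := by
    have h := lintegral_enorm_le_of_paths hφ.1 hB hV hc
      (fun z hz => hφ.eq_zero (hend z hz)) hpath
    rw [← ofReal_integral_norm_eq_lintegral_enorm (hφint B),
      ← ofReal_integral_norm_eq_lintegral_enorm (hdint V), ← ENNReal.ofReal_mul hδ] at h
    exact (ENNReal.ofReal_le_ofReal_iff (mul_nonneg hδ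
      (integral_nonneg fun _ => norm_nonneg _))).1 h
  -- the values
  have e1 : a * volume.real B ≤ ∫ z in B, ‖w z‖ := by
    rw [mul_comm, ← smul_eq_mul, ← setIntegral_const]
    refine setIntegral_mono_on (integrableOn_const hBfin.ne)
      ((hwi.mono_set (hBO.trans hOW)).norm) hB fun z hz => ?_
    rw [hwp z (hBO hz)]; exact ha z hz
  have e2 : ∫ z in B, ‖w z‖ ≤ ε + ∫ z in B, ‖φ z‖ := by
    have h3 : ∫ z in B, ‖w z - φ z‖ ≤ ε := le_trans (setIntegral_mono_set
      (hwi.sub (hφint W)).norm (Filter.Eventually.of_forall fun z => norm_nonneg _)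
      (Filter.Eventually.of_forall (hBO.trans hOW))) h1
    have h4 : ∫ z in B, ‖w z‖ ≤ ∫ z in B, (‖w z - φ z‖ + ‖φ z‖) := by
      refine integral_mono (hwi.mono_set (hBO.trans hOW)).norm
        (((hwi.mono_set (hBO.trans hOW)).sub (hφint B)).norm.add (hφint B).norm) fun z => ?_
      simpa using norm_add_le (w z - φ z) (φ z)
    have i1 : IntegrableOn (fun z => ‖w z - φ z‖) B :=
      ((hwi.mono_set (hBO.trans hOW)).sub (hφint B)).norm
    rw [integral_add i1 (hφint B).norm] at h4
    linarith
  -- the gradients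
  have e3 : ∀ i, ∫ z in V, ‖pderiv i φ z‖ ≤ ε + M * volume.real V := by
    intro i
    have hVW := hVO.trans hOW
    have h3 : ∫ z in V, ‖pderiv i φ z - weakGrad W w i z‖ ≤ ε := le_trans (setIntegral_mono_set
      ((hgint i W).sub (hwgi i)).norm (Filter.Eventually.of_forall fun z => norm_nonneg _)
      (Filter.Eventually.of_forall hVW)) (h2 i)
    have h4 : ∫ z in V, ‖pderiv i φ z‖ ≤
        ∫ z in V, (‖pderiv i φ z - weakGrad W w i z‖ + ‖weakGrad W w i z‖) := by
      refine integral_mono (hgint i V).norm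
        (((hgint i V).sub ((hwgi i).mono_set hVW)).norm.add ((hwgi i).mono_set hVW).norm)
        fun z => ?_
      simpa using norm_add_le (pderiv i φ z - weakGrad W w i z) (weakGrad W w i z)
    have i1 : IntegrableOn (fun z => ‖pderiv i φ z - weakGrad W w i z‖) V :=
      ((hgint i V).sub ((hwgi i).mono_set hVW)).norm
    rw [integral_add i1 ((hwgi i).mono_set hVW).norm] at h4
    have h5 : ∫ z in V, ‖weakGrad W w i z‖ ≤ M * volume.real V := by
      rw [mul_comm, ← smul_eq_mul, ← setIntegral_const]
      have hae := weakGrad_ae_eq_pev hW hOo hOW hw.1 hwp hOb i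
      have hae' : ∀ᵐ z ∂(vol V), weakGrad W w i z = pev (MvPolynomial.pderiv i p) z :=
        ae_restrict_of_ae_restrict_of_subset hVO hae
      refine integral_mono_ae ((hwgi i).mono_set hVW).norm (integrableOn_const hVfin.ne) ?_
      rw [ae_restrict_iff' hV] at hae'
      rw [Filter.EventuallyLE, ae_restrict_iff' hV]
      filter_upwards [hae'] with z hz hzV
      rw [hz hzV]
      exact hM i z hzV
    linarith
  have e4 : ∫ z in V, ‖fderiv ℝ φ z n‖ ≤ ‖n‖ * (d * (ε + M * volume.real V)) := by
    have h3 : ∫ z in V, ‖fderiv ℝ φ z n‖ ≤ ∫ z in V, ‖n‖ * ∑ i, ‖pderiv i φ z‖ :=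
      integral_mono (hdint V).norm
        ((integrable_finsetSum _ fun i _ => (hgint i V).norm).const_mul _)
        fun z => norm_fderiv_apply_le φ z n
    rw [integral_const_mul, integral_finsetSum _ fun i _ => (hgint i V).norm] at h3
    refine h3.trans (mul_le_mul_of_nonneg_left ?_ (norm_nonneg _))
    refine (Finset.sum_le_sum fun i _ => e3 i).trans_eq ?_
    simp [mul_add]
  have e5 : δ * ∫ z in V, ‖fderiv ℝ φ z n‖ ≤ δ * (‖n‖ * (d * (ε + M * volume.real V))) :=
    mul_le_mul_of_nonneg_left e4 hδ
  have e6 : ε * (1 + δ * (‖n‖ * d)) = ε' := by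
    rw [hεdef]; field_simp
  nlinarith

/-- The barycentric coordinates along the direction from one vertex to another. -/
theorem bary_coord_sub_smul {s : Finset (E d)} (hs : AffineIndependent ℝ ((↑) : s → E d))
    (hc : s.card = d + 1) (i j k : s) (z : E d) (σ : ℝ) :
    (bary hs hc).coord i (z - σ • ((j : E d) - k)) = (bary hs hc).coord i z -
      σ * ((if (i : E d) = j then 1 else 0) - (if (i : E d) = k then 1 else 0)) := by
  have h2 := ((bary hs hc).coord i).map_vadd z (-(σ • ((j : E d) - k)))
  rw [vadd_eq_add, neg_add_eq_sub, map_neg, map_smul, ← vsub_eq_sub (j : E d) k,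
    AffineMap.linearMap_vsub] at h2
  have h4 := bary_coord_vertex hs hc i j
  have h5 := bary_coord_vertex hs hc i k
  simp only [Subtype.ext_iff] at h4 h5
  rw [h4, h5] at h2
  rw [← vsub_eq_sub (j : E d) k, h2]
  simp only [smul_eq_mul, vsub_eq_sub, vadd_eq_add]
  ring

namespace Mesh

variable {Ω W : Set (E d)} {T : Mesh Ω} {r : ℕ} {w : E d → ℂ}

/-- A polynomial which agrees with a function in `H¹₀(W)` on an element vanishes on the faces of
the element contained in the boundary of `W`. -/
theorem pev_eq_zero_of_face (hW : IsOpen W) (hWb : Bornology.IsBounded W) (hw : MemH10 W w)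
    {s t : Finset (E d)} (hs : s ∈ T.inner W) {p : MvPolynomial (Fin d) ℂ}
    (hwp : ∀ x ∈ cell s, w x = pev p x) (hts : t ⊆ s) (htc : t.card = d) (htne : t.Nonempty)
    (htW : cell t ⊆ frontier W) {x : E d} (hx : x ∈ cell t) : pev p x = 0 := by
  by_contra hpx
  have hind := T.K.indep hs.1.1
  have hcard := hs.1.2
  -- The vertex opposite to the face.
  obtain ⟨j, hjs, hjt⟩ : ∃ j ∈ s, j ∉ t := by
    by_contra hcon
    simp only [not_exists, not_and, not_not] at hcon
    have := Finset.card_le_card (show s ⊆ t from hcon)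
    omega
  have honly : ∀ i ∈ s, i ∉ t → i = j := by
    intro i hi hit
    by_contra hij
    have h1 : insert i (insert j t) ⊆ s :=
      Finset.insert_subset hi (Finset.insert_subset hjs hts)
    have h2 := Finset.card_le_card h1
    rw [Finset.card_insert_of_notMem (by simp [hij, hit]), Finset.card_insert_of_notMem hjt] at h2
    omega
  -- The direction j - k is transversal to the face: moving by -σ(j - k) lowers the coordinate of j
  -- by σ, raises that of k by σ and keeps the others. The face is thus reached after parameter
  -- length equal to the j-coordinate.
  obtain ⟨k, hkt⟩ := htne
  have hks := hts hkt
  have hjk : j ≠ k := fun h => hjt (h ▸ hkt)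
  obtain ⟨n, hn⟩ : ∃ n : E d, n = j - k := ⟨_, rfl⟩
  obtain ⟨b, hcell, hint, hface, hsum, hcombo, hcoord⟩ :
      ∃ b : s → E d → ℝ, (∀ z, z ∈ cell s ↔ ∀ i, 0 ≤ b i z) ∧
        (∀ z, z ∈ interior (cell s) ↔ ∀ i, 0 < b i z) ∧
        (∀ z, z ∈ cell t ↔ z ∈ cell s ∧ ∀ i : s, (i : E d) ∉ t → b i z = 0) ∧
        (∀ z, ∑ i, b i z = 1) ∧
        (∀ (i : s) (τ : ℝ) (y z : E d), b i ((1 - τ) • y + τ • z) =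
          (1 - τ) * b i y + τ * b i z) ∧
        ∀ (i : s) (z : E d) (σ : ℝ), b i (z - σ • n) = b i z -
          σ * ((if (i : E d) = j then 1 else 0) - (if (i : E d) = k then 1 else 0)) := by
    refine ⟨fun i z => (bary hind hcard).coord i z, fun z => ?_, fun z => ?_,
      mem_cell_iff_of_subset hind hcard hts, sum_bary hind hcard,
      fun i τ y z => bary_combo hind hcard i (by ring), fun i z σ => ?_⟩
    · exact Set.ext_iff.1 (cell_eq hind hcard) z
    · exact Set.ext_iff.1 (interior_cell_eq hind hcard) z
    · rw [hn]
      exact bary_coord_sub_smul hind hcard i ⟨j, hjs⟩ ⟨k, hks⟩ z σ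
  obtain ⟨b₀, hb₀⟩ := interior_cell_nonempty hind hcard
  obtain ⟨ρ, hρ, hball⟩ := Metric.isOpen_iff.1 isOpen_interior b₀ hb₀
  have hxs : x ∈ cell s := convexHull_mono (by exact_mod_cast hts) hx
  have hxj : b ⟨j, hjs⟩ x = 0 := ((hface x).1 hx).2 _ hjt
  -- constants
  set a := ‖pev p x‖ / 2 with ha
  have ha0 : 0 < a := by have := norm_pos_iff.2 hpx; positivity
  obtain ⟨η, hη, hηp⟩ := Metric.continuous_iff.1 (continuous_pev p) x a ha0
  obtain ⟨M, hM⟩ : ∃ M, ∀ i, ∀ z ∈ cell s, ‖pev (MvPolynomial.pderiv i p) z‖ ≤ M := by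
    choose M hM using fun i => (isCompact_cell s).exists_bound_of_continuousOn
      (continuous_pev (MvPolynomial.pderiv i p)).continuousOn
    refine ⟨∑ i, |M i|, fun i z hz => (hM i z hz).trans ((le_abs_self _).trans ?_)⟩
    exact Finset.single_le_sum (f := fun i => |M i|) (fun _ _ => abs_nonneg _) (Finset.mem_univ i)
  set R := dist b₀ x + ρ + ‖n‖ with hR
  have hR0 : 0 < R := by positivity
  set v := volume.real (Metric.ball (0 : E d) 1) with hv
  have hv0 : 0 < v := ENNReal.toReal_pos (Metric.measure_ball_pos _ _ one_pos).ne'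
    measure_ball_lt_top.ne
  have key : ∀ τ : ℝ, 0 < τ → τ ≤ 1 → τ * R < η →
      a * ρ ^ d ≤ τ * (‖n‖ * (d * (|M| * R ^ d))) := by
    intro τ hτ hτ1 hτη
    -- The homothety with centre x and ratio τ maps a ball inside the element to a ball near x. As
    -- the j-coordinate vanishes at x, it is at most τ there.
    set y : E d := x + τ • (b₀ - x) with hy
    have hsub : ∀ z ∈ Metric.ball y (τ * ρ), ∃ ζ ∈ Metric.ball b₀ ρ,
        z = (1 - τ) • x + τ • ζ := by
      intro z hz
      refine ⟨b₀ + τ⁻¹ • (z - y), ?_, ?_⟩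
      · rw [mem_ball_iff_norm, add_sub_cancel_left, norm_smul, norm_inv, Real.norm_of_nonneg hτ.le,
          inv_mul_lt_iff₀ hτ]
        exact mem_ball_iff_norm.1 hz
      · rw [smul_add, smul_inv_smul₀ hτ.ne', hy, sub_smul, one_smul, smul_sub]; abel
    have hcz : ∀ z ∈ Metric.ball y (τ * ρ), (∀ i, 0 < b i z) ∧
        b ⟨j, hjs⟩ z ≤ τ ∧ dist z x ≤ τ * (dist b₀ x + ρ) := by
      intro z hz
      obtain ⟨ζ, hζ, rfl⟩ := hsub z hz
      have hζ' := hball hζ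
      rw [hint] at hζ'
      have hxs' := hxs
      rw [hcell] at hxs'
      have e : ∀ i, b i ((1 - τ) • x + τ • ζ) = (1 - τ) * b i x + τ * b i ζ :=
        fun i => hcombo i τ x ζ
      refine ⟨fun i => ?_, ?_, ?_⟩
      · rw [e i]
        have h1 := mul_nonneg (sub_nonneg.2 hτ1) (hxs' i)
        have h2 := mul_pos hτ (hζ' i)
        linarith
      · rw [e, hxj, mul_zero, zero_add]
        have h1 : b ⟨j, hjs⟩ ζ ≤ 1 := by
          rw [← hsum ζ]
          exact Finset.single_le_sum (f := fun i => b i ζ) (fun i _ => (hζ' i).le)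
            (Finset.mem_univ _)
        exact mul_le_of_le_one_right hτ.le h1
      · have h1 : (1 - τ) • x + τ • ζ - x = τ • (ζ - x) := by
          rw [sub_smul, one_smul, smul_sub]; abel
        rw [dist_eq_norm, h1, norm_smul, Real.norm_of_nonneg hτ.le, ← dist_eq_norm]
        refine mul_le_mul_of_nonneg_left ?_ hτ.le
        have h2 := dist_triangle ζ b₀ x
        have h3 : dist ζ b₀ < ρ := hζ
        linarith
    have hBint : Metric.ball y (τ * ρ) ⊆ interior (cell s) := by
      intro z hz
      rw [hint]
      exact (hcz z hz).1
    have hcoordpath : ∀ z ∈ Metric.ball y (τ * ρ), ∀ σ : ℝ, 0 ≤ σ →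
        ∀ i : s, (i : E d) ≠ j → 0 < b i (z - σ • n) := by
      intro z hz σ hσ i hij
      rw [hcoord, if_neg hij]
      have h1 := (hcz z hz).1 i
      split_ifs <;> nlinarith
    -- The volume of the ball equals, and that of the swept region is at most, a constant times τ^d,
    -- while the paths contribute a further τ on the right. This is incompatible with a positive
    -- lower bound for |p| as τ tends to zero.
    have hest := mul_volume_le_of_boundary_face hW hWb.measure_lt_top hw (p := p)
      (O := interior (cell s)) (B := Metric.ball y (τ * ρ))
      (V := interior (cell s) ∩ Metric.closedBall x (τ * R)) isOpen_interior
      ((isCompact_cell s).isBounded.subset interior_subset) hs.2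
      (fun z hz => hwp z (interior_subset hz)) measurableSet_ball
      (isOpen_interior.measurableSet.inter measurableSet_closedBall) hBint inter_subset_left
      (n := n) (δ := τ) (c := b ⟨j, hjs⟩) hτ.le
      (fun z hz => ⟨((hcz z hz).1 _).le, (hcz z hz).2.1⟩) ?_ ?_ (a := a) (M := |M|) ?_ ?_
    · have hvB : volume.real (Metric.ball y (τ * ρ)) = τ ^ d * ρ ^ d * v := by
        rw [measureReal_def, Measure.addHaar_ball_of_pos _ _ (by positivity),
          finrank_euclideanSpace,
          Fintype.card_fin, ENNReal.toReal_mul, ENNReal.toReal_ofReal (by positivity), mul_pow, hv,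
          measureReal_def]
      have hvV : volume.real (interior (cell s) ∩ Metric.closedBall x (τ * R)) ≤
          τ ^ d * R ^ d * v := by
        refine (measureReal_mono inter_subset_right measure_closedBall_lt_top.ne).trans_eq ?_
        rw [measureReal_def, Measure.addHaar_closedBall _ _ (by positivity),
          finrank_euclideanSpace, Fintype.card_fin, ENNReal.toReal_mul,
          ENNReal.toReal_ofReal (by positivity), mul_pow, hv, measureReal_def]
      have hpos : 0 < τ ^ d * v := by positivity
      rw [hvB] at hest
      have h2 : τ * (‖n‖ * (d * (|M| *
          volume.real (interior (cell s) ∩ Metric.closedBall x (τ * R))))) ≤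
          τ * (‖n‖ * (d * (|M| * (τ ^ d * R ^ d * v)))) := by gcongr
      have h3 := hest.trans h2
      refine le_of_mul_le_mul_right ?_ hpos
      calc a * ρ ^ d * (τ ^ d * v) = a * (τ ^ d * ρ ^ d * v) := by ring
        _ ≤ _ := h3
        _ = _ := by ring
    · intro z hz hzW
      have hmem : z - b ⟨j, hjs⟩ z • n ∈ cell t := by
        refine (hface _).2 ⟨?_, ?_⟩
        · rw [hcell]
          intro i
          by_cases hij : (i : E d) = j
          · have : i = ⟨j, hjs⟩ := Subtype.ext hij
            rw [this]
            have := hcoord ⟨j, hjs⟩ z (b ⟨j, hjs⟩ z)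
            rw [if_pos rfl, if_neg hjk] at this
            rw [this]; simp
          · exact (hcoordpath z hz _ ((hcz z hz).1 _).le i hij).le
        · intro i hi
          have : i = ⟨j, hjs⟩ := Subtype.ext (honly i i.2 hi)
          rw [this]
          have := hcoord ⟨j, hjs⟩ z (b ⟨j, hjs⟩ z)
          rw [if_pos rfl, if_neg hjk] at this
          rw [this]; ring
      have hfr := htW hmem
      rw [hW.frontier_eq] at hfr
      exact hfr.2 hzW
    · intro z hz σ hσ
      refine ⟨?_, ?_⟩
      · rw [hint]
        intro i
        by_cases hij : (i : E d) = j
        · have : i = ⟨j, hjs⟩ := Subtype.ext hij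
          rw [this]
          have := hcoord ⟨j, hjs⟩ z σ
          rw [if_pos rfl, if_neg hjk] at this
          rw [this]
          linarith [hσ.2]
        · exact hcoordpath z hz _ hσ.1.le i hij
      · rw [Metric.mem_closedBall]
        have h1 := dist_triangle (z - σ • n) z x
        have h2 : dist (z - σ • n) z ≤ τ * ‖n‖ := by
          rw [dist_eq_norm, sub_sub_cancel_left, norm_neg, norm_smul, Real.norm_of_nonneg hσ.1.le]
          exact mul_le_mul_of_nonneg_right (hσ.2.le.trans (hcz z hz).2.1) (norm_nonneg _)
        have h3 := (hcz z hz).2.2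
        rw [hR]; linarith
    · intro z hz
      have h1 : dist z x < η := by
        refine ((hcz z hz).2.2).trans_lt (lt_of_le_of_lt ?_ hτη)
        rw [hR]
        exact mul_le_mul_of_nonneg_left (by linarith [norm_nonneg n]) hτ.le
      have h2 := hηp z h1
      rw [dist_eq_norm] at h2
      have h3 := norm_sub_norm_le (pev p x) (pev p z)
      rw [norm_sub_rev] at h3
      linarith
    · intro i z hz
      exact (hM i z (interior_subset hz.1)).trans (le_abs_self M)
  -- let the scale tend to zero
  set A := ‖n‖ * (d * (|M| * R ^ d)) with hA
  have hA0 : 0 ≤ A := by positivity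
  have hpos : 0 < a * ρ ^ d := by positivity
  set τ := min 1 (min (η / (2 * R)) (a * ρ ^ d / (2 * (A + 1)))) with hτdef
  have hτ0 : 0 < τ := by positivity
  have h1 : τ * R < η := by
    have : τ ≤ η / (2 * R) := (min_le_right _ _).trans (min_le_left _ _)
    rw [le_div_iff₀ (by positivity)] at this
    nlinarith
  have h2 : τ * (2 * (A + 1)) ≤ a * ρ ^ d := by
    have : τ ≤ a * ρ ^ d / (2 * (A + 1)) := (min_le_right _ _).trans (min_le_right _ _)
    rwa [le_div_iff₀ (by positivity)] at this
  have h3 := key τ hτ0 (min_le_left _ _) h1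
  nlinarith

/-- Finite element functions in `H¹₀(W)` have zero boundary values. -/
theorem IsFE.eq_zero_of_mem_frontier (hw : T.IsFE r w) (hal : AlignedWith T.K W) (hW : IsOpen W)
    (hWΩ : W ⊆ closure Ω) (hWb : Bornology.IsBounded W) (hw0 : MemH10 W w) {x : E d}
    (hx : x ∈ frontier W) : w x = 0 := by
  obtain ⟨Γ, hΓ, hcard, hfr⟩ := id hal
  have hx' := hx
  rw [hfr] at hx'
  obtain ⟨t, ht, hxt⟩ := mem_iUnion₂.1 hx'
  have htW : cell t ⊆ frontier W := by
    rw [hfr]; exact subset_biUnion_of_mem (u := fun s : Finset (E d) => cell s) ht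
  obtain ⟨s, hs, hts⟩ := exists_inner_of_face hal hW hWΩ (hΓ ht) htW
  obtain ⟨p, hp, hwp⟩ := hw.exists_poly hs.1
  have hxs : x ∈ cell s := convexHull_mono (by exact_mod_cast hts) hxt
  rw [hwp x hxs]
  exact pev_eq_zero_of_face hW hWb hw0 hs hwp hts (hcard t ht)
    (T.K.nonempty_of_mem_faces (hΓ ht)) htW hxt

end Mesh

/-! ### The cutoff operation on a simplex -/

theorem fderiv_apply_eq_sum (φ : E d → ℂ) (x n : E d) :
    fderiv ℝ φ x n = ∑ i, (n i : ℂ) * pderiv i φ x := by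
  have h2 : n = ∑ k, n k • EuclideanSpace.single k (1 : ℝ) := by
    have := (EuclideanSpace.basisFun (Fin d) ℝ).sum_repr n
    simpa using this.symm
  conv_lhs => rw [h2, map_sum]
  refine Finset.sum_congr rfl fun i _ => ?_
  rw [map_smul, Complex.real_smul]
  rfl

/-- The first order functional `p(x) + r⁻¹ Dp(x)(v - x)`. -/
def nodal (r : ℕ) (p : MvPolynomial (Fin d) ℂ) (x v : E d) : ℂ :=
  pev p x + (r : ℂ)⁻¹ * fderiv ℝ (pev p) x (v - x)

/-- The derivative in direction v - x is a one-sided derivative along a segment inside `S`. So on a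
common face the functional is the same from both elements. -/
theorem nodal_eq_of_eqOn (r : ℕ) {p p' : MvPolynomial (Fin d) ℂ} {S : Set (E d)}
    (hS : Convex ℝ S) (h : ∀ y ∈ S, pev p y = pev p' y) {x v : E d} (hx : x ∈ S) (hv : v ∈ S) :
    nodal r p x v = nodal r p' x v := by
  have hd : ∀ q : MvPolynomial (Fin d) ℂ, HasDerivWithinAt (fun τ : ℝ => pev q (x + τ • (v - x)))
      (fderiv ℝ (pev q) x (v - x)) (Icc 0 1) 0 := by
    intro q
    have h1 : HasDerivAt (fun τ : ℝ => x + τ • (v - x)) (v - x) 0 := by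
      simpa using ((hasDerivAt_id (0 : ℝ)).smul_const (v - x)).const_add x
    have h2 : HasFDerivAt (pev q) (fderiv ℝ (pev q) x) (x + (0 : ℝ) • (v - x)) := by
      simpa using (differentiable_pev q x).hasFDerivAt
    exact (h2.comp_hasDerivAt (0 : ℝ) h1).hasDerivWithinAt
  have heq : ∀ τ ∈ Icc (0 : ℝ) 1, pev p (x + τ • (v - x)) = pev p' (x + τ • (v - x)) :=
    fun τ hτ => h _ (hS.add_smul_sub_mem hx hv hτ)
  have h0 : (0 : ℝ) ∈ Icc (0 : ℝ) 1 := ⟨le_rfl, zero_le_one⟩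
  have h3 := (uniqueDiffOn_Icc (zero_lt_one (α := ℝ)) 0 h0).eq_deriv _ (hd p)
    ((hd p').congr heq (heq 0 h0))
  rw [nodal, nodal, h x hx, h3]

theorem nodal_eq_zero (r : ℕ) {p : MvPolynomial (Fin d) ℂ} {S : Set (E d)}
    (hS : Convex ℝ S) (h : ∀ y ∈ S, pev p y = 0) {x v : E d} (hx : x ∈ S) (hv : v ∈ S) :
    nodal r p x v = 0 := by
  have := nodal_eq_of_eqOn r (p' := 0) hS (fun y hy => by rw [h y hy]; simp) hx hv
  rw [this, nodal]
  have : pev (0 : MvPolynomial (Fin d) ℂ) = fun _ : E d => (0 : ℂ) := by ext; simp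
  simp [this]

/-- Barycentric coordinates with respect to a face of a simplex. -/
theorem bary_coord_of_sum {s t : Finset (E d)} (hs : AffineIndependent ℝ ((↑) : s → E d))
    (hc : s.card = d + 1) (hts : t ⊆ s) {w : E d → ℝ} (hw : ∑ v ∈ t, w v = 1) (i : s) :
    (bary hs hc).coord i (∑ v ∈ t, w v • v) = if (i : E d) ∈ t then w i else 0 := by
  classical
  have h1 : ∑ v ∈ t, w v • v = t.affineCombination ℝ id w := by
    rw [t.affineCombination_eq_linear_combination _ _ hw]; rfl
  rw [h1, Finset.map_affineCombination _ _ _ hw,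
    t.affineCombination_eq_linear_combination _ _ hw]
  have h2 : ∀ v ∈ t, w v • ((bary hs hc).coord i ∘ id) v = if (i : E d) = v then w v else 0 := by
    intro v hv
    have := bary_coord_vertex hs hc i ⟨v, hts hv⟩
    simp only [Subtype.ext_iff] at this
    simp [this]
  rw [Finset.sum_congr rfl h2, Finset.sum_ite_eq]

/-- A degree preserving substitute of the product of `p` with the piecewise linear interpolant of
the vertex values `χ`. -/
theorem exists_cutoff_poly {r : ℕ} (hr : 1 ≤ r) {s : Finset (E d)}
    (hs : AffineIndependent ℝ ((↑) : s → E d)) (hc : s.card = d + 1)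
    {p : MvPolynomial (Fin d) ℂ} (hp : p.totalDegree ≤ r) (χ : E d → ℝ) :
    ∃ q : MvPolynomial (Fin d) ℂ, q.totalDegree ≤ r ∧ ∀ t ⊆ s, ∀ w : E d → ℝ,
      ∑ v ∈ t, w v = 1 → pev q (∑ v ∈ t, w v • v) =
        ∑ v ∈ t, ((w v * χ v : ℝ) : ℂ) * nodal r p (∑ v ∈ t, w v • v) v := by
  classical
  choose Λ hΛ hΛx using fun i : s => exists_poly_of_affine ((bary hs hc).coord i)
  have hdeg : ∀ c : s → ℂ, (∑ i, MvPolynomial.C (c i) * Λ i).totalDegree ≤ 1 := by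
    intro c
    refine MvPolynomial.totalDegree_finsetSum_le fun i _ => ?_
    refine (MvPolynomial.totalDegree_mul _ _).trans ?_
    rw [MvPolynomial.totalDegree_C, zero_add]
    exact hΛ i
  -- The affine functions are the interpolants of χ and of χ times the k-th coordinate. On a subface
  -- only its own barycentric weights survive, so one q obeys the formula for all faces.
  obtain ⟨q, hq, hqx⟩ := exists_poly_cutoff hr hp (hdeg fun i => (χ i : ℂ))
    (fun k => hdeg fun i => ((χ i * (i : E d) k : ℝ) : ℂ))
  refine ⟨q, hq, fun t hts w hw => ?_⟩
  set x := ∑ v ∈ t, w v • v with hx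
  have hsum : ∀ c : E d → ℂ, ∑ i : s, c i * (((bary hs hc).coord i x : ℝ) : ℂ) =
      ∑ v ∈ t, c v * (w v : ℂ) := by
    intro c
    calc ∑ i : s, c i * (((bary hs hc).coord i x : ℝ) : ℂ)
        = ∑ i : s, (fun v => if v ∈ t then c v * (w v : ℂ) else 0) i := by
          refine Finset.sum_congr rfl fun i _ => ?_
          rw [hx, bary_coord_of_sum hs hc hts hw]
          by_cases hi : (i : E d) ∈ t <;> simp [hi]
      _ = ∑ v ∈ s, if v ∈ t then c v * (w v : ℂ) else 0 :=
          Finset.sum_coe_sort s fun v => if v ∈ t then c v * (w v : ℂ) else 0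
      _ = ∑ v ∈ t, c v * (w v : ℂ) := by
          rw [← Finset.sum_filter, Finset.filter_mem_eq_inter, Finset.inter_eq_right.2 hts]
  rw [hqx]
  simp only [pev_sum, pev_mul, pev_C, hΛx]
  rw [hsum fun v => (χ v : ℂ)]
  have hk : ∀ k : Fin d, ∑ i : s, ((χ i * (i : E d) k : ℝ) : ℂ) *
      (((bary hs hc).coord i x : ℝ) : ℂ) = ∑ v ∈ t, ((χ v * v k : ℝ) : ℂ) * (w v : ℂ) :=
    fun k => hsum fun v => ((χ v * v k : ℝ) : ℂ)
  simp only [hk, nodal, fderiv_apply_eq_sum, pderiv_pev, mul_add, Finset.sum_add_distrib,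
    Finset.sum_mul, ← Finset.sum_sub_distrib]
  congr 1
  · exact Finset.sum_congr rfl fun v _ => by push_cast; ring
  · simp only [Finset.mul_sum]
    rw [Finset.sum_comm]
    refine Finset.sum_congr rfl fun v _ => Finset.sum_congr rfl fun k _ => ?_
    simp only [PiLp.sub_apply]
    push_cast
    ring

/-! ### A cutoff function on a possibly cracked domain. -/

/-- A cutoff function with prescribed gap, Lipschitz on convex subsets of `Ω`. -/
theorem exists_cutoff_function {Ω W G : Set (E d)} (hΩ : IsOpen Ω) (hW : IsOpen W) (hG : IsOpen G)
    (hGW : G ⊆ W)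
    {δ : ℝ} (hδ : 0 < δ) (hdist : ∀ x ∈ frontier G \ frontier Ω, ∀ y ∈ frontier W \ frontier Ω,
      δ ≤ dist x y) :
    ∃ f : E d → ℝ, (∀ x ∈ G, f x = 1) ∧ (∀ x ∈ frontier W \ frontier Ω, f x = 0) ∧
      ∀ S : Set (E d), Convex ℝ S → S ⊆ Ω → LipschitzOnWith (Real.toNNReal (1 / δ)) f S := by
  classical
  set Z := frontier W \ frontier Ω with hZ
  have hK : ((1 / δ).toNNReal : ℝ) = 1 / δ := Real.coe_toNNReal _ (by positivity)
  -- The distance to the empty set is zero by convention, so an empty Z is treated separately, with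
  -- the constant one.
  by_cases hne : Z.Nonempty
  swap
  · refine ⟨fun _ => 1, fun _ _ => rfl, fun x hx => absurd ⟨x, hx⟩ hne, fun S _ _ => ?_⟩
    exact (LipschitzWith.const' (1 : ℝ)).lipschitzOnWith
  -- Off G the value is the truncated distance to Z, which equals one on the part of the frontier of
  -- G inside Ω. A jump is possible only across the frontier of Ω, hence not within a convex subset
  -- of Ω.
  refine ⟨fun x => if x ∈ G then 1 else min 1 (Metric.infDist x Z / δ), fun x hx => if_pos hx,
    fun x hx => ?_, fun S hS hSΩ => ?_⟩
  · have hxW : x ∉ W := by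
      have := hx.1; rw [hW.frontier_eq] at this; exact this.2
    have hxG : x ∉ G := fun h => hxW (hGW h)
    simp only [if_neg hxG, Metric.infDist_zero_of_mem hx]
    simp
  · have key : ∀ x ∈ S, ∀ y ∈ S, x ∈ G → y ∉ G →
        1 - min 1 (Metric.infDist y Z / δ) ≤ 1 / δ * dist x y := by
      intro x hx y hy hxG hyG
      -- A segment leaving G inside Ω crosses its frontier at a point of distance at least δ from Z.
      obtain ⟨z, hz, hzG⟩ : ∃ z ∈ segment ℝ x y, z ∈ frontier G := by
        by_contra hcon
        simp only [not_exists, not_and] at hcon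
        refine hyG ((convex_segment x y).isPreconnected.subset_left_of_subset_union hG
          (isClosed_closure (s := G)).isOpen_compl ?_ ?_ ⟨x, left_mem_segment ℝ x y, hxG⟩
          (right_mem_segment ℝ x y))
        · exact Set.disjoint_left.2 fun z hz hz' => hz' (subset_closure hz)
        · intro z hz
          by_cases hzG : z ∈ G
          · exact Or.inl hzG
          · exact Or.inr fun hzc => hcon z hz (by rw [hG.frontier_eq]; exact ⟨hzc, hzG⟩)
      have hzΩ : z ∈ Ω := hSΩ (hS.segment_subset hx hy hz)
      have hzf : z ∉ frontier Ω := by rw [hΩ.frontier_eq]; exact fun h => h.2 hzΩ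
      have h1 : δ ≤ Metric.infDist z Z :=
        (Metric.le_infDist hne).2 fun y hy => hdist z ⟨hzG, hzf⟩ y hy
      have h2 : Metric.infDist z Z ≤ Metric.infDist y Z + dist z y :=
        Metric.infDist_le_infDist_add_dist
      have h3 : dist z y ≤ dist x y := by
        have := dist_add_dist_of_mem_segment hz
        linarith [dist_nonneg (x := x) (y := z)]
      have h4 : 0 ≤ 1 / δ * dist x y := by positivity
      rcases le_total 1 (Metric.infDist y Z / δ) with h | h
      · rw [min_eq_left h]; linarith
      · rw [min_eq_right h, sub_le_iff_le_add, div_mul_eq_mul_div, one_mul, ← add_div,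
          le_div_iff₀ hδ]
        linarith
    refine LipschitzOnWith.of_dist_le_mul fun x hx y hy => ?_
    rw [hK, Real.dist_eq]
    by_cases hxG : x ∈ G <;> by_cases hyG : y ∈ G
    · simp only [if_pos hxG, if_pos hyG, sub_self, abs_zero]; positivity
    · simp only [if_pos hxG, if_neg hyG]
      rw [abs_of_nonneg (sub_nonneg.2 (min_le_left _ _))]
      exact key x hx y hy hxG hyG
    · simp only [if_neg hxG, if_pos hyG]
      rw [abs_sub_comm, abs_of_nonneg (sub_nonneg.2 (min_le_left _ _)), dist_comm]
      exact key y hy x hx hyG hxG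
    · simp only [if_neg hxG, if_neg hyG]
      refine (abs_min_sub_min_le_max _ _ _ _).trans ?_
      rw [sub_self, abs_zero, max_eq_right (abs_nonneg _), ← sub_div, abs_div, abs_of_pos hδ,
        div_le_iff₀ hδ]
      have h1 : Metric.infDist x Z ≤ Metric.infDist y Z + dist x y :=
        Metric.infDist_le_infDist_add_dist
      have h2 : Metric.infDist y Z ≤ Metric.infDist x Z + dist y x :=
        Metric.infDist_le_infDist_add_dist
      rw [dist_comm y x] at h2
      have h3 : 1 / δ * dist x y * δ = dist x y := by field_simp
      rw [h3, abs_le]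
      constructor <;> linarith

namespace Mesh

variable {Ω W : Set (E d)} {T : Mesh Ω} {r : ℕ}

/-- Gluing of polynomials on the elements in `W`, extended by zero. -/
theorem exists_isFE_of_inner (hal : AlignedWith T.K W) (hW : IsOpen W)
    {q : Finset (E d) → MvPolynomial (Fin d) ℂ} (hq : ∀ s ∈ T.inner W, (q s).totalDegree ≤ r)
    (hcons : ∀ s ∈ T.inner W, ∀ s' ∈ T.inner W, ∀ x ∈ cell s, x ∈ cell s' →
      pev (q s) x = pev (q s') x)
    (hzero : ∀ s ∈ T.inner W, ∀ x ∈ cell s, x ∈ frontier W → pev (q s) x = 0) :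
    ∃ v : E d → ℂ, T.IsFE r v ∧ (∀ s ∈ T.inner W, ∀ x ∈ cell s, v x = pev (q s) x) ∧
      ∀ x ∉ W, v x = 0 := by
  classical
  set v : E d → ℂ := fun x => if h : ∃ s ∈ T.inner W, x ∈ cell s then pev (q h.choose) x else 0
    with hv
  have hvs : ∀ s ∈ T.inner W, ∀ x ∈ cell s, v x = pev (q s) x := by
    intro s hs x hx
    have h : ∃ s ∈ T.inner W, x ∈ cell s := ⟨s, hs, hx⟩
    simp only [hv, dif_pos h]
    exact hcons _ h.choose_spec.1 _ hs x h.choose_spec.2 hx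
  have hv0 : ∀ x ∉ W, v x = 0 := by
    intro x hx
    by_cases h : ∃ s ∈ T.inner W, x ∈ cell s
    · obtain ⟨s, hs, hxs⟩ := h
      rw [hvs s hs x hxs]
      refine hzero s hs x hxs ?_
      rw [hW.frontier_eq]
      exact ⟨cell_subset_closure hs hxs, hx⟩
    · simp only [hv, dif_neg h]
  have hloc : ∀ s ∈ T.elements, ∃ p : MvPolynomial (Fin d) ℂ, p.totalDegree ≤ r ∧
      ∀ x ∈ cell s, v x = pev p x := by
    intro s hs
    by_cases hsW : s ∈ T.inner W
    · exact ⟨q s, hq s hsW, hvs s hsW⟩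
    · refine ⟨0, by simp, fun x hx => ?_⟩
      rw [hv0 x fun hxW => hsW (mem_inner_of_mem hal hW hs hx hxW), pev_zero]
  refine ⟨v, ⟨?_, hloc⟩, hvs, hv0⟩
  rw [T.closure_eq, biUnion_eq_iUnion]
  have : Finite T.elements := T.finite_elements
  refine (locallyFinite_of_finite _).continuousOn_iUnion (fun s => isClosed_cell _) fun s => ?_
  obtain ⟨p, -, hp⟩ := hloc s s.2
  exact (continuous_pev p).continuousOn.congr hp

end Mesh

/-! ### Vertex values and the error of the cutoff on one element. -/

/-- Vertex values of a cutoff function: one where the function is at least `1/2`. -/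
def clamp (y : ℝ) : ℝ := min 1 (2 * max 0 y)

theorem clamp_nonneg (y : ℝ) : 0 ≤ clamp y :=
  le_min zero_le_one (mul_nonneg zero_le_two (le_max_left _ _))

theorem clamp_le_one (y : ℝ) : clamp y ≤ 1 := min_le_left _ _

theorem clamp_zero : clamp 0 = 0 := by simp [clamp]

theorem lt_of_clamp_lt_one {y : ℝ} (h : clamp y < 1) : y < 1 / 2 := by
  by_contra hy
  rw [not_lt] at hy
  have : 1 ≤ 2 * max 0 y := by linarith [le_max_right 0 y]
  rw [clamp, min_eq_left this] at h
  exact lt_irrefl _ h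

theorem abs_clamp_sub_le (x y : ℝ) : |clamp x - clamp y| ≤ 2 * |x - y| := by
  unfold clamp
  refine (abs_min_sub_min_le_max _ _ _ _).trans ?_
  rw [sub_self, abs_zero, max_eq_right (abs_nonneg _), ← mul_sub, abs_mul, abs_two]
  refine mul_le_mul_of_nonneg_left ?_ zero_le_two
  refine (abs_max_sub_max_le_max _ _ _ _).trans ?_
  rw [sub_self, abs_zero, max_eq_right (abs_nonneg _)]

/-- Barycentric coordinates as a function on the whole space, so that sums over `s` and over its
faces share one format. -/
theorem exists_weights {s : Finset (E d)} (hs : AffineIndependent ℝ ((↑) : s → E d))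
    (hc : s.card = d + 1) (x : E d) :
    ∃ w : E d → ℝ, ∑ v ∈ s, w v = 1 ∧ ∑ v ∈ s, w v • v = x ∧
      (x ∈ cell s → ∀ v ∈ s, 0 ≤ w v) := by
  classical
  have hinj : Function.Injective ((↑) : s → E d) := Subtype.val_injective
  refine ⟨Function.extend ((↑) : s → E d) (fun i => (bary hs hc).coord i x) 0, ?_, ?_, ?_⟩
  · rw [← Finset.sum_coe_sort, ← sum_bary hs hc x]
    exact Finset.sum_congr rfl fun i _ => hinj.extend_apply _ _ _
  · rw [← Finset.sum_coe_sort s fun v => _ • v]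
    conv_rhs => rw [← sum_bary_smul hs hc x]
    exact Finset.sum_congr rfl fun i _ => by rw [hinj.extend_apply]
  · intro hx v hv
    rw [cell_eq hs hc] at hx
    have := hinj.extend_apply (fun i => (bary hs hc).coord i x) 0 ⟨v, hv⟩
    rw [this]
    exact hx _

theorem exists_combo_of_mem_ball {x b z : E d} {τ ρ : ℝ} (hτ : 0 < τ)
    (hz : z ∈ Metric.ball ((1 - τ) • x + τ • b) (τ * ρ)) :
    ∃ ζ ∈ Metric.ball b ρ, z = (1 - τ) • x + τ • ζ := by
  refine ⟨b + τ⁻¹ • (z - ((1 - τ) • x + τ • b)), ?_, ?_⟩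
  · rw [mem_ball_iff_norm, add_sub_cancel_left, norm_smul, norm_inv, Real.norm_of_nonneg hτ.le,
      inv_mul_lt_iff₀ hτ]
    exact mem_ball_iff_norm.1 hz
  · rw [smul_add, smul_inv_smul₀ hτ.ne']; abel

theorem diam_cell_pos (hd : 1 ≤ d) {s : Finset (E d)} (hc : s.card = d + 1) :
    0 < Metric.diam (cell s) := by
  obtain ⟨x, hx, y, hy, hxy⟩ := Finset.one_lt_card.1 (show 1 < s.card by omega)
  refine (dist_pos.2 hxy).trans_le
    (Metric.dist_le_diam_of_mem (isCompact_cell s).isBounded ?_ ?_)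
  · exact subset_convexHull ℝ _ hx
  · exact subset_convexHull ℝ _ hy

theorem pdens_eq_zero {p : MvPolynomial (Fin d) ℂ} (h : ∀ x, pev p x = 0) (x : E d) :
    pdens p x = 0 := by
  have h0 : pev p = fun _ => (0 : ℂ) := funext h
  have h1 : ∀ i, pev (MvPolynomial.pderiv i p) x = 0 := by
    intro i
    rw [← pderiv_pev, h0]
    simp [pderiv]
  simp [pdens, dens, h x, h1]

theorem pdens_nonneg (p : MvPolynomial (Fin d) ℂ) (x : E d) : 0 ≤ pdens p x := dens_nonneg _ _ _

/-- On an element, the error of the cutoff operation is controlled by the function on the region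
where the cutoff function is less than one. -/
theorem exists_cutoff_estimate (hd : 1 ≤ d) {r : ℕ} (hr : 1 ≤ r) {κ δ B : ℝ} (hκ : 0 < κ)
    (hδ : 0 < δ) (hB : 0 < B) :
    ∃ C : ℝ, 0 ≤ C ∧ ∀ s : Finset (E d), AffineIndependent ℝ ((↑) : s → E d) → s.card = d + 1 →
      Metric.diam (cell s) ≤ B → (∃ c, Metric.ball c (κ * Metric.diam (cell s)) ⊆ cell s) →
      ∀ F : E d → ℝ, LipschitzWith (Real.toNNReal (1 / δ)) F →
      ∀ p q : MvPolynomial (Fin d) ℂ, p.totalDegree ≤ r → q.totalDegree ≤ r →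
      (∀ w : E d → ℝ, ∑ v ∈ s, w v = 1 → pev q (∑ v ∈ s, w v • v) =
        ∑ v ∈ s, ((w v * clamp (F v) : ℝ) : ℂ) * nodal r p (∑ v ∈ s, w v • v) v) →
      ∫ x in interior (cell s), pdens (q - p) x ≤
        C * ∫ x in interior (cell s) ∩ {x | F x < 1}, pdens p x := by
  -- With this ratio, shrinking an element of diameter at most B towards a vertex moves no point
  -- further than δ/4 from it, whatever the mesh size.
  set t := min 1 (δ / (4 * B)) with ht
  have ht0 : 0 < t := by positivity
  have ht1 : t ≤ 1 := min_le_left _ _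
  have htB : t * B ≤ δ / 4 := by
    have : t ≤ δ / (4 * B) := min_le_right _ _
    rw [le_div_iff₀ (by positivity)] at this
    linarith
  -- The slope is L = 2/δ because `clamp` doubles the Lipschitz constant 1/δ.
  obtain ⟨C, hC, hest⟩ := exists_cell_estimate d r (ρ := t * κ) (L := 2 / δ) (B := B)
    (by positivity)
  refine ⟨C, hC, fun s hs hc hdB hball F hF p q hp hq hqp => ?_⟩
  have hrhs : 0 ≤ C * ∫ x in interior (cell s) ∩ {x | F x < 1}, pdens p x :=
    mul_nonneg hC (integral_nonneg fun x => pdens_nonneg p x)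
  choose w hw1 hwx hw0 using exists_weights hs hc
  have hsum : ∀ x : E d, ∑ v ∈ s, w x v • (v - x) = 0 := by
    intro x
    simp only [smul_sub, Finset.sum_sub_distrib, hwx, ← Finset.sum_smul, hw1, one_smul, sub_self]
  have hqx : ∀ x, pev q x = ∑ v ∈ s, ((w x v * clamp (F v) : ℝ) : ℂ) * nodal r p x v := by
    intro x
    have := hqp (w x) (hw1 x)
    rwa [hwx] at this
  -- If all vertex values are one, the first order terms cancel, as the weighted sum of v - x
  -- vanishes, and q = p.
  by_cases hall : ∀ v ∈ s, 1 ≤ clamp (F v)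
  · have hqp' : ∀ x, pev (q - p) x = 0 := by
      intro x
      rw [pev_sub, hqx, sub_eq_zero]
      have e1 : ∑ v ∈ s, ((w x v * clamp (F v) : ℝ) : ℂ) * nodal r p x v =
          ∑ v ∈ s, ((w x v : ℂ) * pev p x + (r : ℂ)⁻¹ * fderiv ℝ (pev p) x (w x v • (v - x))) := by
        refine Finset.sum_congr rfl fun v hv => ?_
        rw [le_antisymm (clamp_le_one _) (hall v hv), mul_one, nodal, map_smul, Complex.real_smul]
        ring
      rw [e1, Finset.sum_add_distrib, ← Finset.sum_mul, ← Finset.mul_sum, ← map_sum, hsum,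
        ← Complex.ofReal_sum, hw1]
      simp
    simp only [pdens_eq_zero hqp', integral_zero]
    exact hrhs
  simp only [not_forall, not_le] at hall
  obtain ⟨v₀, hv₀, hv₀1⟩ := hall
  have hFv₀ := lt_of_clamp_lt_one hv₀1
  obtain ⟨c, hcball⟩ := hball
  have hh := diam_cell_pos hd hc
  set h := Metric.diam (cell s) with hhdef
  have hconv : Convex ℝ (cell s) := convex_convexHull ℝ _
  have hbdd := (isCompact_cell s).isBounded
  have hv₀s : v₀ ∈ cell s := subset_convexHull ℝ _ hv₀
  have hcs : c ∈ cell s := hcball (Metric.mem_ball_self (by positivity))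
  have hFl : ∀ x y, |F x - F y| ≤ 1 / δ * dist x y := by
    intro x y
    have := hF.dist_le_mul x y
    rwa [Real.dist_eq, Real.coe_toNNReal _ (by positivity)] at this
  -- The inscribed ball is contracted towards the vertex v₀. There F is below 1/2 + 1/4, which is
  -- why `clamp` reaches one already at 1/2.
  set y : E d := (1 - t) • v₀ + t • c with hy
  have hys : y ∈ cell s := hconv hv₀s hcs (by linarith) ht0.le (by ring)
  have hS : Metric.ball y (h * (t * κ)) ⊆ interior (cell s) ∩ {x | F x < 1} := by
    have hcombo : ∀ z ∈ Metric.ball y (h * (t * κ)), ∃ ζ ∈ cell s, z = (1 - t) • v₀ + t • ζ := by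
      intro z hz
      rw [show h * (t * κ) = t * (κ * h) by ring] at hz
      obtain ⟨ζ, hζ, rfl⟩ := exists_combo_of_mem_ball ht0 hz
      exact ⟨ζ, hcball hζ, rfl⟩
    refine subset_inter (interior_maximal (fun z hz => ?_) Metric.isOpen_ball) fun z hz => ?_
    · obtain ⟨ζ, hζ, rfl⟩ := hcombo z hz
      exact hconv hv₀s hζ (by linarith) ht0.le (by ring)
    · obtain ⟨ζ, hζ, rfl⟩ := hcombo z hz
      have e1 : (1 - t) • v₀ + t • ζ - v₀ = t • (ζ - v₀) := by
        rw [sub_smul, one_smul, smul_sub]; abel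
      have e2 : dist ((1 - t) • v₀ + t • ζ) v₀ ≤ δ / 4 := by
        rw [dist_eq_norm, e1, norm_smul, Real.norm_of_nonneg ht0.le, ← dist_eq_norm]
        refine le_trans (mul_le_mul_of_nonneg_left ?_ ht0.le) htB
        exact (Metric.dist_le_diam_of_mem hbdd hζ hv₀s).trans hdB
      have e3 := (le_abs_self _).trans (hFl ((1 - t) • v₀ + t • ζ) v₀)
      have e4 : 1 / δ * dist ((1 - t) • v₀ + t • ζ) v₀ ≤ 1 / δ * (δ / 4) :=
        mul_le_mul_of_nonneg_left e2 (by positivity)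
      have e5 : 1 / δ * (δ / 4) = 1 / 4 := by field_simp
      show F _ < 1
      linarith
  have hKy : cell s ⊆ Metric.closedBall y h := fun x hx =>
    Metric.mem_closedBall.2 (Metric.dist_le_diam_of_mem hbdd hx hys)
  have hint : ∀ p : MvPolynomial (Fin d) ℂ, IntegrableOn (pdens p) (cell s) := fun p =>
    integrableOn_of_continuous_of_subset (continuous_pdens p) hKy
  -- Here χ interpolates the vertex values, Z collects the first order corrections, of size at most
  -- h, and the comparison constant is the value at v₀.
  have hmain := hest p q hp hq y h hh hdB (cell s) hKy (isClosed_cell s).measurableSet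
    (hS.trans (inter_subset_left.trans interior_subset))
    (fun x => ((∑ v ∈ s, w x v * clamp (F v) : ℝ) : ℂ))
    (fun k x => (((r : ℝ)⁻¹ * ∑ v ∈ s, w x v * clamp (F v) * (v k - x k) : ℝ) : ℂ))
    (clamp (F v₀) : ℂ) ?_ ?_ ?_
  · refine (setIntegral_mono_set (hint _) (Filter.Eventually.of_forall fun x => pdens_nonneg _ x)
      (Filter.Eventually.of_forall interior_subset)).trans (hmain.trans ?_)
    refine mul_le_mul_of_nonneg_left ?_ hC
    exact setIntegral_mono_set ((hint p).mono_set (inter_subset_left.trans interior_subset))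
      (Filter.Eventually.of_forall fun x => pdens_nonneg _ x) (Filter.Eventually.of_forall hS)
  · rw [Complex.norm_real, Real.norm_of_nonneg (clamp_nonneg _)]
    exact clamp_le_one _
  · intro x _
    rw [hqx]
    simp only [nodal, fderiv_apply_eq_sum, pderiv_pev, mul_add, Finset.sum_add_distrib]
    push_cast
    simp only [Finset.sum_mul, Finset.mul_sum]
    congr 1
    rw [Finset.sum_comm]
    refine Finset.sum_congr rfl fun k _ => Finset.sum_congr rfl fun v _ => ?_
    simp only [PiLp.sub_apply]
    push_cast
    ring
  · intro x hx
    have hwn := hw0 x hx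
    have hn : ∀ v ∈ s, 0 ≤ w x v * clamp (F v) := fun v hv =>
      mul_nonneg (hwn v hv) (clamp_nonneg _)
    have hle : ∀ v ∈ s, w x v * clamp (F v) ≤ w x v := fun v hv =>
      mul_le_of_le_one_right (hwn v hv) (clamp_le_one _)
    refine ⟨?_, ?_, fun k => ?_⟩
    · rw [Complex.norm_real, Real.norm_of_nonneg (Finset.sum_nonneg hn)]
      exact (Finset.sum_le_sum hle).trans_eq (hw1 x)
    · rw [← Complex.ofReal_sub, Complex.norm_real, Real.norm_eq_abs]
      have e : ∑ v ∈ s, w x v * clamp (F v) - clamp (F v₀) =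
          ∑ v ∈ s, w x v * (clamp (F v) - clamp (F v₀)) := by
        simp only [mul_sub, Finset.sum_sub_distrib, ← Finset.sum_mul, hw1, one_mul]
      rw [e]
      refine (Finset.abs_sum_le_sum_abs _ _).trans ?_
      have : ∀ v ∈ s, |w x v * (clamp (F v) - clamp (F v₀))| ≤ w x v * (2 / δ * h) := by
        intro v hv
        rw [abs_mul, abs_of_nonneg (hwn v hv)]
        refine mul_le_mul_of_nonneg_left ?_ (hwn v hv)
        refine (abs_clamp_sub_le _ _).trans ?_
        have h1 := hFl v v₀
        have h2 : 1 / δ * dist v v₀ ≤ 1 / δ * h := mul_le_mul_of_nonneg_left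
          (Metric.dist_le_diam_of_mem hbdd (subset_convexHull ℝ _ hv) hv₀s) (by positivity)
        have h3 : 2 / δ * h = 2 * (1 / δ * h) := by ring
        rw [h3]; linarith
      refine (Finset.sum_le_sum this).trans_eq ?_
      rw [← Finset.sum_mul, hw1, one_mul]
    · rw [Complex.norm_real, Real.norm_eq_abs, abs_mul]
      have h1 : |(r : ℝ)⁻¹| ≤ 1 := by
        rw [abs_of_nonneg (by positivity)]
        exact inv_le_one_of_one_le₀ (by exact_mod_cast hr)
      have h2 : |∑ v ∈ s, w x v * clamp (F v) * (v k - x k)| ≤ h := by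
        refine (Finset.abs_sum_le_sum_abs _ _).trans ?_
        have : ∀ v ∈ s, |w x v * clamp (F v) * (v k - x k)| ≤ w x v * h := by
          intro v hv
          rw [abs_mul, abs_of_nonneg (hn v hv)]
          refine mul_le_mul (hle v hv) ?_ (abs_nonneg _) (hwn v hv)
          refine le_trans ?_ (Metric.dist_le_diam_of_mem hbdd (subset_convexHull ℝ _ hv) hx)
          rw [dist_eq_norm]
          exact PiLp.norm_apply_le (v - x) k
        refine (Finset.sum_le_sum this).trans_eq ?_
        rw [← Finset.sum_mul, hw1, one_mul]
      calc _ ≤ 1 * h := mul_le_mul h1 h2 (abs_nonneg _) zero_le_one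
        _ = h := one_mul h

/-! ### Gluing the elementwise cutoffs. -/

namespace Mesh

variable {Ω W : Set (E d)} {T : Mesh Ω} {r : ℕ}

/-- The cutoff operation for finite element functions with zero boundary values. -/
theorem exists_isFE_cutoff (hr : 1 ≤ r) (hΩ : IsOpen Ω) (hW : IsOpen W)
    (hal : AlignedWith T.K W) {K : ℝ≥0} {f : E d → ℝ}
    (hf0 : ∀ x ∈ frontier W \ frontier Ω, f x = 0)
    (hfL : ∀ S : Set (E d), Convex ℝ S → S ⊆ Ω → LipschitzOnWith K f S)
    {φ : E d → ℂ} (hφ : T.IsFE r φ) (hφ0 : ∀ x ∈ frontier Ω, φ x = 0) :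
    ∃ (F : Finset (E d) → E d → ℝ) (P Q : Finset (E d) → MvPolynomial (Fin d) ℂ) (v : E d → ℂ),
      T.IsFE r v ∧ (∀ x ∉ W, v x = 0) ∧ ∀ s ∈ T.inner W,
        LipschitzWith K (F s) ∧ EqOn f (F s) (cell s \ frontier Ω) ∧
        (P s).totalDegree ≤ r ∧ (Q s).totalDegree ≤ r ∧
        (∀ x ∈ cell s, φ x = pev (P s) x) ∧ (∀ x ∈ cell s, v x = pev (Q s) x) ∧
        ∀ w : E d → ℝ, ∑ y ∈ s, w y = 1 → pev (Q s) (∑ y ∈ s, w y • y) =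
          ∑ y ∈ s, ((w y * clamp (F s y) : ℝ) : ℂ) * nodal r (P s) (∑ y ∈ s, w y • y) y := by
  classical
  have hex : ∀ s ∈ T.inner W, ∃ (F : E d → ℝ) (P Q : MvPolynomial (Fin d) ℂ),
      LipschitzWith K F ∧ EqOn f F (cell s \ frontier Ω) ∧ P.totalDegree ≤ r ∧
      Q.totalDegree ≤ r ∧ (∀ x ∈ cell s, φ x = pev P x) ∧ ∀ t ⊆ s, ∀ w : E d → ℝ,
        ∑ v ∈ t, w v = 1 → pev Q (∑ v ∈ t, w v • v) =
          ∑ v ∈ t, ((w v * clamp (F v) : ℝ) : ℂ) * nodal r P (∑ v ∈ t, w v • v) v := by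
    intro s hs
    have hsub : cell s \ frontier Ω ⊆ Ω := by
      intro x hx
      by_contra hxΩ
      refine hx.2 ?_
      rw [hΩ.frontier_eq]
      exact ⟨T.cell_subset hs.1 hx.1, hxΩ⟩
    -- A Lipschitz extension supplies values at vertices on the frontier of Ω, where f carries no
    -- information. They may differ from element to element, for example on the two sides of a
    -- crack.
    obtain ⟨F, hF, hFf⟩ :=
      (hfL _ (convex_cell_diff_frontier T.aligned hs.1) hsub).extend_real
    obtain ⟨P, hP, hPφ⟩ := hφ.exists_poly hs.1
    obtain ⟨Q, hQ, hQP⟩ := exists_cutoff_poly hr (T.K.indep hs.1.1) hs.1.2 hP fun v => clamp (F v)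
    exact ⟨F, P, Q, hF, hFf, hP, hQ, hPφ, hQP⟩
  choose! F P Q hF hFf hP hQ hPφ hQP using hex
  have hmem : ∀ {t : Finset (E d)} {v : E d}, v ∈ t → v ∈ cell t := fun hv =>
    subset_convexHull ℝ _ hv
  have hmono : ∀ {s t : Finset (E d)}, t ⊆ s → cell t ⊆ cell s := fun h =>
    convexHull_mono (by exact_mod_cast h)
  have hweights : ∀ {t : Finset (E d)} {x : E d}, x ∈ cell t →
      ∃ w : E d → ℝ, ∑ v ∈ t, w v = 1 ∧ ∑ v ∈ t, w v • v = x := by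
    intro t x hx
    obtain ⟨w, -, h1, h2⟩ := Finset.mem_convexHull'.1 hx
    exact ⟨w, h1, h2⟩
  -- on faces in the boundary of the domain
  have hbdry : ∀ s ∈ T.inner W, ∀ t ⊆ s, cell t ⊆ frontier Ω → ∀ x ∈ cell t,
      pev (Q s) x = 0 := by
    intro s hs t hts htΩ x hx
    obtain ⟨w, hw1, rfl⟩ := hweights hx
    rw [hQP s hs t hts w hw1]
    refine Finset.sum_eq_zero fun v hv => ?_
    rw [nodal_eq_zero r (convex_convexHull ℝ (t : Set (E d))) (fun y hy => ?_) hx (hmem hv),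
      mul_zero]
    rw [← hPφ s hs y (hmono hts hy), hφ0 y (htΩ hy)]
  have hcons : ∀ s ∈ T.inner W, ∀ s' ∈ T.inner W, ∀ x ∈ cell s, x ∈ cell s' →
      pev (Q s) x = pev (Q s') x := by
    intro s hs s' hs' x hx hx'
    have hxt : x ∈ cell (s ∩ s') := by
      have := T.K.inter_subset_convexHull hs.1.1 hs'.1.1 ⟨hx, hx'⟩
      simpa [cell] using this
    by_cases htΩ : cell (s ∩ s') ⊆ frontier Ω
    · rw [hbdry s hs _ Finset.inter_subset_left htΩ x hxt,
        hbdry s' hs' _ Finset.inter_subset_right htΩ x hxt]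
    -- The points of the common face off the frontier of Ω are dense in it; both extensions equal f
    -- there, hence agree on the face by continuity.
    · have hcl := subset_closure_diff_frontier T.aligned hs.1 Finset.inter_subset_left htΩ
      have hFF : ∀ v ∈ cell (s ∩ s'), F s v = F s' v := by
        intro v hv
        refine closure_minimal (s := cell (s ∩ s') \ frontier Ω) (t := {v | F s v = F s' v}) ?_
          (isClosed_eq (hF s hs).continuous (hF s' hs').continuous) (hcl hv)
        intro z hz
        show F s z = F s' z
        rw [← hFf s hs ⟨hmono Finset.inter_subset_left hz.1, hz.2⟩,
          ← hFf s' hs' ⟨hmono Finset.inter_subset_right hz.1, hz.2⟩]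
      obtain ⟨w, hw1, rfl⟩ := hweights hxt
      rw [hQP s hs _ Finset.inter_subset_left w hw1, hQP s' hs' _ Finset.inter_subset_right w hw1]
      refine Finset.sum_congr rfl fun v hv => ?_
      rw [hFF v (hmem hv), nodal_eq_of_eqOn r (convex_convexHull ℝ _) (fun y hy => ?_) hxt
        (hmem hv)]
      rw [← hPφ s hs y (hmono Finset.inter_subset_left hy),
        ← hPφ s' hs' y (hmono Finset.inter_subset_right hy)]
  -- The same dichotomy: either φ vanishes on the face, or the extension vanishes on it by density,
  -- since f is zero on the frontier of W inside Ω.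
  have hzero : ∀ s ∈ T.inner W, ∀ x ∈ cell s, x ∈ frontier W → pev (Q s) x = 0 := by
    intro s hs x hx hxW
    obtain ⟨Γ, hΓ, -, hfr⟩ := id hal
    have hxW' := hxW
    rw [hfr] at hxW'
    obtain ⟨s₁, hs₁, hxs₁⟩ := mem_iUnion₂.1 hxW'
    have hs₁W : cell s₁ ⊆ frontier W := by
      rw [hfr]; exact subset_biUnion_of_mem (u := fun s : Finset (E d) => cell s) hs₁
    have hxt : x ∈ cell (s ∩ s₁) := by
      have := T.K.inter_subset_convexHull hs.1.1 (hΓ hs₁) ⟨hx, hxs₁⟩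
      simpa [cell] using this
    by_cases htΩ : cell (s ∩ s₁) ⊆ frontier Ω
    · exact hbdry s hs _ Finset.inter_subset_left htΩ x hxt
    · have hcl := subset_closure_diff_frontier T.aligned hs.1 Finset.inter_subset_left htΩ
      have hF0 : ∀ v ∈ cell (s ∩ s₁), F s v = 0 := by
        intro v hv
        refine closure_minimal (s := cell (s ∩ s₁) \ frontier Ω) (t := {v | F s v = 0}) ?_
          (isClosed_eq (hF s hs).continuous continuous_const) (hcl hv)
        intro z hz
        show F s z = 0
        rw [← hFf s hs ⟨hmono Finset.inter_subset_left hz.1, hz.2⟩]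
        exact hf0 z ⟨hs₁W (hmono Finset.inter_subset_right hz.1), hz.2⟩
      obtain ⟨w, hw1, rfl⟩ := hweights hxt
      rw [hQP s hs _ Finset.inter_subset_left w hw1]
      refine Finset.sum_eq_zero fun v hv => ?_
      rw [hF0 v (hmem hv), clamp_zero]
      simp
  obtain ⟨v, hv, hvQ, hv0⟩ := exists_isFE_of_inner hal hW hQ hcons hzero
  exact ⟨F, P, Q, v, hv, hv0, fun s hs => ⟨hF s hs, hFf s hs, hP s hs, hQ s hs, hPφ s hs,
    hvQ s hs, hQP s hs s subset_rfl⟩⟩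

end Mesh

theorem nonempty_compl_of_isBounded (hd : 1 ≤ d) {Ω : Set (E d)} (hΩ : Bornology.IsBounded Ω) :
    Ωᶜ.Nonempty := by
  have : Nonempty (Fin d) := ⟨⟨0, hd⟩⟩
  rw [nonempty_compl]
  rintro rfl
  exact NormedSpace.unbounded_univ ℝ (E d) hΩ

/-! ### The global cutoff estimate. -/

namespace Mesh

variable {Ω W : Set (E d)} {T : Mesh Ω} {r : ℕ}

theorem interior_cell_subset (T : Mesh Ω) (hΩ : IsOpen Ω) {s : Finset (E d)}
    (hs : s ∈ T.elements) : interior (cell s) ⊆ Ω := by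
  intro x hx
  by_contra hxΩ
  refine Set.disjoint_left.1 (disjoint_interior_frontier T.aligned hs) hx ?_
  rw [hΩ.frontier_eq]
  exact ⟨T.cell_subset hs (interior_subset hx), hxΩ⟩

/-- Integrals are sums over the elements. -/
theorem setIntegral_eq_sum (hΩ : IsOpen Ω) {g : E d → ℝ} (hg : IntegrableOn g Ω) :
    ∫ x in Ω, g x = ∑ s ∈ T.finite_elements.toFinset, ∫ x in interior (cell s), g x := by
  have hsub : ∀ s ∈ T.elements, interior (cell s) ⊆ Ω := fun s hs => T.interior_cell_subset hΩ hs
  have hae : Ω =ᵐ[volume] ⋃ s ∈ T.finite_elements.toFinset, interior (cell s) := by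
    refine Filter.EventuallyLE.antisymm ?_
      (LE.le.eventuallyLE (iUnion₂_subset fun s hs => hsub s (by simpa using hs)))
    have hnull : volume (⋃ s ∈ T.elements, frontier (cell s)) = 0 := by
      rw [measure_biUnion_null_iff T.finite_elements.countable]
      exact fun s _ => (convex_convexHull ℝ (s : Set (E d))).addHaar_frontier volume
    filter_upwards [measure_eq_zero_iff_ae_notMem.1 hnull] with x hx hxΩ
    have hxc := subset_closure hxΩ
    rw [T.closure_eq] at hxc
    obtain ⟨s, hs, hxs⟩ := mem_iUnion₂.1 hxc
    refine mem_iUnion₂.2 ⟨s, by simpa using hs, ?_⟩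
    by_contra hxi
    refine hx (mem_iUnion₂.2 ⟨s, hs, ?_⟩)
    rw [(isClosed_cell s).frontier_eq]
    exact ⟨hxs, hxi⟩
  rw [setIntegral_congr_set hae]
  refine integral_biUnion_finset _ (fun s _ => isOpen_interior.measurableSet) ?_ ?_
  · intro s hs s' hs' hne
    refine Set.disjoint_left.2 fun x hx hx' => hne ?_
    have h1 : s ∈ T.elements := by simpa using hs
    have h2 : s' ∈ T.elements := by simpa using hs'
    exact subset_antisymm (subset_of_mem_interior h1.1 h1.2 h2.1 hx (interior_subset hx'))
      (subset_of_mem_interior h2.1 h2.2 h1.1 hx' (interior_subset hx))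
  · exact fun s hs => hg.mono_set (hsub s (by simpa using hs))

/-- Quasi-interpolation of a cut off finite element function: it has zero boundary values on `W`
and differs from the given function only away from `G`. -/
theorem exists_cutoff_approx (hd : 1 ≤ d) (hr : 1 ≤ r) (hΩ : IsOpen Ω)
    (hΩb : Bornology.IsBounded Ω) {G : Set (E d)} (hW : IsOpen W) (hG : IsOpen G) (hWΩ : W ⊆ Ω)
    (hGW : CInside Ω G W) {κ : ℝ} (hκ : 0 < κ) :
    ∃ C : ℝ, 0 ≤ C ∧ ∀ T : Mesh Ω, T.ShapeRegular κ → AlignedWith T.K W → ∀ φ ∈ T.V0 r Ω,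
      ∃ v, v ∈ T.V0 r W ∧ v ∈ T.V0 r Ω ∧ (∀ x ∉ W, v x = 0) ∧
        norm1 Ω (v - φ) ≤ C * norm1 (Ω \ closure G) φ := by
  classical
  obtain ⟨hGsub, δ, hδ, hdist⟩ := hGW
  obtain ⟨f, hf1, hf0, hfL⟩ := exists_cutoff_function hΩ hW hG hGsub hδ hdist
  obtain ⟨C₁, hC₁, hest⟩ := exists_cutoff_estimate hd hr hκ hδ
    (B := Metric.diam (closure Ω) + 1) (by positivity)
  -- The constant C₁ serves the elements inside W; the 1 serves the others, where v = 0 and the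
  -- error is φ itself.
  set C := max 1 C₁ with hC
  have hC0 : 0 ≤ C := zero_le_one.trans (le_max_left _ _)
  have hΩc := nonempty_compl_of_isBounded hd hΩb
  refine ⟨√C, Real.sqrt_nonneg _, fun T hT hal φ hφ => ?_⟩
  have hφFE := isFE_of_mem_V0 hφ
  have hφ0 : ∀ x ∈ frontier Ω, φ x = 0 := fun x hx =>
    hφFE.eq_zero_of_mem_frontier T.aligned hΩ subset_closure hΩb hφ.2 hx
  obtain ⟨F, P, Q, v, hv, hv0, hin⟩ := exists_isFE_cutoff hr hΩ hW hal hf0 hfL hφFE hφ0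
  have hvW := hv.mem_V0 hΩ hΩb hΩc hW hWΩ hv0
  have hvΩ := hv.mem_V0 hΩ hΩb hΩc hΩ subset_rfl fun x hx => hv0 x fun h => hx (hWΩ h)
  refine ⟨v, hvW, hvΩ, hv0, ?_⟩
  have hη : MemH1 Ω (v - φ) := hvΩ.2.1.sub hφ.2.1
  have hsub : Ω \ closure G ⊆ Ω := sdiff_subset
  have hopen : IsOpen (Ω \ closure G) := hΩ.sdiff isClosed_closure
  have hφg := (hφ.2.1.hasGrad.mono hΩ.measurableSet hsub).norm1_sq hopen
    (hφ.2.1.1.mono_measure (Measure.restrict_mono hsub le_rfl))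
  have hintη := hη.integrableOn_dens
  have hintφ := hφ.2.1.integrableOn_dens
  have hms : MeasurableSet (closure G)ᶜ := isClosed_closure.isOpen_compl.measurableSet
  suffices hsq : norm1 Ω (v - φ) ^ 2 ≤ C * norm1 (Ω \ closure G) φ ^ 2 by
    have h1 := Real.sqrt_le_sqrt hsq
    rwa [Real.sqrt_sq (norm1_nonneg _ _), Real.sqrt_mul hC0, Real.sqrt_sq (norm1_nonneg _ _)] at h1
  rw [hφg, hη.norm1_sq, sdiff_eq, ← setIntegral_indicator hms, T.setIntegral_eq_sum hΩ hintη,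
    T.setIntegral_eq_sum hΩ (hintφ.indicator hms), Finset.mul_sum]
  refine Finset.sum_le_sum fun s hs => ?_
  have hse : s ∈ T.elements := by simpa using hs
  rw [setIntegral_indicator hms]
  set V := interior (cell s) with hV
  have hVo : IsOpen V := isOpen_interior
  have hVb : Bornology.IsBounded V := (isCompact_cell s).isBounded.subset interior_subset
  have hVΩ : V ⊆ Ω := T.interior_cell_subset hΩ hse
  have hdens : ∀ {w : E d → ℂ} {p : MvPolynomial (Fin d) ℂ}, MemH1 Ω w →
      (∀ x ∈ cell s, w x = pev p x) → dens w (weakGrad Ω w) =ᵐ[vol V] pdens p := by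
    intro w p hw hwp
    refine dens_ae_eq ?_ (weakGrad_ae_eq_pev hΩ hVo hVΩ hw
      (fun x hx => hwp x (interior_subset hx)) hVb)
    rw [Filter.EventuallyEq, ae_restrict_iff' hVo.measurableSet]
    exact Filter.Eventually.of_forall fun x hx => hwp x (interior_subset hx)
  have hnn : 0 ≤ ∫ x in V ∩ (closure G)ᶜ, dens φ (weakGrad Ω φ) x :=
    integral_nonneg fun x => dens_nonneg _ _ _
  by_cases hsW : s ∈ T.inner W
  · obtain ⟨hFL, hFf, hPd, hQd, hPφ, hQv, hQP⟩ := hin s hsW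
    have hηp : ∀ x ∈ cell s, (v - φ) x = pev (Q s - P s) x := fun x hx => by
      rw [Pi.sub_apply, hPφ x hx, hQv x hx, pev_sub]
    rw [integral_congr_ae (hdens hη hηp),
      integral_congr_ae (ae_restrict_of_ae_restrict_of_subset inter_subset_left
        (hdens hφ.2.1 hPφ))]
    have hdiam : Metric.diam (cell s) ≤ Metric.diam (closure Ω) + 1 :=
      (Metric.diam_mono (T.cell_subset hse) hΩb.closure).trans (by linarith)
    refine (hest s (T.K.indep hse.1) hse.2 hdiam (hT s hse) (F s) hFL (P s) (Q s) hPd hQd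
      hQP).trans ?_
    -- The left-hand side is open, so meeting closure G it would meet G, where the cutoff function
    -- is one.
    have hsubset : V ∩ {x | F s x < 1} ⊆ V ∩ (closure G)ᶜ := by
      have hO : IsOpen (V ∩ {x | F s x < 1}) :=
        hVo.inter (isOpen_lt hFL.continuous continuous_const)
      refine fun x hx => ⟨hx.1, fun hxG => ?_⟩
      obtain ⟨z, ⟨hzV, hzF⟩, hzG⟩ := mem_closure_iff.1 hxG _ hO hx
      have hzΩ : z ∉ frontier Ω :=
        Set.disjoint_left.1 (disjoint_interior_frontier T.aligned hse) hzV
      have h1 : F s z < 1 := hzF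
      rw [← hFf ⟨interior_subset hzV, hzΩ⟩, hf1 z hzG] at h1
      exact lt_irrefl _ h1
    have hintV : IntegrableOn (pdens (P s)) V :=
      (hintφ.mono_set hVΩ).congr (hdens hφ.2.1 hPφ)
    have hintP := hintV.mono_set (inter_subset_left (t := (closure G)ᶜ))
    have h2 : ∫ x in V ∩ {x | F s x < 1}, pdens (P s) x ≤
        ∫ x in V ∩ (closure G)ᶜ, pdens (P s) x :=
      setIntegral_mono_set hintP (Filter.Eventually.of_forall fun x => pdens_nonneg _ x)
        (Filter.Eventually.of_forall hsubset)
    calc _ ≤ C₁ * ∫ x in V ∩ (closure G)ᶜ, pdens (P s) x := mul_le_mul_of_nonneg_left h2 hC₁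
      _ ≤ _ := mul_le_mul_of_nonneg_right (le_max_right _ _)
        (integral_nonneg fun x => pdens_nonneg _ x)
  · obtain ⟨p, -, hp⟩ := hφFE.exists_poly hse
    have hdisj : Disjoint V W :=
      (interior_subset_or_disjoint hal hW hse).resolve_left fun h => hsW ⟨hse, h⟩
    have hVG : V ∩ (closure G)ᶜ = V := by
      refine inter_eq_left.2 fun x hx hxG => ?_
      obtain ⟨z, hzV, hzG⟩ := mem_closure_iff.1 hxG V hVo hx
      exact Set.disjoint_left.1 hdisj hzV (hGsub hzG)
    rw [hVG] at hnn ⊢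
    have hηφ : ∫ x in V, dens (v - φ) (weakGrad Ω (v - φ)) x =
        ∫ x in V, dens φ (weakGrad Ω φ) x := by
      have h1 : ∀ x ∈ cell s, (v - φ) x = pev (-p) x := by
        intro x hx
        have : x ∉ W := fun hxW => hsW (mem_inner_of_mem hal hW hse hx hxW)
        rw [Pi.sub_apply, hv0 x this, hp x hx]
        simp [pev]
      rw [integral_congr_ae (hdens hη h1), integral_congr_ae (hdens hφ.2.1 hp)]
      refine integral_congr_ae (Filter.Eventually.of_forall fun x => ?_)
      simp [pdens, dens, pev]
    rw [hηφ]
    exact le_mul_of_one_le_left hnn (le_max_left _ _)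

end Mesh

/-! ### Extension of local finite element functions by zero. -/

namespace Mesh

variable {Ω W : Set (E d)} {T : Mesh Ω} {r : ℕ}

theorem size_nonneg (T : Mesh Ω) : 0 ≤ T.size :=
  Real.sSup_nonneg fun _ ⟨_, _, h⟩ => h ▸ Metric.diam_nonneg

theorem add_mem_V0 (hΩ : IsOpen Ω) {v w : E d → ℂ} (hv : v ∈ T.V0 r Ω) (hw : w ∈ T.V0 r Ω) :
    v + w ∈ T.V0 r Ω :=
  ⟨⟨v + w, (isFE_of_mem_V0 hv).add (isFE_of_mem_V0 hw), fun _ _ => rfl⟩, hv.2.add hΩ hw.2⟩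

theorem sub_mem_V0 (hΩ : IsOpen Ω) {v w : E d → ℂ} (hv : v ∈ T.V0 r Ω) (hw : w ∈ T.V0 r Ω) :
    v - w ∈ T.V0 r Ω :=
  ⟨⟨v - w, (isFE_of_mem_V0 hv).sub (isFE_of_mem_V0 hw), fun _ _ => rfl⟩, hv.2.sub hΩ hw.2⟩

/-- The extension by zero of a local finite element function with zero boundary values. -/
theorem indicator_mem_V0 (hΩ : IsOpen Ω) (hΩb : Bornology.IsBounded Ω) (hΩc : Ωᶜ.Nonempty)
    (hW : IsOpen W) (hWΩ : W ⊆ Ω) (hal : AlignedWith T.K W) {e : E d → ℂ} (he : e ∈ T.V0 r W) :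
    (∀ x ∉ W, (closure W).indicator e x = 0) ∧ (closure W).indicator e ∈ T.V0 r W ∧
      (closure W).indicator e ∈ T.V0 r Ω := by
  obtain ⟨⟨w, hw, hew⟩, heH⟩ := he
  have hae : e =ᵐ[vol W] w := by
    rw [Filter.EventuallyEq, ae_restrict_iff' hW.measurableSet]
    exact Filter.Eventually.of_forall fun x hx => hew (subset_closure hx)
  have hwH : MemH10 W w := heH.congr hW hae
  have hWcΩ : W ⊆ closure Ω := hWΩ.trans subset_closure
  have hwpoly : ∀ s ∈ T.inner W, ∃ p : MvPolynomial (Fin d) ℂ, p.totalDegree ≤ r ∧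
      ∀ x ∈ cell s, w x = pev p x := fun s hs => hw.exists_poly hs.1
  choose! q hq hqw using hwpoly
  -- The zero boundary values obtained from membership in H¹₀ make the pieces on W and the zero
  -- function outside fit together continuously.
  obtain ⟨v, hv, hvq, hv0⟩ := exists_isFE_of_inner hal hW hq
    (fun s hs s' hs' x hx hx' => by rw [← hqw s hs x hx, ← hqw s' hs' x hx'])
    (fun s hs x hx hxW => by
      rw [← hqw s hs x hx]
      exact hw.eq_zero_of_mem_frontier hal hW hWcΩ (hΩb.subset hWΩ) hwH hxW)
  have hev : (closure W).indicator e = v := by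
    ext x
    by_cases hx : x ∈ closure W
    · rw [indicator_of_mem hx, hew hx]
      rw [closure_eq_inner hal hW hWcΩ] at hx
      obtain ⟨s, hs, hxs⟩ := mem_iUnion₂.1 hx
      rw [hqw s hs x hxs, hvq s hs x hxs]
    · rw [indicator_of_notMem hx, hv0 x fun h => hx (subset_closure h)]
  rw [hev]
  exact ⟨hv0, hv.mem_V0 hΩ hΩb hΩc hW hWΩ hv0,
    hv.mem_V0 hΩ hΩb hΩc hΩ subset_rfl fun x hx => hv0 x fun h => hx (hWΩ h)⟩

end Mesh

/-! ### The energy argument for one correction step. -/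

/-- A coercivity argument. -/
theorem norm1_sub_le_of_coercive {Ω : Set (E d)} (hΩ : IsOpen Ω) {𝒞 : Coeffs d} {a₀ : ℝ}
    (h𝒞 : Admissible Ω 𝒞 a₀) {M γ : ℝ} {v η : E d → ℂ} (hv : MemH1 Ω v) (hη : MemH1 Ω η)
    (h : ‖aForm 𝒞 Ω v v‖ ≤ M * (γ * norm1 Ω v) + M * (norm1 Ω η * norm1 Ω v)) (hM : 0 ≤ M)
    (hγ : 0 ≤ γ) :
    norm1 Ω (v - η) ≤ 2 * (2 / a₀ * M + 1) * (γ + norm1 Ω η) := by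
  have ha := h𝒞.a₀_pos
  have hc := h𝒞.coercive v hv
  have hn := norm1_nonneg Ω v
  have hη0 := norm1_nonneg Ω η
  have h1 : a₀ / 2 * norm1 Ω v ^ 2 ≤ M * (γ + norm1 Ω η) * norm1 Ω v := by
    have := (Complex.re_le_norm _).trans h
    nlinarith
  have h2 : norm1 Ω v ≤ 2 / a₀ * M * (γ + norm1 Ω η) := by
    rcases hn.eq_or_lt with h0 | h0
    · rw [← h0]; positivity
    · have h3 : a₀ / 2 * norm1 Ω v ≤ M * (γ + norm1 Ω η) := by
        refine le_of_mul_le_mul_right ?_ h0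
        calc _ = a₀ / 2 * norm1 Ω v ^ 2 := by ring
          _ ≤ _ := h1
      calc norm1 Ω v = 2 / a₀ * (a₀ / 2 * norm1 Ω v) := by field_simp
        _ ≤ 2 / a₀ * (M * (γ + norm1 Ω η)) := mul_le_mul_of_nonneg_left h3 (by positivity)
        _ = _ := by ring
  have h4 : norm1 Ω (v - η) ≤ 2 * (norm1 Ω v + norm1 Ω η) := by
    have h5 := norm1_add_le hΩ hv (hη.const_smul (-1))
    rw [norm1_const_smul hΩ hη, norm_neg, norm_one, one_mul, neg_smul, one_smul,
      ← sub_eq_add_neg] at h5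
    exact h5
  nlinarith

/-- One step of local defect correction, for the given problem and its adjoint. -/
theorem exists_local_correction_estimate (hd : 1 ≤ d) {r : ℕ} (hr : 1 ≤ r) {Ω W G : Set (E d)}
    (hΩ : IsOpen Ω) (hΩb : Bornology.IsBounded Ω) (hW : IsOpen W) (hG : IsOpen G) (hWΩ : W ⊆ Ω)
    (hGW : CInside Ω G W) {𝒞 : Coeffs d} {a₀ : ℝ} (h𝒞 : Admissible Ω 𝒞 a₀) {κ : ℝ} (hκ : 0 < κ) :
    ∃ C : ℝ, 0 < C ∧ ∀ T : Mesh Ω, T.ShapeRegular κ → AlignedWith T.K W →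
      ∀ U ∈ T.V0 r Ω, ∀ e ∈ T.V0 r W, ∀ (lam lam₀ : ℂ) (u₀ p : E d → ℂ),
      ((∀ v ∈ T.V0 r W, aForm 𝒞 W e v = lam * bForm 𝒞 W U v - aForm 𝒞 W U v) →
        IsEigen 𝒞 Ω lam₀ u₀ → T.IsRitz r 𝒞 u₀ p →
        norm1 Ω (U + (closure W).indicator e - p) ≤
          C * (norm0 Ω (lam • U - lam₀ • u₀) + norm1 (Ω \ closure G) (U - p))) ∧
      ((∀ v ∈ T.V0 r W, aForm 𝒞 W v e = conj lam * bForm 𝒞 W v U - aForm 𝒞 W v U) →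
        IsAdjEigen 𝒞 Ω lam₀ u₀ → T.IsAdjRitz r 𝒞 u₀ p →
        norm1 Ω (U + (closure W).indicator e - p) ≤
          C * (norm0 Ω (lam • U - lam₀ • u₀) + norm1 (Ω \ closure G) (U - p))) := by
  obtain ⟨C₁, hC₁, happrox⟩ := Mesh.exists_cutoff_approx hd hr hΩ hΩb hW hG hWΩ hGW hκ
  obtain ⟨A, hA, hAle⟩ := h𝒞.exists_norm_aForm_le
  obtain ⟨B, hB, hBle⟩ := h𝒞.exists_norm_bForm_le
  have ha := h𝒞.a₀_pos
  have hΩc := nonempty_compl_of_isBounded hd hΩb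
  set M := A + B with hM
  have hM0 : 0 ≤ M := add_nonneg hA hB
  set C₂ := 2 * (2 / a₀ * M + 1) with hC₂
  have hC₂0 : 0 < C₂ := by positivity
  refine ⟨C₂ * (1 + C₁), by positivity, fun T hT hal U hU e he lam lam₀ u₀ p => ?_⟩
  have hnull := Mesh.volume_frontier_eq_zero hal
  obtain ⟨hē0, hēW, hēΩ⟩ := Mesh.indicator_mem_V0 hΩ hΩb hΩc hW hWΩ hal he
  set ē := (closure W).indicator e with hē
  have hēe : ē =ᵐ[vol W] e := by
    rw [Filter.EventuallyEq, ae_restrict_iff' hW.measurableSet]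
    exact Filter.Eventually.of_forall fun x hx => indicator_of_mem (subset_closure hx) e
  -- the decomposition of the error
  have hdec : ∀ p ∈ T.V0 r Ω, ∃ v η, v ∈ T.V0 r W ∧ v ∈ T.V0 r Ω ∧ (∀ x ∉ W, v x = 0) ∧
      MemH1 Ω η ∧ U + ē - p = v - η ∧ norm1 Ω η ≤ C₁ * norm1 (Ω \ closure G) (U - p) := by
    intro p hp
    -- The part v₀ of U - p that fits into W joins the correction in v; the rest is the remainder η,
    -- which is controlled away from G.
    obtain ⟨v₀, hv₀W, hv₀Ω, hv₀0, hv₀⟩ := happrox T hT hal (U - p) (Mesh.sub_mem_V0 hΩ hU hp)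
    have hvΩ := Mesh.add_mem_V0 hΩ hēΩ hv₀Ω
    have hv0 : ∀ x ∉ W, (ē + v₀) x = 0 := fun x hx => by
      rw [Pi.add_apply, hē0 x hx, hv₀0 x hx, add_zero]
    refine ⟨ē + v₀, v₀ - (U - p), ?_, hvΩ, hv0, hv₀Ω.2.1.sub (hU.2.1.sub hp.2.1), ?_, hv₀⟩
    · exact (Mesh.isFE_of_mem_V0 hvΩ).mem_V0 hΩ hΩb hΩc hW hWΩ hv0
    · abel
  have hfin : ∀ {v η g : E d → ℂ}, MemH1 Ω v → MemH1 Ω η →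
      U + ē - p = v - η → norm1 Ω η ≤ C₁ * norm1 (Ω \ closure G) (U - p) →
      ‖aForm 𝒞 Ω v v‖ ≤ B * (norm0 Ω g * norm0 Ω v) + A * (norm1 Ω η * norm1 Ω v) →
      norm1 Ω (U + ē - p) ≤ C₂ * (1 + C₁) * (norm0 Ω g + norm1 (Ω \ closure G) (U - p)) := by
    intro v η g hv hη hE hηle hle
    have h0 := norm0_nonneg Ω g
    have h1 := norm1_nonneg Ω v
    have h2 := norm1_nonneg Ω η
    have h3 := norm1_nonneg (Ω \ closure G) (U - p)
    have h4 : B * (norm0 Ω g * norm0 Ω v) ≤ M * (norm0 Ω g * norm1 Ω v) :=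
      mul_le_mul (by linarith) (mul_le_mul_of_nonneg_left (norm0_le_norm1 Ω v) h0)
        (mul_nonneg h0 (norm0_nonneg _ _)) hM0
    have h5 : A * (norm1 Ω η * norm1 Ω v) ≤ M * (norm1 Ω η * norm1 Ω v) :=
      mul_le_mul_of_nonneg_right (by linarith) (mul_nonneg h2 h1)
    rw [hE]
    refine (norm1_sub_le_of_coercive hΩ h𝒞 hv hη (hle.trans (add_le_add h4 h5)) hM0 h0).trans ?_
    rw [← hC₂, mul_assoc C₂]
    refine mul_le_mul_of_nonneg_left ?_ hC₂0.le
    nlinarith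
  constructor
  · intro hcorr hu₀ hp
    obtain ⟨v, η, hvW, hvΩ, hv0, hη, hE, hηle⟩ := hdec p hp.1
    have hg : MemLp (lam • U - lam₀ • u₀) 2 (vol Ω) :=
      (hU.2.1.1.const_smul lam).sub (hu₀.1.1.1.const_smul lam₀)
    refine hfin hvΩ.2.1 hη hE hηle ?_
    have hv0' : ∀ x ∈ Ω \ closure W, v x = 0 := fun x hx => hv0 x fun h => hx.2 (subset_closure h)
    have e1 := hcorr v hvW
    rw [aForm_local_right hΩ hWΩ hW hnull hēΩ.2.1 hvΩ.2.1 hv0' hēe Filter.EventuallyEq.rfl,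
      aForm_local_right hΩ hWΩ hW hnull hU.2.1 hvΩ.2.1 hv0' Filter.EventuallyEq.rfl
        Filter.EventuallyEq.rfl,
      bForm_local hΩ hWΩ hW (fun x hx => Or.inr (hv0 x hx.2)) Filter.EventuallyEq.rfl
        Filter.EventuallyEq.rfl] at e1
    have e2 := hp.2 v hvΩ
    rw [h𝒞.aForm_sub_left hΩ hu₀.1.1 hp.1.2.1 hvΩ.2.1, hu₀.2 v hvΩ.2] at e2
    -- The terms a(U, v) cancel between the defect and the error, and the Ritz property replaces
    -- a(p, v) by λ₀ b(u₀, v).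
    have e3 : aForm 𝒞 Ω (U + ē - p) v = bForm 𝒞 Ω (lam • U - lam₀ • u₀) v := by
      rw [h𝒞.aForm_sub_left hΩ (hU.2.1.add hēΩ.2.1) hp.1.2.1 hvΩ.2.1,
        h𝒞.aForm_add_left hΩ hU.2.1 hēΩ.2.1 hvΩ.2.1,
        h𝒞.bForm_sub_left hU.2.1.1 hu₀.1.1.1 hvΩ.2.1.1]
      linear_combination e1 + e2
    -- With v as its own test function the identity reads a(v, v) = b(g, v) + a(η, v).
    rw [hE, h𝒞.aForm_sub_left hΩ hvΩ.2.1 hη hvΩ.2.1, sub_eq_iff_eq_add] at e3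
    rw [e3]
    exact (norm_add_le _ _).trans
      (add_le_add (hBle _ _ hg hvΩ.2.1.1) (hAle _ _ hη hvΩ.2.1))
  · intro hcorr hu₀ hp
    obtain ⟨v, η, hvW, hvΩ, hv0, hη, hE, hηle⟩ := hdec p hp.1
    have hg : MemLp (lam • U - lam₀ • u₀) 2 (vol Ω) :=
      (hU.2.1.1.const_smul lam).sub (hu₀.1.1.1.const_smul lam₀)
    refine hfin hvΩ.2.1 hη hE hηle ?_
    have hv0' : ∀ x ∈ Ω \ closure W, v x = 0 := fun x hx => hv0 x fun h => hx.2 (subset_closure h)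
    have e1 := hcorr v hvW
    rw [aForm_local_left hΩ hWΩ hW hnull hēΩ.2.1 hvΩ.2.1 hv0' hēe Filter.EventuallyEq.rfl,
      aForm_local_left hΩ hWΩ hW hnull hU.2.1 hvΩ.2.1 hv0' Filter.EventuallyEq.rfl
        Filter.EventuallyEq.rfl,
      bForm_local hΩ hWΩ hW (fun x hx => Or.inl (hv0 x hx.2)) Filter.EventuallyEq.rfl
        Filter.EventuallyEq.rfl] at e1
    have e2 := hp.2 v hvΩ
    rw [h𝒞.aForm_sub_right hΩ hu₀.1.1 hp.1.2.1 hvΩ.2.1, hu₀.2 v hvΩ.2] at e2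
    -- Conjugate linearity in the second slot of b matches the conjugated factors of the adjoint
    -- equations.
    have e3 : aForm 𝒞 Ω v (U + ē - p) = bForm 𝒞 Ω v (lam • U - lam₀ • u₀) := by
      rw [h𝒞.aForm_sub_right hΩ (hU.2.1.add hēΩ.2.1) hp.1.2.1 hvΩ.2.1,
        h𝒞.aForm_add_right hΩ hU.2.1 hēΩ.2.1 hvΩ.2.1,
        h𝒞.bForm_sub_right hU.2.1.1 hu₀.1.1.1 hvΩ.2.1.1]
      linear_combination e1 + e2
    rw [hE, h𝒞.aForm_sub_right hΩ hvΩ.2.1 hη hvΩ.2.1, sub_eq_iff_eq_add] at e3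
    rw [e3]
    refine (norm_add_le _ _).trans (add_le_add ?_ ?_)
    · rw [mul_comm (norm0 Ω _)]
      exact hBle _ _ hvΩ.2.1.1 hg
    · rw [mul_comm (norm1 Ω η)]
      exact hAle _ _ hvΩ.2.1 hη

/-- The iterates of the scheme are finite element functions with zero boundary values. -/
theorem IsSchemeRun.mem_V0 {𝒞 : Coeffs d} {Ω : Set (E d)} {r : ℕ} {β : ℝ} {l : ℤ}
    {W : ℤ → Set (E d)} {T : ℤ → Mesh Ω} {lam lamS : ℤ → ℂ} {u uS e eS : ℤ → E d → ℂ}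
    (h : IsSchemeRun 𝒞 Ω r β l W T lam lamS u uS e eS) (hΩ : IsOpen Ω)
    (hΩb : Bornology.IsBounded Ω) (hΩc : Ωᶜ.Nonempty)
    (hWo : ∀ i, 1 ≤ i → i ≤ l → IsOpen (W i)) (hWΩ : ∀ i, 1 ≤ i → i ≤ l → W i ⊆ Ω)
    (hT : ∀ i, 0 ≤ i → i ≤ l → (T (i - 1)).V0 r Ω ⊆ (T i).V0 r Ω)
    (hal : ∀ i, 1 ≤ i → i ≤ l → AlignedWith (T i).K (W i)) :
    ∀ i, 0 ≤ i → i ≤ l → u i ∈ (T i).V0 r Ω ∧ uS i ∈ (T i).V0 r Ω := by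
  intro i hi
  induction i, hi using Int.leInduction with
  | base => exact fun _ => ⟨h.meso_mem, h.meso_adj_mem⟩
  | succ i hi ih =>
    intro hil
    have h1 : 1 ≤ i + 1 := by omega
    have ih := ih (by omega)
    have hsub := hT (i + 1) (by omega) hil
    have e1 := h.update (i + 1) h1 hil
    have e2 := h.update_adj (i + 1) h1 hil
    simp only [add_sub_cancel_right] at hsub e1 e2
    rw [e1, e2]
    exact ⟨Mesh.add_mem_V0 hΩ (hsub ih.1) (Mesh.indicator_mem_V0 hΩ hΩb hΩc (hWo _ h1 hil)
        (hWΩ _ h1 hil) (hal _ h1 hil) (h.corr_mem _ h1 hil)).2.2,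
      Mesh.add_mem_V0 hΩ (hsub ih.2) (Mesh.indicator_mem_V0 hΩ hΩb hΩc (hWo _ h1 hil)
        (hWΩ _ h1 hil) (hal _ h1 hil) (h.corr_adj_mem _ h1 hil)).2.2⟩

end MultilevelFEM

end

/-! ### The multilevel estimate. -/

open MultilevelFEM in
theorem theorem4p2 {d : ℕ} (hd : 2 ≤ d)
    -- the domain, the operator, the polynomial degree and the regularity exponents
    (Ω : Set (E d)) (hΩo : IsOpen Ω) (hΩc : IsConnected Ω) (hΩb : Bornology.IsBounded Ω)
    (𝒞 : Coeffs d) (a₀ : ℝ) (h𝒞 : Admissible Ω 𝒞 a₀)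
    (r : ℕ) (hr : 1 ≤ r) (γ₁ γ₂ : ℝ) (hγ₁ : 0 < γ₁ ∧ γ₁ ≤ 1) (hγ₂ : 0 < γ₂ ∧ γ₂ ≤ 1)
    -- the eigenvalue
    (lam₀ : ℂ)
    -- the subdomains `Ω ⊇ Ω_1 ⊇ … ⊇ Ω_l` and `D ⊂⊂ F ⊂⊂ G_i ⊂⊂ Ω_i`
    (l : ℤ) (hl : 1 ≤ l) (W G : ℤ → Set (E d)) (D F : Set (E d))
    (hDo : IsOpen D) (hFo : IsOpen F)
    (hWo : ∀ i, 1 ≤ i → i ≤ l → IsOpen (W i)) (hGo : ∀ i, 1 ≤ i → i ≤ l → IsOpen (G i))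
    (hWΩ : ∀ i, 1 ≤ i → i ≤ l → W i ⊆ Ω)
    (hWW : ∀ i, 1 ≤ i → i < l → W (i + 1) ⊆ W i)
    (hDF : CInside Ω D F) (hFG : ∀ i, 1 ≤ i → i ≤ l → CInside Ω F (G i))
    (hGW : ∀ i, 1 ≤ i → i ≤ l → CInside Ω (G i) (W i))
    -- the local regularity assumption
    (hR : ∀ i, 1 ≤ i → i ≤ l → LocalRegularity 𝒞 γ₁ γ₂ (W i))
    -- the constants of shape regularity, of the mesh size condition, and of the coarse pairing
    (κ ν C₀ β : ℝ) (hκ : 0 < κ) (hν : 1 ≤ ν) (hC₀ : 0 < C₀) (hβ : 0 < β) :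
    ∃ C : ℝ, 0 < C ∧
      ∀ T : ℤ → Mesh Ω,
        (∀ i, -1 ≤ i → i ≤ l → (T i).ShapeRegular κ ∧ (T i).SizeCondition ν C₀) →
        (∀ i, 0 ≤ i → i ≤ l → (T (i - 1)).V0 r Ω ⊆ (T i).V0 r Ω) →
        (∀ i, 1 ≤ i → i ≤ l →
          AlignedWith (T (i - 1)).K (W i) ∧ AlignedWith (T i).K (W i)) →
        ∀ (lam lamS : ℤ → ℂ) (u uS e eS : ℤ → E d → ℂ),
          IsSchemeRun 𝒞 Ω r β l W T lam lamS u uS e eS →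
          (∀ u₀ p : E d → ℂ, IsEigen 𝒞 Ω lam₀ u₀ → (T l).IsRitz r 𝒞 u₀ p →
            norm1 Ω (u l - p) ≤ C *
              (norm0 (W l) (u₀ - p)
                + (T (l - 1)).size ^ γ₂ * norm1 (W l) (p - u (l - 1))
                + norm0 (W l) (lam₀ • u₀ - lam (l - 2) • u (l - 2))
                + norm0 Ω (lam (l - 1) • u (l - 1) - lam₀ • u₀)
                + norm1 (Ω \ closure (G l)) (u (l - 1) - p)
                + norm1 (W l \ closure F) (u (l - 1) - u₀))) ∧
          (∀ u₀S pS : E d → ℂ, IsAdjEigen 𝒞 Ω (starRingEnd ℂ lam₀) u₀S →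
            (T l).IsAdjRitz r 𝒞 u₀S pS →
            norm1 Ω (uS l - pS) ≤ C *
              (norm0 (W l) (u₀S - pS)
                + (T (l - 1)).size ^ γ₁ * norm1 (W l) (pS - uS (l - 1))
                + norm0 (W l) (starRingEnd ℂ lam₀ • u₀S - lamS (l - 2) • uS (l - 2))
                + norm0 Ω (lamS (l - 1) • uS (l - 1) - starRingEnd ℂ lam₀ • u₀S)
                + norm1 (Ω \ closure (G l)) (uS (l - 1) - pS)
                + norm1 (W l \ closure F) (uS (l - 1) - u₀S))) := by
  -- Only the last correction enters, so the constant is that of a single step on Ω_l.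
  obtain ⟨C, hC, hmain⟩ := exists_local_correction_estimate (by omega) hr hΩo hΩb
    (hWo l hl le_rfl) (hGo l hl le_rfl) (hWΩ l hl le_rfl) (hGW l hl le_rfl) h𝒞 hκ
  refine ⟨C, hC, fun T hT hTT hTW lam lamS u uS e eS hrun => ?_⟩
  have hΩc' := nonempty_compl_of_isBounded (by omega) hΩb
  -- For l = 1 this is the mesoscopic level; nestedness then places the iterate in the space of
  -- level l.
  have hU := hrun.mem_V0 hΩo hΩb hΩc' hWo hWΩ hTT (fun i h1 h2 => (hTW i h1 h2).2)
    (l - 1) (by omega) (by omega)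
  have hsub := hTT l (by omega) le_rfl
  have hstep := hmain (T l) (hT l (by omega) le_rfl).1 (hTW l hl le_rfl).2
  have hsize : ∀ γ : ℝ, 0 ≤ (T (l - 1)).size ^ γ := fun γ =>
    Real.rpow_nonneg (T (l - 1)).size_nonneg γ
  constructor
  · intro u₀ p hu₀ hp
    rw [hrun.update l hl le_rfl]
    refine ((hstep _ (hsub hU.1) _ (hrun.corr_mem l hl le_rfl) (lam (l - 1)) lam₀ u₀ p).1
      (hrun.corr_eq l hl le_rfl) hu₀ hp).trans (mul_le_mul_of_nonneg_left ?_ hC.le)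
    -- The step estimate already supplies the fourth and fifth terms of the bound; the other four
    -- need only be nonnegative.
    have h1 := norm0_nonneg (W l) (u₀ - p)
    have h2 := mul_nonneg (hsize γ₂) (norm1_nonneg (W l) (p - u (l - 1)))
    have h3 := norm0_nonneg (W l) (lam₀ • u₀ - lam (l - 2) • u (l - 2))
    have h4 := norm1_nonneg (W l \ closure F) (u (l - 1) - u₀)
    linarith
  · intro u₀ p hu₀ hp
    rw [hrun.update_adj l hl le_rfl]
    refine ((hstep _ (hsub hU.2) _ (hrun.corr_adj_mem l hl le_rfl) (lamS (l - 1))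
      (starRingEnd ℂ lam₀) u₀ p).2 (hrun.corr_adj_eq l hl le_rfl) hu₀ hp).trans
      (mul_le_mul_of_nonneg_left ?_ hC.le)
    have h1 := norm0_nonneg (W l) (u₀ - p)
    have h2 := mul_nonneg (hsize γ₁) (norm1_nonneg (W l) (p - uS (l - 1)))
    have h3 := norm0_nonneg (W l) (starRingEnd ℂ lam₀ • u₀ - lamS (l - 2) • uS (l - 2))
    have h4 := norm1_nonneg (W l \ closure F) (uS (l - 1) - u₀)
    linarith
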